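/- Let $l\in\{\tfrac12,\tfrac32,\tfrac52,\dots\}$ and let $\tilde{\mathfrak g}=\tilde{\mathfrak g}^{(l)}$ be the complex Lie algebra with basis $e,h,f,z,p_0,\dots,p_{2l}$ and brackets $[h,e]=2e$, $[h,f]=-2f$, $[e,f]=h$, $[h,p_k]=2(l-k)p_k$, $[e,p_k]=kp_{k-1}$, $[f,p_k]=(2l-k)p_{k+1}$, $z$ central, and $[p_k,p_{k'}]=\delta_{k+k',2l}(-1)^{k+l+\frac12}k!(2l-k)!\,z$. Let $\mathfrak{sl}_2=\mathrm{span}(e,h,f)$, $\tilde H=\mathrm{span}(p_0,\dots,p_{2l},z)$, and $\mathfrak b=\mathrm{span}(h,z,e,p_k\,:\,k<l)$. For $\dot z,\dot h\in\mathbb C$ the Verma module $M_{\tilde{\mathfrak g}}(\dot z,\dot h)$ is the $\tilde{\mathfrak g}$-module induced from the one-dimensional $\mathfrak b$-module on which $z$ acts by $\dot z$, $h$ by $\dot h$, and $e$ and the $p_k$, $k<l$, by $0$. Similarly, $M_{\mathfrak{sl}_2}(\lambda)$ is induced from the one-dimensional module over $\mathfrak b\cap\mathfrak{sl}_2=\mathrm{span}(h,e)$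 with $h\mapsto\lambda$, $e\mapsto0$, and $M_{\tilde H}(\dot z)$ is induced from the one-dimensional module over $\mathfrak b\cap\tilde H=\mathrm{span}(z,p_k\,:\,k<l)$ with $z\mapsto\dot z$, $p_k\mapsto0$. Let $\bar M_{\tilde{\mathfrak g}}(\dot z,\dot h)$ and $\bar M_{\mathfrak{sl}_2}(\lambda)$ be the unique simple quotients of the corresponding Verma modules, i.e. the quotients by the sum of all proper submodules. For an $\mathfrak{sl}_2$-module $N$ let $N^{\tilde{\mathfrak g}}$ be the $\tilde{\mathfrak g}$-module $N$ on which $\tilde H$ acts by $0$. For an $\tilde H$-module $V$ let $V^{\tilde{\mathfrak g}}$ be the localization $U(\tilde H)_{(z)}\otimes_{U(\tilde H)}V$, where $U(\tilde H)_{(z)}$ is the localization of $U(\tilde H)$ at the powers of $z$, regarded as a $\tilde{\mathfrak g}$-module through the algebra homomorphism $\Phi:U(\tilde{\mathfrak g})\to U(\tilde H)_{(z)}$ that is the identity on $\tilde H$ and maps $$e\mapsto\frac1z\sum_{k=1}^{2l}(-1)^{k+l+\frac12}\frac{l-k}{(k-1)!(2l-k)!}p_{k-1}p_{2l-k},\qquad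 f\mapsto\frac1z\sum_{k=1}^{2l}(-1)^{k+l-\frac12}\frac{l-k}{(k-1)!(2l-k)!}p_kp_{2l-k+1},$$ $$h\mapsto\frac2z\sum_{k=0}^{l-\frac12}(-1)^{k+l-\frac12}\frac{l-k}{k!(2l-k)!}p_{2l-k}p_k-\frac{(l+\frac12)^2}{2}.$$ Theorem. For all $\dot h\in\mathbb C$ and $\dot z\in\mathbb C\setminus\{0\}$ there are isomorphisms of $\tilde{\mathfrak g}$-modules $$M_{\tilde{\mathfrak g}}(\dot z,\dot h)\cong M_{\tilde H}(\dot z)^{\tilde{\mathfrak g}}\otimes M_{\mathfrak{sl}_2}\bigl(\dot h+\tfrac12(l+\tfrac12)^2\bigr)^{\tilde{\mathfrak g}},\qquad \bar M_{\tilde{\mathfrak g}}(\dot z,\dot h)\cong M_{\tilde H}(\dot z)^{\tilde{\mathfrak g}}\otimes \bar M_{\mathfrak{sl}_2}\bigl(\dot h+\tfrac12(l+\tfrac12)^2\bigr)^{\tilde{\mathfrak g}},$$ and $\bar M_{\tilde{\mathfrak g}}(\dot z,\dot h)$ is simple. Hence $M_{\tilde{\mathfrak g}}(\dot z,\dot h)$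 is simple if and only if $\dot h+\tfrac12(l+\tfrac12)^2$ is not a nonnegative integer. -/

import Mathlib

open scoped TensorProduct OreLocalization

noncomputable section

namespace Galilei

/-! ### The conformal Galilei algebra

Throughout `n : ℕ` encodes the half-integer `l = n + 1/2`, so that `2l = 2n + 1` and
`l + 1/2 = n + 1`; as `n` runs through the natural numbers, `l` runs through `1/2, 3/2, 5/2, …`. -/

/-- Labels of the basis `e, h, f, p_0, …, p_{2l}, z`. -/
inductive Idx (n : ℕ) : Type
  | e | h | f
  | p (k : Fin (2 * n + 2))
  | z

/-- The half-integer `l = n + 1/2`, as a complex number. -/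
def ell (n : ℕ) : ℂ := (n : ℂ) + 1 / 2

/-- The vector space with basis `e, h, f, p_0, …, p_{2l}, z`. -/
def Alg (n : ℕ) : Type := Idx n →₀ ℂ

instance (n : ℕ) : AddCommGroup (Alg n) := inferInstanceAs (AddCommGroup (Idx n →₀ ℂ))
instance (n : ℕ) : Module ℂ (Alg n) := inferInstanceAs (Module ℂ (Idx n →₀ ℂ))

/-- The defining basis. -/
def stdBasis (n : ℕ) : Module.Basis (Idx n) ℂ (Alg n) :=
  (Finsupp.basisSingleOne : Module.Basis (Idx n) ℂ (Idx n →₀ ℂ))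

/-- The basis vector with a given label. -/
def gen {n : ℕ} (i : Idx n) : Alg n := stdBasis n i

/-- The basis vector `p_k`, with the convention `p_k = 0` for `k > 2l`. -/
def P (n k : ℕ) : Alg n := if hk : k < 2 * n + 2 then gen (.p ⟨k, hk⟩) else 0

/-- The scalar `(-1)^{k+l+1/2} k! (2l-k)!`. -/
def omega (n k : ℕ) : ℂ := (-1) ^ (k + n + 1) * (k.factorial : ℂ) * ((2 * n + 1 - k).factorial : ℂ)

/-- The table of brackets of basis vectors. -/
def table (n : ℕ) : Idx n → Idx n → Alg n
  | .h, .e => (2 : ℂ) • gen .e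
  | .e, .h => -((2 : ℂ) • gen .e)
  | .h, .f => -((2 : ℂ) • gen .f)
  | .f, .h => (2 : ℂ) • gen .f
  | .e, .f => gen .h
  | .f, .e => -gen .h
  | .h, .p k => (2 * (ell n - (k : ℕ))) • P n k
  | .p k, .h => -((2 * (ell n - (k : ℕ))) • P n k)
  | .e, .p k => ((k : ℕ) : ℂ) • P n ((k : ℕ) - 1)
  | .p k, .e => -(((k : ℕ) : ℂ) • P n ((k : ℕ) - 1))
  | .f, .p k => (2 * ell n - (k : ℕ)) • P n ((k : ℕ) + 1)
  | .p k, .f => -((2 * ell n - (k : ℕ)) • P n ((k : ℕ) + 1))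
  | .p k, .p k' => if (k : ℕ) + (k' : ℕ) = 2 * n + 1 then omega n k • gen .z else 0
  | _, _ => 0

/-- The bilinear extension of the table of brackets. -/
def bracketHom (n : ℕ) : Alg n →ₗ[ℂ] Alg n →ₗ[ℂ] Alg n :=
  (stdBasis n).constr ℂ fun i => (stdBasis n).constr ℂ fun j => table n i j

instance (n : ℕ) : Bracket (Alg n) (Alg n) := ⟨fun x y => bracketHom n x y⟩

theorem bracket_def {n : ℕ} (x y : Alg n) : ⁅x, y⁆ = bracketHom n x y := rfl

theorem bracketHom_gen {n : ℕ} (i j : Idx n) : bracketHom n (gen i) (gen j) = table n i j := by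
  simp [bracketHom, gen]

theorem P_of_lt {n : ℕ} (k : Fin (2 * n + 2)) : P n k = gen (.p k) := by
  simp [P, k.2]

theorem P_of_ge {n k : ℕ} (hk : 2 * n + 2 ≤ k) : P n k = 0 := by
  simp [P, hk]

theorem omega_swap {n k k' : ℕ} (h : k + k' = 2 * n + 1) : omega n k' = -omega n k := by
  obtain rfl : k' = 2 * n + 1 - k := by omega
  have hk : k ≤ 2 * n + 1 := by omega
  have h1 : 2 * n + 1 - (2 * n + 1 - k) = k := by omega
  have h2 : ((-1 : ℂ)) ^ (2 * n + 1 - k + n + 1) = -(-1) ^ (k + n + 1) := by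
    rcases Nat.even_or_odd (k + n + 1) with he | ho
    · rw [he.neg_one_pow, Odd.neg_one_pow]
      rw [Nat.odd_iff]; rw [Nat.even_iff] at he; omega
    · rw [ho.neg_one_pow, Even.neg_one_pow]
      · simp
      rw [Nat.even_iff]; rw [Nat.odd_iff] at ho; omega
  rw [omega, omega, h1, h2]; ring

theorem omega_succ {n k : ℕ} (hk : k < 2 * n + 1) :
    ((2 * n + 1 - k : ℕ) : ℂ) * omega n (k + 1) = -(((k : ℂ) + 1) * omega n k) := by
  obtain ⟨m, hm⟩ : ∃ m, 2 * n + 1 - k = m + 1 := ⟨2 * n - k, by omega⟩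
  have hm' : 2 * n + 1 - (k + 1) = m := by omega
  rw [omega, omega, hm', hm, Nat.factorial_succ, Nat.factorial_succ]
  push_cast; ring

theorem table_swap {n : ℕ} (i j : Idx n) : table n i j = -table n j i := by
  cases i <;> cases j <;> simp [table]
  rename_i k k'
  by_cases h : (k : ℕ) + (k' : ℕ) = 2 * n + 1
  · rw [if_pos h, if_pos (by omega), omega_swap h]; simp
  · rw [if_neg h, if_neg (by omega)]; simp

theorem bracketHom_swap {n : ℕ} (x y : Alg n) : bracketHom n x y = -bracketHom n y x := by
  have : bracketHom n = -(bracketHom n).flip := by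
    refine (stdBasis n).ext fun i => (stdBasis n).ext fun j => ?_
    change bracketHom n (gen i) (gen j) = -bracketHom n (gen j) (gen i)
    rw [bracketHom_gen, bracketHom_gen, table_swap]
  exact congrArg (fun F => F x y) this

theorem bracket_h_P {n : ℕ} (k : ℕ) :
    bracketHom n (gen .h) (P n k) = (2 * (ell n - k)) • P n k := by
  by_cases hk : k < 2 * n + 2
  · have := bracketHom_gen (n := n) .h (.p ⟨k, hk⟩)
    rwa [← P_of_lt] at this
  · simp [P_of_ge (not_lt.mp hk)]

theorem bracket_e_P {n k : ℕ} (hk : k < 2 * n + 2) :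
    bracketHom n (gen .e) (P n k) = (k : ℂ) • P n (k - 1) := by
  have := bracketHom_gen (n := n) .e (.p ⟨k, hk⟩)
  rwa [← P_of_lt] at this

theorem bracket_f_P {n k : ℕ} (hk : k < 2 * n + 2) :
    bracketHom n (gen .f) (P n k) = (2 * ell n - k) • P n (k + 1) := by
  have := bracketHom_gen (n := n) .f (.p ⟨k, hk⟩)
  rwa [← P_of_lt] at this

theorem bracket_z_P {n : ℕ} (k : ℕ) : bracketHom n (gen .z) (P n k) = 0 := by
  by_cases hk : k < 2 * n + 2
  · have := bracketHom_gen (n := n) .z (.p ⟨k, hk⟩)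
    rwa [← P_of_lt] at this
  · simp [P_of_ge (not_lt.mp hk)]

theorem bracket_P_P {n : ℕ} (k k' : ℕ) : bracketHom n (P n k) (P n k') =
    if k + k' = 2 * n + 1 then omega n k • gen .z else 0 := by
  by_cases hk : k < 2 * n + 2
  · by_cases hk' : k' < 2 * n + 2
    · have := bracketHom_gen (n := n) (.p ⟨k, hk⟩) (.p ⟨k', hk'⟩)
      rwa [← P_of_lt, ← P_of_lt] at this
    · rw [P_of_ge (not_lt.mp hk'), if_neg (by omega)]; simp
  · rw [P_of_ge (not_lt.mp hk), if_neg (by omega)]; simp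

theorem two_ell (n : ℕ) : 2 * ell n = 2 * n + 1 := by
  rw [ell]; ring

/-- The Jacobi identity on basis vectors. -/
def Jac {n : ℕ} (x y z : Alg n) : Prop :=
  bracketHom n x (bracketHom n y z) =
    bracketHom n (bracketHom n x y) z + bracketHom n y (bracketHom n x z)

theorem Jac.swap12 {n : ℕ} {x y z : Alg n} (h : Jac x y z) : Jac y x z := by
  unfold Jac at *
  rw [h, bracketHom_swap y x]; simp

theorem Jac.swap23 {n : ℕ} {x y z : Alg n} (h : Jac x y z) : Jac x z y := by
  unfold Jac at *
  rw [bracketHom_swap z y, map_neg, h, bracketHom_swap z, bracketHom_swap y]; simp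

theorem bracket_self {n : ℕ} (x : Alg n) : bracketHom n x x = 0 := by
  have h : (2 : ℂ) • bracketHom n x x = 0 := by
    rw [two_smul]; nth_rewrite 1 [bracketHom_swap]; simp
  simpa using h

theorem bracket_z {n : ℕ} (x : Alg n) : bracketHom n (gen .z) x = 0 := by
  have : bracketHom n (gen .z) = 0 := by
    refine (stdBasis n).ext fun j => ?_
    change bracketHom n (gen .z) (gen j) = _
    rw [bracketHom_gen]; cases j <;> rfl
  rw [this]; rfl

theorem jac_z {n : ℕ} (x y : Alg n) : Jac (gen .z) x y := by
  simp [Jac, bracket_z]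

theorem jac_self {n : ℕ} (x y : Alg n) : Jac x x y := by
  simp [Jac, bracket_self]

theorem jac_hef (n : ℕ) : Jac (n := n) (gen .h) (gen .e) (gen .f) := by
  simp [Jac, bracketHom_gen, table]

theorem jac_heP {n : ℕ} (k : Fin (2 * n + 2)) : Jac (gen .h) (gen .e) (P n k) := by
  rcases k with ⟨_ | k, hk⟩
  all_goals
    simp only [Jac, bracket_e_P hk, bracket_h_P, bracketHom_gen, table, map_smul,
      LinearMap.smul_apply, Nat.add_sub_cancel]
    push_cast
  · simp
  · module

theorem jac_hfP {n : ℕ} (k : Fin (2 * n + 2)) : Jac (gen .h) (gen .f) (P n k) := by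
  rcases k with ⟨k, hk⟩
  simp only [Jac, bracket_f_P hk, bracket_h_P, bracketHom_gen, table, map_smul,
      LinearMap.smul_apply, LinearMap.neg_apply, map_neg]
  push_cast
  module

theorem jac_efP {n : ℕ} (k : Fin (2 * n + 2)) : Jac (gen .e) (gen .f) (P n k) := by
  rcases k with ⟨k, hk⟩
  have h1 : bracketHom n (gen .e) ((2 * ell n - k) • P n (k + 1)) =
      ((2 * ell n - k) * (k + 1)) • P n k := by
    by_cases hk1 : k + 1 < 2 * n + 2
    · rw [map_smul, bracket_e_P hk1, smul_smul, Nat.add_sub_cancel]; push_cast; rfl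
    · obtain rfl : k = 2 * n + 1 := by omega
      simp [two_ell]
  have h2 : bracketHom n (gen .f) ((k : ℂ) • P n (k - 1)) =
      ((2 * ell n - k + 1) * k) • P n k := by
    rcases k with _ | k
    · simp
    · rw [map_smul, bracket_f_P (by omega), smul_smul, Nat.add_sub_cancel]; push_cast
      congr 1; ring
  simp only [Jac, bracket_f_P hk, bracket_e_P hk, h1, h2, bracketHom_gen, table, bracket_h_P]
  module

theorem jac_hPP {n : ℕ} (k k' : Fin (2 * n + 2)) : Jac (gen .h) (P n k) (P n k') := by
  rcases k with ⟨k, hk⟩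
  rcases k' with ⟨k', hk'⟩
  simp only [Jac, bracket_h_P, map_smul, LinearMap.smul_apply, bracket_P_P]
  split_ifs with h
  · have : (k' : ℂ) = 2 * ell n - k := by
      rw [two_ell, eq_sub_iff_add_eq']; exact_mod_cast h
    rw [this, map_smul, bracketHom_gen, table]
    · module
    all_goals simp
  · simp

theorem jac_ePP {n : ℕ} (k k' : Fin (2 * n + 2)) : Jac (gen .e) (P n k) (P n k') := by
  rcases k with ⟨k, hk⟩
  rcases k' with ⟨k', hk'⟩
  have h0 : bracketHom n (gen .e) (gen .z) = 0 := by rw [bracketHom_gen]; rfl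
  simp only [Jac, bracket_e_P hk, bracket_e_P hk', map_smul, LinearMap.smul_apply, bracket_P_P]
  have hl : bracketHom n (gen .e) (if k + k' = 2 * n + 1 then omega n k • gen .z else 0) = 0 := by
    split_ifs <;> simp [h0]
  rw [hl]
  rcases k with _ | k
  · rcases k' with _ | k'
    · simp
    · rw [if_neg (c := _ + (_ - 1) = _) (by omega)]; simp
  rcases k' with _ | k'
  · rw [if_neg (c := _ - 1 + _ = _) (by omega)]; simp
  by_cases h : k + k' = 2 * n
  · rw [if_pos (by omega), if_pos (by omega), smul_smul, smul_smul, ← add_smul]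
    have := omega_succ (n := n) (k := k) (by omega)
    have h2 : 2 * n + 1 - k = k' + 1 := by omega
    rw [h2] at this
    have h3 : ((k + 1 : ℕ) : ℂ) * omega n k + ((k' + 1 : ℕ) : ℂ) * omega n (k + 1) = 0 := by
      rw [this]; push_cast; ring
    simp only [Nat.add_sub_cancel]
    rw [h3, zero_smul]
  · rw [if_neg (by omega), if_neg (by omega)]; simp

theorem jac_fPP {n : ℕ} (k k' : Fin (2 * n + 2)) : Jac (gen .f) (P n k) (P n k') := by
  rcases k with ⟨k, hk⟩
  rcases k' with ⟨k', hk'⟩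
  have h0 : bracketHom n (gen .f) (gen .z) = 0 := by rw [bracketHom_gen]; rfl
  simp only [Jac, bracket_f_P hk, bracket_f_P hk', map_smul, LinearMap.smul_apply, bracket_P_P]
  have hl : bracketHom n (gen .f) (if k + k' = 2 * n + 1 then omega n k • gen .z else 0) = 0 := by
    split_ifs <;> simp [h0]
  rw [hl]
  by_cases h : k + k' = 2 * n
  · rw [if_pos (by omega), if_pos (by omega), smul_smul, smul_smul, ← add_smul]
    have := omega_succ (n := n) (k := k) (by omega)
    have h2 : 2 * n + 1 - k = k' + 1 := by omega
    rw [h2] at this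
    have h4 : (k : ℂ) + k' = 2 * n := by exact_mod_cast h
    have h3 : (2 * ell n - k) * omega n (k + 1) + (2 * ell n - k') * omega n k = 0 := by
      rw [two_ell]
      push_cast at this
      linear_combination this - (omega n (k + 1) + omega n k) * h4
    rw [h3, zero_smul]
  · rw [if_neg (by omega), if_neg (by omega)]; simp

theorem jac_PPP {n : ℕ} (i j k : ℕ) : Jac (P n i) (P n j) (P n k) := by
  have h : ∀ a b c, bracketHom n (P n a) (bracketHom n (P n b) (P n c)) = 0 := by
    intro a b c
    rw [bracket_P_P, bracketHom_swap]
    split_ifs <;> simp [bracket_z_P]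
  rw [Jac, bracketHom_swap (bracketHom n (P n i) (P n j)), h, h, h]; simp

theorem jac_basis {n : ℕ} (i j k : Idx n) : Jac (gen i) (gen j) (gen k) := by
  cases i <;> cases j <;> cases k <;> (try simp only [← P_of_lt]) <;>
    first
    | with_reducible exact jac_z _ _
    | with_reducible exact (jac_z _ _).swap12
    | with_reducible exact (jac_z _ _).swap12.swap23
    | with_reducible exact jac_self _ _
    | with_reducible exact (jac_self _ _).swap23
    | with_reducible exact (jac_self _ _).swap23.swap12
    | with_reducible exact jac_PPP _ _ _
    | (have h := jac_hef n
       first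
       | with_reducible exact h
       | with_reducible exact h.swap12
       | with_reducible exact h.swap23
       | with_reducible exact h.swap12.swap23
       | with_reducible exact h.swap23.swap12
       | with_reducible exact h.swap12.swap23.swap12)
    | (rename_i k
       have h1 := jac_heP k
       have h2 := jac_hfP k
       have h3 := jac_efP k
       first
       | with_reducible exact h1
       | with_reducible exact h1.swap12
       | with_reducible exact h1.swap23
       | with_reducible exact h1.swap12.swap23
       | with_reducible exact h1.swap23.swap12
       | with_reducible exact h1.swap12.swap23.swap12
       | with_reducible exact h2
       | with_reducible exact h2.swap12
       | with_reducible exact h2.swap23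
       | with_reducible exact h2.swap12.swap23
       | with_reducible exact h2.swap23.swap12
       | with_reducible exact h2.swap12.swap23.swap12
       | with_reducible exact h3
       | with_reducible exact h3.swap12
       | with_reducible exact h3.swap23
       | with_reducible exact h3.swap12.swap23
       | with_reducible exact h3.swap23.swap12
       | with_reducible exact h3.swap12.swap23.swap12)
    | (rename_i k k'
       have h1 := jac_ePP k k'
       have h2 := jac_hPP k k'
       have h3 := jac_fPP k k'
       first
       | with_reducible exact h1
       | with_reducible exact h1.swap12
       | with_reducible exact h1.swap12.swap23
       | with_reducible exact h2
       | with_reducible exact h2.swap12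
       | with_reducible exact h2.swap12.swap23
       | with_reducible exact h3
       | with_reducible exact h3.swap12
       | with_reducible exact h3.swap12.swap23)

theorem gen_induction {n : ℕ} {C : Alg n → Prop} (hg : ∀ i, C (gen i)) (h0 : C 0)
    (hadd : ∀ x y, C x → C y → C (x + y)) (hsmul : ∀ (c : ℂ) x, C x → C (c • x)) (x : Alg n) :
    C x := by
  refine Submodule.span_induction (p := fun x _ => C x) ?_ h0 (fun x y _ _ => hadd x y)
    (fun c x _ => hsmul c x) ((stdBasis n).mem_span x)
  rintro _ ⟨i, rfl⟩
  exact hg i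

theorem jac {n : ℕ} (x y z : Alg n) : Jac x y z := by
  induction x using gen_induction with
  | h0 => simp [Jac]
  | hadd a b ha hb => unfold Jac at *; simp only [map_add, LinearMap.add_apply, ha, hb]; abel
  | hsmul c a ha => unfold Jac at *; simp only [map_smul, LinearMap.smul_apply, ha, smul_add]
  | hg i =>
  induction y using gen_induction with
  | h0 => simp [Jac]
  | hadd a b ha hb => unfold Jac at *; simp only [map_add, LinearMap.add_apply, ha, hb]; abel
  | hsmul c a ha => unfold Jac at *; simp only [map_smul, LinearMap.smul_apply, ha, smul_add]
  | hg j =>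
  induction z using gen_induction with
  | h0 => simp [Jac]
  | hadd a b ha hb => unfold Jac at *; simp only [map_add, ha, hb]; abel
  | hsmul c a ha => unfold Jac at *; simp only [map_smul, ha, smul_add]
  | hg k => exact jac_basis i j k

/-- The conformal Galilei algebra as a Lie ring. -/
instance (n : ℕ) : LieRing (Alg n) where
  add_lie x y z := by simp [bracket_def]
  lie_add x y z := by simp [bracket_def]
  lie_self x := bracket_self x
  leibniz_lie x y z := jac x y z

/-- The conformal Galilei algebra as a complex Lie algebra. -/
instance (n : ℕ) : LieAlgebra ℂ (Alg n) where
  lie_smul c x y := by simp [bracket_def]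

theorem lie_gen {n : ℕ} (i j : Idx n) : ⁅(gen i : Alg n), (gen j : Alg n)⁆ = table n i j :=
  bracketHom_gen i j

/-- A linear map that respects the brackets of basis vectors is a Lie algebra morphism. -/
def lieHomOfGen {n : ℕ} {L : Type*} [LieRing L] [LieAlgebra ℂ L] (φ : Alg n →ₗ[ℂ] L)
    (hφ : ∀ i j : Idx n, φ (table n i j) = ⁅φ (gen i), φ (gen j)⁆) : Alg n →ₗ⁅ℂ⁆ L :=
  { φ with
    map_lie' := by
      intro x y
      change φ ⁅x, y⁆ = ⁅φ x, φ y⁆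
      induction x using gen_induction with
      | h0 => simp
      | hadd a b ha hb => simp only [add_lie, map_add, ha, hb]
      | hsmul c a ha => simp only [smul_lie, map_smul, ha]
      | hg i =>
      induction y using gen_induction with
      | h0 => simp
      | hadd a b ha hb => simp only [lie_add, map_add, ha, hb]
      | hsmul c a ha => simp only [lie_smul, map_smul, ha]
      | hg j => rw [lie_gen, hφ] }

/-! ### Subalgebras -/

/-- The span of a set of basis vectors that is closed under the bracket. -/
def spanSub {n : ℕ} (s : Set (Idx n))
    (hs : ∀ i ∈ s, ∀ j ∈ s, table n i j ∈ Submodule.span ℂ ((gen : Idx n → Alg n) '' s)) :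
    LieSubalgebra ℂ (Alg n) :=
  { Submodule.span ℂ ((gen : Idx n → Alg n) '' s) with
    lie_mem' := by
      intro x y hx hy
      change ⁅x, y⁆ ∈ Submodule.span ℂ ((gen : Idx n → Alg n) '' s)
      change x ∈ Submodule.span ℂ ((gen : Idx n → Alg n) '' s) at hx
      change y ∈ Submodule.span ℂ ((gen : Idx n → Alg n) '' s) at hy
      induction hx using Submodule.span_induction with
      | zero => simp
      | add a b _ _ ha hb => rw [add_lie]; exact add_mem ha hb
      | smul c a _ ha => rw [smul_lie]; exact Submodule.smul_mem _ _ ha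
      | mem a ha =>
      induction hy using Submodule.span_induction with
      | zero => simp
      | add a b _ _ ha hb => rw [lie_add]; exact add_mem ha hb
      | smul c a _ ha => rw [lie_smul]; exact Submodule.smul_mem _ _ ha
      | mem b hb =>
        obtain ⟨i, hi, rfl⟩ := ha
        obtain ⟨j, hj, rfl⟩ := hb
        rw [lie_gen]; exact hs i hi j hj }

theorem P_mem_span {n : ℕ} {s : Set (Idx n)} (k : ℕ) (hk : ∀ j : Fin (2 * n + 2), j.1 = k → .p j ∈ s) :
    P n k ∈ Submodule.span ℂ ((gen : Idx n → Alg n) '' s) := by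
  rw [P]
  split_ifs with h
  · exact Submodule.subset_span ⟨_, hk _ rfl, rfl⟩
  · exact zero_mem _

theorem gen_mem_span {n : ℕ} {s : Set (Idx n)} {i : Idx n} (hi : i ∈ s) :
    gen i ∈ Submodule.span ℂ ((gen : Idx n → Alg n) '' s) :=
  Submodule.subset_span ⟨i, hi, rfl⟩

/-- The subalgebra `sl₂` spanned by `e, h, f`. -/
def sl2 (n : ℕ) : LieSubalgebra ℂ (Alg n) :=
  spanSub {.e, .h, .f} (by
    have he := gen_mem_span (n := n) (s := {.e, .h, .f}) (i := .e) (by simp)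
    have hh := gen_mem_span (n := n) (s := {.e, .h, .f}) (i := .h) (by simp)
    have hf := gen_mem_span (n := n) (s := {.e, .h, .f}) (i := .f) (by simp)
    rintro i (rfl | rfl | rfl) j (rfl | rfl | rfl) <;>
      simp only [table, zero_mem, neg_mem_iff, he, hh, hf, Submodule.smul_mem])

/-- The Heisenberg subalgebra spanned by `p_0, …, p_{2l}, z`. -/
def heis (n : ℕ) : LieSubalgebra ℂ (Alg n) :=
  spanSub (insert .z (Set.range .p)) (by
    rintro i (rfl | ⟨k, rfl⟩) j (rfl | ⟨k', rfl⟩) <;> simp only [table, zero_mem]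
    split_ifs
    · exact Submodule.smul_mem _ _ (gen_mem_span (by simp))
    · exact zero_mem _)

/-- Labels of the basis vectors of non-negative degree for the grading by the adjoint action of
`h`: these are `h`, `z`, `e` and the `p_k` with `k < l`, that is `k ≤ n`. -/
def nonnegIdx (n : ℕ) : Set (Idx n) := {.h, .z, .e} ∪ {i | ∃ k : Fin (2 * n + 2), k.1 ≤ n ∧ i = .p k}

/-- The subalgebra spanned by the homogeneous elements of non-negative degree. -/
def borel (n : ℕ) : LieSubalgebra ℂ (Alg n) :=
  spanSub (nonnegIdx n) (by
    have he := gen_mem_span (n := n) (s := nonnegIdx n) (i := .e) (by simp [nonnegIdx])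
    have hp : ∀ k ≤ n, P n k ∈ Submodule.span ℂ ((gen : Idx n → Alg n) '' nonnegIdx n) :=
      fun k hk => P_mem_span k fun j hj => Or.inr ⟨j, by omega, rfl⟩
    rintro i ((rfl | rfl | rfl) | ⟨k, hk, rfl⟩) j ((rfl | rfl | rfl) | ⟨k', hk', rfl⟩) <;>
      simp only [table, zero_mem, neg_mem_iff, Submodule.smul_mem, *]
    · exact Submodule.smul_mem _ _ (hp _ (by omega))
    · exact Submodule.smul_mem _ _ (hp _ (by omega))
    · rw [if_neg (by omega)]; exact zero_mem _)

theorem gen_mem_sl2_e (n : ℕ) : gen .e ∈ sl2 n := gen_mem_span (by simp)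
theorem gen_mem_sl2_h (n : ℕ) : gen .h ∈ sl2 n := gen_mem_span (by simp)
theorem gen_mem_sl2_f (n : ℕ) : gen .f ∈ sl2 n := gen_mem_span (by simp)
theorem gen_mem_heis_z (n : ℕ) : gen .z ∈ heis n := gen_mem_span (by simp)
theorem P_mem_heis (n k : ℕ) : P n k ∈ heis n := P_mem_span k (by simp)

/-- The projection onto `sl₂` along the Heisenberg ideal. -/
def sl2Proj (n : ℕ) : Alg n →ₗ⁅ℂ⁆ sl2 n :=
  lieHomOfGen
    ((stdBasis n).constr ℂ fun
      | .e => ⟨gen .e, gen_mem_sl2_e n⟩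
      | .h => ⟨gen .h, gen_mem_sl2_h n⟩
      | .f => ⟨gen .f, gen_mem_sl2_f n⟩
      | _ => 0)
    (by
      set F := (stdBasis n).constr ℂ (M' := sl2 n) _ with hF
      have he : F (gen .e) = ⟨gen .e, gen_mem_sl2_e n⟩ := by simp [hF, gen]
      have hh : F (gen .h) = ⟨gen .h, gen_mem_sl2_h n⟩ := by simp [hF, gen]
      have hf : F (gen .f) = ⟨gen .f, gen_mem_sl2_f n⟩ := by simp [hF, gen]
      have hz : F (gen .z) = 0 := by simp [hF, gen]
      have hp : ∀ k, F (gen (.p k)) = 0 := fun k => by simp [hF, gen]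
      have hP : ∀ k, F (P n k) = 0 := fun k => by
        rw [P]; split_ifs <;> simp [hp]
      intro i j
      cases i <;> cases j <;>
        simp only [table, map_smul, map_neg, he, hh, hf, hz, hp, hP, smul_zero, neg_zero, lie_zero,
          zero_lie, map_zero, lie_self] <;>
        first
        | (apply Subtype.ext; simp [lie_gen, table]; done)
        | (split_ifs <;> simp [hz]))

/-- The linear functional with value `a` on `z`, value `b` on `h`, and zero on the other basis
vectors. -/
def weightFun (n : ℕ) (a b : ℂ) : Alg n →ₗ[ℂ] ℂ :=
  (stdBasis n).constr ℂ fun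
    | .h => b
    | .z => a
    | _ => 0

theorem weightFun_lie {n : ℕ} (a b : ℂ) {x y : Alg n} (hx : x ∈ borel n) (hy : y ∈ borel n) :
    weightFun n a b ⁅x, y⁆ = 0 := by
  have hp : ∀ k, weightFun n a b (P n k) = 0 := fun k => by
    rw [P]; split_ifs <;> simp [weightFun, gen]
  have he : weightFun n a b (gen .e) = 0 := by simp [weightFun, gen]
  change x ∈ Submodule.span ℂ ((gen : Idx n → Alg n) '' nonnegIdx n) at hx
  change y ∈ Submodule.span ℂ ((gen : Idx n → Alg n) '' nonnegIdx n) at hy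
  induction hx using Submodule.span_induction with
  | zero => simp
  | add u v _ _ hu hv => rw [add_lie, map_add, hu, hv, add_zero]
  | smul c u _ hu => rw [smul_lie, map_smul, hu, smul_zero]
  | mem u hu =>
  induction hy using Submodule.span_induction with
  | zero => simp
  | add u v _ _ hu hv => rw [lie_add, map_add, hu, hv, add_zero]
  | smul c u _ hu => rw [lie_smul, map_smul, hu, smul_zero]
  | mem v hv =>
    obtain ⟨i, hi, rfl⟩ := hu
    obtain ⟨j, hj, rfl⟩ := hv
    rw [lie_gen]
    rcases hi with (rfl | rfl | rfl) | ⟨k, hk, rfl⟩ <;>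
      rcases hj with (rfl | rfl | rfl) | ⟨k', hk', rfl⟩ <;>
      simp only [table, map_zero, map_neg, map_smul, he, hp, smul_zero, neg_zero]
    rw [if_neg (by omega), map_zero]

attribute [local instance 100] LieRing.ofAssociativeRing in
/-- The one-dimensional representation of the non-negative part in which `z` acts by `a`, `h` acts
by `b`, and the positive part acts by zero. -/
def weightChar (n : ℕ) (a b : ℂ) : borel n →ₗ⁅ℂ⁆ ℂ :=
  { (weightFun n a b) ∘ₗ (borel n).toSubmodule.subtype with
    map_lie' := by
      intro x y
      change weightFun n a b ⁅(x : Alg n), (y : Alg n)⁆ = _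
      rw [weightFun_lie a b x.2 y.2, LieRing.of_associative_ring_bracket, mul_comm, sub_self] }

/-! ### Verma modules -/

section Induction

variable {𝔤 : Type} [LieRing 𝔤] [LieAlgebra ℂ 𝔤]

/-- The induced module `U(𝔤) ⊗_{U(𝔟)} ℂ_χ` of a one-dimensional representation `χ` of a subalgebra
`𝔟`, realised as the quotient of `U(𝔤)` by the left ideal generated by all `x - χ(x)`, `x ∈ 𝔟`. -/
def Ind (𝔟 : LieSubalgebra ℂ 𝔤) (χ : LieAlgebra.LieCharacter ℂ 𝔟) : Type :=
  UniversalEnvelopingAlgebra ℂ 𝔤 ⧸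
    Submodule.span (UniversalEnvelopingAlgebra ℂ 𝔤)
      {u | ∃ x : 𝔟, u = UniversalEnvelopingAlgebra.ι ℂ (x : 𝔤) - algebraMap ℂ _ (χ x)}

variable (𝔟 : LieSubalgebra ℂ 𝔤) (χ : LieAlgebra.LieCharacter ℂ 𝔟)

instance : AddCommGroup (Ind 𝔟 χ) := inferInstanceAs (AddCommGroup (_ ⧸ _))
instance : Module (UniversalEnvelopingAlgebra ℂ 𝔤) (Ind 𝔟 χ) :=
  inferInstanceAs (Module (UniversalEnvelopingAlgebra ℂ 𝔤) (_ ⧸ _))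
instance : Module ℂ (Ind 𝔟 χ) := inferInstanceAs (Module ℂ (_ ⧸ _))
instance : IsScalarTower ℂ (UniversalEnvelopingAlgebra ℂ 𝔤) (Ind 𝔟 χ) :=
  inferInstanceAs (IsScalarTower ℂ (UniversalEnvelopingAlgebra ℂ 𝔤) (_ ⧸ _))

attribute [local instance 100] LieRing.ofAssociativeRing in
/-- The Lie algebra acts through its enveloping algebra. -/
instance : LieRingModule 𝔤 (Ind 𝔟 χ) where
  bracket x v := UniversalEnvelopingAlgebra.ι ℂ x • v
  add_lie x y v := by simp only [map_add, add_smul]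
  lie_add x v w := smul_add _ _ _
  leibniz_lie x y v := by
    simp only [LieHom.map_lie, LieRing.of_associative_ring_bracket, sub_smul, mul_smul,
      sub_add_cancel]

instance : LieModule ℂ 𝔤 (Ind 𝔟 χ) where
  smul_lie c x v := by
    change UniversalEnvelopingAlgebra.ι ℂ (c • x) • v = c • (UniversalEnvelopingAlgebra.ι ℂ x • v)
    rw [map_smul, smul_assoc]
  lie_smul c x v := by
    change UniversalEnvelopingAlgebra.ι ℂ x • (c • v) = c • (UniversalEnvelopingAlgebra.ι ℂ x • v)
    rw [smul_algebra_smul_comm]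

end Induction

/-- The non-negative part of a subalgebra `𝔞`, that is, its intersection with the non-negative part
of the whole algebra, as a subalgebra of `𝔞`. For `sl₂` it is the span of `e` and `h`, and for the
Heisenberg subalgebra it is the span of `z` and the `p_k` with `k < l`. -/
def borelIn {n : ℕ} (𝔞 : LieSubalgebra ℂ (Alg n)) : LieSubalgebra ℂ 𝔞 := (borel n).comap 𝔞.incl

attribute [local instance 100] LieRing.ofAssociativeRing in
/-- The restriction of the one-dimensional representation `weightChar` to the non-negative part of
a subalgebra. -/
def weightCharIn {n : ℕ} (𝔞 : LieSubalgebra ℂ (Alg n)) (a b : ℂ) : borelIn 𝔞 →ₗ⁅ℂ⁆ ℂ :=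
  (weightChar n a b).comp
    { toFun := fun x => ⟨(x : 𝔞), x.2⟩
      map_add' := fun _ _ => rfl
      map_smul' := fun _ _ => rfl
      map_lie' := rfl }

/-- The Verma module of the conformal Galilei algebra in which `z` acts on the highest weight
vector by `a`, and `h` by `b`. -/
abbrev Verma (n : ℕ) (a b : ℂ) : Type := Ind (borel n) (weightChar n a b)

/-- The Verma module of `sl₂` of highest weight `b`. -/
abbrev VermaSl2 (n : ℕ) (b : ℂ) : Type := Ind (borelIn (sl2 n)) (weightCharIn (sl2 n) 0 b)

/-- The Verma module of the Heisenberg algebra in which `z` acts by `a`. -/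
abbrev VermaHeis (n : ℕ) (a : ℂ) : Type := Ind (borelIn (heis n)) (weightCharIn (heis n) a 0)

/-- The quotient of a module by the sum of all its proper submodules. For a Verma module (and for
every module with a largest proper submodule) this is the unique simple quotient. -/
abbrev SimpleQuotient (L M : Type) [LieRing L] [LieAlgebra ℂ L] [AddCommGroup M] [Module ℂ M]
    [LieRingModule L M] [LieModule ℂ L M] : Type :=
  M ⧸ sSup {N : LieSubmodule ℂ L M | N ≠ ⊤}

/-! ### Modules over `sl₂` as modules over the conformal Galilei algebra -/

/-- A module over `sl₂`, regarded as a module over the conformal Galilei algebra on which the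
Heisenberg subalgebra acts by zero. -/
def Inflation (_n : ℕ) (V : Type) : Type := V

section Inflation

variable (n : ℕ) (V : Type) [AddCommGroup V] [Module ℂ V] [LieRingModule (sl2 n) V]
  [LieModule ℂ (sl2 n) V]

instance : AddCommGroup (Inflation n V) := inferInstanceAs (AddCommGroup V)
instance : Module ℂ (Inflation n V) := inferInstanceAs (Module ℂ V)
instance : LieRingModule (Alg n) (Inflation n V) := LieRingModule.compLieHom V (sl2Proj n)
instance : LieModule ℂ (Alg n) (Inflation n V) := LieModule.compLieHom V (sl2Proj n)

end Inflation

/-! ### The oscillator formulas -/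

section Oscillator

variable {A : Type} [Ring A] [Algebra ℂ A]

/-- The element `E`, for given `p_k = q k` and `1/z = c`. -/
def oscE (n : ℕ) (q : ℕ → A) (c : A) : A :=
  c * ∑ k ∈ Finset.Icc 1 (2 * n + 1),
    ((-1) ^ (k + n + 1) * (ell n - k) /
      (((k - 1).factorial : ℂ) * ((2 * n + 1 - k).factorial : ℂ))) •
        (q (k - 1) * q (2 * n + 1 - k))

/-- The element `F`, for given `p_k = q k` and `1/z = c`. -/
def oscF (n : ℕ) (q : ℕ → A) (c : A) : A :=
  c * ∑ k ∈ Finset.Icc 1 (2 * n + 1),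
    ((-1) ^ (k + n) * (ell n - k) /
      (((k - 1).factorial : ℂ) * ((2 * n + 1 - k).factorial : ℂ))) •
        (q k * q (2 * n + 1 - k + 1))

/-- The element `H`, for given `p_k = q k` and `1/z = c`. -/
def oscH (n : ℕ) (q : ℕ → A) (c : A) : A :=
  2 * c * (∑ k ∈ Finset.range (n + 1),
    ((-1) ^ (k + n) * (ell n - k) / ((k.factorial : ℂ) * ((2 * n + 1 - k).factorial : ℂ))) •
        (q (2 * n + 1 - k) * q k)) - algebraMap ℂ A ((ell n + 1 / 2) ^ 2 / 2)

variable {n : ℕ} {q : ℕ → A} {zz c : A}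

/-- The relations needed for the oscillator formulas: the `q k` and `zz` satisfy the relations of
the Heisenberg algebra, and `c` is an inverse of `zz`. -/
structure HeisRel (n : ℕ) (q : ℕ → A) (zz c : A) : Prop where
  comm : ∀ i j, q i * q j - q j * q i = if i + j = 2 * n + 1 then omega n i • zz else 0
  zero : ∀ i, 2 * n + 2 ≤ i → q i = 0
  central : ∀ i, Commute zz (q i)
  mul_eq : c * zz = 1
  eq_mul : zz * c = 1

namespace HeisRel

theorem central_inv (h : HeisRel n q zz c) (i : ℕ) : Commute c (q i) := by
  have h1 := h.central i
  have : c * (zz * q i) * c = c * (q i * zz) * c := by rw [h1.eq]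
  rw [← mul_assoc, h.mul_eq, one_mul, mul_assoc, mul_assoc, h.eq_mul, mul_one] at this
  exact this.symm

attribute [local instance 100] LieRing.ofAssociativeRing

theorem mul_lie_q (a b x : A) : ⁅a * b, x⁆ = a * ⁅b, x⁆ + ⁅a, x⁆ * b := by
  simp only [LieRing.of_associative_ring_bracket]; noncomm_ring

theorem lie_mul_q (a b x : A) : ⁅x, a * b⁆ = a * ⁅x, b⁆ + ⁅x, a⁆ * b := by
  simp only [LieRing.of_associative_ring_bracket]; noncomm_ring

theorem lie_qq (h : HeisRel n q zz c) (i j : ℕ) :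
    ⁅q i, q j⁆ = if i + j = 2 * n + 1 then omega n i • zz else 0 := h.comm i j

theorem c_lie (h : HeisRel n q zz c) (X : A) (i : ℕ) : ⁅c * X, q i⁆ = c * ⁅X, q i⁆ := by
  rw [mul_lie_q, (commute_iff_lie_eq.mp (h.central_inv i)), zero_mul, add_zero]

theorem qq_lie (h : HeisRel n q zz c) (a b i : ℕ) : ⁅q a * q b, q i⁆ =
    (if b + i = 2 * n + 1 then omega n b • (zz * q a) else 0) +
    (if a + i = 2 * n + 1 then omega n a • (zz * q b) else 0) := by
  rw [mul_lie_q, h.lie_qq, h.lie_qq]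
  congr 1
  · split_ifs
    · rw [mul_smul_comm, (h.central a).eq]
    · rw [mul_zero]
  · split_ifs
    · rw [smul_mul_assoc]
    · rw [zero_mul]

theorem c_smul (h : HeisRel n q zz c) (r : ℂ) (X : A) : c * (r • (zz * X)) = r • X := by
  rw [mul_smul_comm, ← mul_assoc, h.mul_eq, one_mul]

/-- A quadratic expression in the `q k` acts on each `q i` by a scalar shift. -/
theorem sum_lie_q (h : HeisRel n q zz c) (s : Finset ℕ) (α : ℕ → ℂ) (f g : ℕ → ℕ) (i a b : ℕ)
    (r : ℂ) (x : A) (ha : ∀ k ∈ s, g k + i = 2 * n + 1 ↔ k = a)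
    (hb : ∀ k ∈ s, f k + i = 2 * n + 1 ↔ k = b)
    (hr : (if a ∈ s then (α a * omega n (g a)) • q (f a) else 0) +
      (if b ∈ s then (α b * omega n (f b)) • q (g b) else 0) = r • x) :
    ⁅c * ∑ k ∈ s, α k • (q (f k) * q (g k)), q i⁆ = r • x := by
  have h1 : ∀ k ∈ s, ⁅α k • (q (f k) * q (g k)), q i⁆ =
      (if k = a then (α k * omega n (g k)) • (zz * q (f k)) else 0) +
      (if k = b then (α k * omega n (f k)) • (zz * q (g k)) else 0) := by
    intro k hk
    rw [smul_lie, h.qq_lie, smul_add, smul_ite, smul_ite, smul_zero, smul_smul, smul_smul]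
    simp only [ha k hk, hb k hk]
  rw [h.c_lie, LieRing.of_associative_ring_bracket, Finset.sum_mul, Finset.mul_sum,
    ← Finset.sum_sub_distrib]
  simp only [← LieRing.of_associative_ring_bracket]
  rw [Finset.sum_congr rfl h1, Finset.sum_add_distrib, Finset.sum_ite_eq', Finset.sum_ite_eq',
    mul_add, ← hr]
  congr 1
  · split_ifs
    · rw [h.c_smul]
    · rw [mul_zero]
  · split_ifs
    · rw [h.c_smul]
    · rw [mul_zero]

theorem sign_sq (m : ℕ) : ((-1 : ℂ) ^ m) ^ 2 = 1 := by
  rw [← pow_mul, mul_comm, pow_mul]; simp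

theorem sign_eq {j m n : ℕ} (h : j + m = 2 * n) : (-1 : ℂ) ^ j = (-1) ^ m := by
  have h1 : (-1 : ℂ) ^ j * (-1) ^ m = 1 := by rw [← pow_add, h]; simp
  calc (-1 : ℂ) ^ j = (-1) ^ j * ((-1) ^ m) ^ 2 := by rw [sign_sq, mul_one]
    _ = _ := by rw [sq, ← mul_assoc, h1, one_mul]

theorem ell_eq {j m n : ℕ} (h : j + m = 2 * n) : ell n = ((j : ℂ) + m + 1) / 2 := by
  have : (j : ℂ) + m = 2 * n := by exact_mod_cast h
  rw [this, ell]; ring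

theorem E_lie (h : HeisRel n q zz c) {i : ℕ} (hi : i < 2 * n + 2) :
    ⁅oscE n q c, q i⁆ = (i : ℂ) • q (i - 1) := by
  refine h.sum_lie_q _ _ (fun k => k - 1) (fun k => 2 * n + 1 - k) i i (2 * n + 2 - i) _ _ ?_ ?_ ?_
  · intro k hk; rw [Finset.mem_Icc] at hk; omega
  · intro k hk; rw [Finset.mem_Icc] at hk; omega
  rcases i with _ | j
  · simp
  obtain ⟨m, hm⟩ : ∃ m, j + m = 2 * n := ⟨2 * n - j, by omega⟩
  have e1 : 2 * n + 1 - (j + 1) = m := by omega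
  have e2 : 2 * n + 2 - (j + 1) = m + 1 := by omega
  have e3 : 2 * n + 1 - (m + 1) = j := by omega
  have e4 : 2 * n + 1 - m = j + 1 := by omega
  rw [if_pos (by rw [Finset.mem_Icc]; omega), if_pos (by rw [Finset.mem_Icc]; omega)]
  simp only [e1, e2, e3, Nat.add_sub_cancel, ← add_smul, omega, e4]
  congr 1
  have f1 : (j.factorial : ℂ) ≠ 0 := by exact_mod_cast j.factorial_ne_zero
  have f2 : (m.factorial : ℂ) ≠ 0 := by exact_mod_cast m.factorial_ne_zero
  rw [Nat.factorial_succ, ell_eq hm]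
  simp only [pow_add, pow_one, sign_eq hm]
  field_simp
  push_cast
  rw [sign_sq, sign_sq]
  ring

theorem F_lie (h : HeisRel n q zz c) {i : ℕ} (hi : i < 2 * n + 2) :
    ⁅oscF n q c, q i⁆ = (2 * ell n - i) • q (i + 1) := by
  refine h.sum_lie_q _ _ (fun k => k) (fun k => 2 * n + 1 - k + 1) i (i + 1) (2 * n + 1 - i)
    _ _ ?_ ?_ ?_
  · intro k hk; rw [Finset.mem_Icc] at hk; omega
  · intro k hk; rw [Finset.mem_Icc] at hk; omega
  by_cases hi' : i = 2 * n + 1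
  · subst hi'; simp [two_ell]
  obtain ⟨m, hm⟩ : ∃ m, i + m = 2 * n := ⟨2 * n - i, by omega⟩
  have e1 : 2 * n + 1 - (i + 1) = m := by omega
  have e2 : 2 * n + 1 - i = m + 1 := by omega
  have e3 : 2 * n + 1 - (m + 1) = i := by omega
  rw [if_pos (by rw [Finset.mem_Icc]; omega), if_pos (by rw [Finset.mem_Icc]; omega)]
  simp only [e1, e2, e3, Nat.add_sub_cancel, ← add_smul, omega]
  congr 1
  have f1 : (i.factorial : ℂ) ≠ 0 := by exact_mod_cast i.factorial_ne_zero
  have f2 : (m.factorial : ℂ) ≠ 0 := by exact_mod_cast m.factorial_ne_zero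
  rw [Nat.factorial_succ, ell_eq hm]
  simp only [pow_add, pow_one, sign_eq hm]
  field_simp
  push_cast
  rw [sign_sq, sign_sq]
  ring

/-- The coefficients of `H` in its symmetric form. -/
def coefH (n k : ℕ) : ℂ :=
  (-1) ^ (k + n) * (ell n - k) / ((k.factorial : ℂ) * ((2 * n + 1 - k).factorial : ℂ))

theorem coefH_omega {k m : ℕ} (hm : k + m = 2 * n + 1) : coefH n k * omega n m = ell n - k := by
  have e1 : 2 * n + 1 - k = m := by omega
  have e2 : 2 * n + 1 - m = k := by omega
  have f1 : (k.factorial : ℂ) ≠ 0 := by exact_mod_cast k.factorial_ne_zero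
  have f2 : (m.factorial : ℂ) ≠ 0 := by exact_mod_cast m.factorial_ne_zero
  have hs : (-1 : ℂ) ^ m = -(-1) ^ k := by
    have h1 : (-1 : ℂ) ^ k * (-1) ^ m = -1 := by rw [← pow_add, hm, pow_add, pow_mul]; simp
    have h2 := sign_sq k
    linear_combination (-1 : ℂ) ^ k * h1 - (-1) ^ m * h2
  rw [coefH, omega, e1, e2]
  simp only [pow_add, pow_one, hs]
  field_simp
  rw [sign_sq, sign_sq]
  ring

theorem coefH_symm {k m : ℕ} (hm : k + m = 2 * n + 1) : coefH n m = coefH n k := by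
  have h1 := coefH_omega hm
  have h2 := coefH_omega (n := n) (k := m) (m := k) (by omega)
  rw [omega_swap hm] at h1
  have h3 : (k : ℂ) + m = 2 * n + 1 := by exact_mod_cast hm
  have h4 : omega n k ≠ 0 := by
    have f1 : (k.factorial : ℂ) ≠ 0 := by exact_mod_cast k.factorial_ne_zero
    have f2 : ((2 * n + 1 - k).factorial : ℂ) ≠ 0 := by
      exact_mod_cast (2 * n + 1 - k).factorial_ne_zero
    simp [omega, f1, f2]
  refine mul_right_cancel₀ h4 ?_
  rw [h2]
  have := two_ell n
  linear_combination this - h3 + h1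

theorem sum_ell (n : ℕ) : ∑ k ∈ Finset.range (n + 1), (ell n - k) = ((n : ℂ) + 1) ^ 2 / 2 := by
  have : ∀ m : ℕ, ∑ k ∈ Finset.range m, (ell n - k) = m * (ell n - (m - 1) / 2) := by
    intro m
    induction m with
    | zero => simp
    | succ m ih => rw [Finset.sum_range_succ, ih]; push_cast; ring
  rw [this, ell]; push_cast; ring

/-- The symmetric form of `H`. -/
theorem H_eq (h : HeisRel n q zz c) : oscH n q c =
    c * ∑ k ∈ Finset.range (2 * n + 2), coefH n k • (q (2 * n + 1 - k) * q k) := by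
  have e : 2 * n + 2 = (n + 1) + (n + 1) := by ring
  have h2 : ∑ k ∈ Finset.range (n + 1),
      coefH n (n + 1 + k) • (q (2 * n + 1 - (n + 1 + k)) * q (n + 1 + k)) =
      ∑ k ∈ Finset.range (n + 1), coefH n k • (q (2 * n + 1 - k) * q k) -
        ((ell n + 1 / 2) ^ 2 / 2) • zz := by
    rw [← Finset.sum_range_reflect]
    have h3 : ∀ k ∈ Finset.range (n + 1),
        coefH n (n + 1 + (n + 1 - 1 - k)) • (q (2 * n + 1 - (n + 1 + (n + 1 - 1 - k))) *
          q (n + 1 + (n + 1 - 1 - k))) =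
        coefH n k • (q (2 * n + 1 - k) * q k) - (ell n - k) • zz := by
      intro k hk
      rw [Finset.mem_range] at hk
      have e1 : n + 1 + (n + 1 - 1 - k) = 2 * n + 1 - k := by omega
      have e2 : 2 * n + 1 - (2 * n + 1 - k) = k := by omega
      have e3 : k + (2 * n + 1 - k) = 2 * n + 1 := by omega
      have h4 := h.comm (2 * n + 1 - k) k
      rw [if_pos (by omega)] at h4
      rw [e1, e2, coefH_symm e3, ← coefH_omega e3, mul_smul, ← h4, smul_sub, sub_sub_cancel]
    rw [Finset.sum_congr rfl h3, Finset.sum_sub_distrib, ← Finset.sum_smul, sum_ell]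
    congr 3
    rw [ell]; ring
  rw [e, Finset.sum_range_add, h2, oscH, mul_add, mul_sub, mul_smul_comm, h.mul_eq,
    ← Algebra.algebraMap_eq_smul_one, ← add_sub_assoc, mul_assoc, two_mul]
  rfl

theorem H_lie (h : HeisRel n q zz c) {i : ℕ} (hi : i < 2 * n + 2) :
    ⁅oscH n q c, q i⁆ = (2 * (ell n - i)) • q i := by
  rw [h.H_eq]
  refine h.sum_lie_q _ _ (fun k => 2 * n + 1 - k) (fun k => k) i (2 * n + 1 - i) i _ _ ?_ ?_ ?_
  · intro k hk; rw [Finset.mem_range] at hk; omega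
  · intro k hk; rw [Finset.mem_range] at hk; omega
  have e1 : 2 * n + 1 - (2 * n + 1 - i) = i := by omega
  have e2 : i + (2 * n + 1 - i) = 2 * n + 1 := by omega
  rw [if_pos (by rw [Finset.mem_range]; omega), if_pos (by rw [Finset.mem_range]; omega)]
  simp only [e1, ← add_smul]
  rw [coefH_symm e2, coefH_omega e2, two_mul]

theorem lie_sum_q (x : A) (s : Finset ℕ) (f : ℕ → A) :
    ⁅x, c * ∑ k ∈ s, f k⁆ = ⁅x, c⁆ * (∑ k ∈ s, f k) + c * ∑ k ∈ s, ⁅x, f k⁆ := by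
  rw [lie_mul_q, add_comm]
  congr 2
  simp only [LieRing.of_associative_ring_bracket, Finset.sum_mul, Finset.mul_sum,
    Finset.sum_sub_distrib]

theorem c_quad (h : HeisRel n q zz c) (s : Finset ℕ) (α : ℕ → ℂ) (f g : ℕ → ℕ) (y : A)
    (hy : ∀ i, Commute y (q i)) (hyc : Commute y c) :
    Commute y (c * ∑ k ∈ s, α k • (q (f k) * q (g k))) :=
  hyc.mul_right (Commute.sum_right _ _ _ fun _ _ => ((hy _).mul_right (hy _)).smul_right _)

theorem zz_c (h : HeisRel n q zz c) : Commute zz c := by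
  rw [Commute, SemiconjBy, h.mul_eq, h.eq_mul]

theorem H_lie_quad (h : HeisRel n q zz c) (s : Finset ℕ) (α : ℕ → ℂ) (f g : ℕ → ℕ) (r : ℂ)
    (hf : ∀ k ∈ s, f k < 2 * n + 2) (hg : ∀ k ∈ s, g k < 2 * n + 2)
    (hr : ∀ k ∈ s, 2 * (ell n - f k) + 2 * (ell n - g k) = r) :
    ⁅oscH n q c, c * ∑ k ∈ s, α k • (q (f k) * q (g k))⁆ =
      r • (c * ∑ k ∈ s, α k • (q (f k) * q (g k))) := by
  have hc : ⁅oscH n q c, c⁆ = 0 := by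
    rw [← commute_iff_lie_eq, h.H_eq]
    exact (h.c_quad _ _ _ _ _ h.central_inv (Commute.refl c)).symm
  rw [lie_sum_q, hc, zero_mul, zero_add, ← mul_smul_comm, Finset.smul_sum]
  congr 1
  refine Finset.sum_congr rfl fun k hk => ?_
  rw [lie_smul, lie_mul_q, h.H_lie (hf k hk), h.H_lie (hg k hk), ← hr k hk, mul_smul_comm,
    smul_mul_assoc, ← add_smul, smul_comm, add_comm]

theorem H_lie_E (h : HeisRel n q zz c) : ⁅oscH n q c, oscE n q c⁆ = (2 : ℂ) • oscE n q c := by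
  refine h.H_lie_quad _ _ _ _ _ ?_ ?_ ?_
  · intro k hk; rw [Finset.mem_Icc] at hk; omega
  · intro k hk; rw [Finset.mem_Icc] at hk; omega
  · intro k hk; rw [Finset.mem_Icc] at hk
    have : ((k - 1 : ℕ) : ℂ) + (2 * n + 1 - k : ℕ) = 2 * n := by
      have : (k - 1) + (2 * n + 1 - k) = 2 * n := by omega
      exact_mod_cast this
    linear_combination 2 * two_ell n - 2 * this

theorem H_lie_F (h : HeisRel n q zz c) : ⁅oscH n q c, oscF n q c⁆ = (-2 : ℂ) • oscF n q c := by
  refine h.H_lie_quad _ _ (fun k => k) _ _ ?_ ?_ ?_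
  · intro k hk; rw [Finset.mem_Icc] at hk; omega
  · intro k hk; rw [Finset.mem_Icc] at hk; omega
  · intro k hk; rw [Finset.mem_Icc] at hk
    have : ((k : ℕ) : ℂ) + (2 * n + 1 - k + 1 : ℕ) = 2 * n + 2 := by
      have : k + (2 * n + 1 - k + 1) = 2 * n + 2 := by omega
      exact_mod_cast this
    linear_combination 2 * two_ell n - 2 * this

/-- The coefficients of `F` in its symmetric form. -/
def coefF (n j : ℕ) : ℂ :=
  (-1) ^ (j + n) / (2 * ((j.factorial : ℂ) * ((2 * n - j).factorial : ℂ)))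

/-- The symmetric form of `F`. -/
theorem F_eq (h : HeisRel n q zz c) : oscF n q c =
    c * ∑ j ∈ Finset.range (2 * n + 1), coefF n j • (q (j + 1) * q (2 * n + 1 - j)) := by
  set β : ℕ → ℂ := fun j => (-1) ^ (j + 1 + n) * (ell n - (j + 1 : ℕ)) /
      ((j.factorial : ℂ) * ((2 * n - j).factorial : ℂ)) with hβ
  set X : ℕ → A := fun j => q (j + 1) * q (2 * n + 1 - j) with hX
  have h1 : oscF n q c = c * ∑ j ∈ Finset.range (2 * n + 1), β j • X j := by
    rw [oscF]
    congr 1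
    refine Finset.sum_nbij' (fun k => k - 1) (fun j => j + 1) ?_ ?_ ?_ ?_ ?_
    · intro k hk; rw [Finset.mem_Icc] at hk; rw [Finset.mem_range]; omega
    · intro k hk; rw [Finset.mem_range] at hk; rw [Finset.mem_Icc]; omega
    · intro k hk; rw [Finset.mem_Icc] at hk; omega
    · intro k hk; omega
    · intro k hk
      rw [Finset.mem_Icc] at hk
      have e1 : k - 1 + 1 = k := by omega
      have e2 : 2 * n - (k - 1) = 2 * n + 1 - k := by omega
      have e3 : 2 * n + 1 - (k - 1) = 2 * n + 1 - k + 1 := by omega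
      simp only [hβ, hX, e1, e2, e3]
  have h2 : ∑ j ∈ Finset.range (2 * n + 1), β j • X j =
      ∑ j ∈ Finset.range (2 * n + 1), β (2 * n - j) • X j := by
    rw [← Finset.sum_range_reflect]
    refine Finset.sum_congr rfl fun j hj => ?_
    rw [Finset.mem_range] at hj
    have e1 : 2 * n + 1 - 1 - j = 2 * n - j := by omega
    have e2 : 2 * n - j + 1 = 2 * n + 1 - j := by omega
    have e3 : 2 * n + 1 - (2 * n - j) = j + 1 := by omega
    have h3 := h.comm (j + 1) (2 * n + 1 - j)
    rw [if_neg (by omega), sub_eq_zero] at h3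
    simp only [hX, e1, e2, e3, h3]
  have h3 : ∀ j ∈ Finset.range (2 * n + 1),
      β j • X j + β (2 * n - j) • X j = (2 : ℂ) • (coefF n j • X j) := by
    intro j hj
    rw [Finset.mem_range] at hj
    obtain ⟨m, hm⟩ : ∃ m, j + m = 2 * n := ⟨2 * n - j, by omega⟩
    have e1 : 2 * n - j = m := by omega
    have e2 : 2 * n - m = j := by omega
    have f1 : (j.factorial : ℂ) ≠ 0 := by exact_mod_cast j.factorial_ne_zero
    have f2 : (m.factorial : ℂ) ≠ 0 := by exact_mod_cast m.factorial_ne_zero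
    rw [← add_smul, smul_smul]
    congr 1
    simp only [hβ, coefF, e1, e2, ell_eq hm, pow_add, pow_one, sign_eq hm]
    push_cast
    field_simp
    ring
  have h4 : (2 : ℂ) • ∑ j ∈ Finset.range (2 * n + 1), β j • X j =
      (2 : ℂ) • ∑ j ∈ Finset.range (2 * n + 1), coefF n j • X j := by
    rw [Finset.smul_sum (s := Finset.range (2 * n + 1)) (f := fun j => coefF n j • X j),
      ← Finset.sum_congr rfl h3, Finset.sum_add_distrib, ← h2, two_smul]
  rw [h1]
  congr 1
  have := congrArg (fun y => (2⁻¹ : ℂ) • y) h4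
  simpa [smul_smul] using this

theorem E_lie_F (h : HeisRel n q zz c) : ⁅oscE n q c, oscF n q c⁆ = oscH n q c := by
  have hc : ⁅oscE n q c, c⁆ = 0 := by
    rw [← commute_iff_lie_eq]
    exact (h.c_quad _ _ (fun k => k - 1) _ _ h.central_inv (Commute.refl c)).symm
  set Y : ℕ → A := fun k => q k * q (2 * n + 1 - k) with hY
  set a : ℕ → ℂ := fun k => (-1) ^ (k + n) * (2 * n + 1 - k : ℕ) * (k + 1) /
    (2 * ((k.factorial : ℂ) * ((2 * n + 1 - k).factorial : ℂ))) with ha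
  set b : ℕ → ℂ := fun k => -((-1) ^ (k + n) * k * ((2 * n + 1 - k : ℕ) + 1)) /
    (2 * ((k.factorial : ℂ) * ((2 * n + 1 - k).factorial : ℂ))) with hb
  have h1 : ∀ j ∈ Finset.range (2 * n + 1),
      ⁅oscE n q c, coefF n j • (q (j + 1) * q (2 * n + 1 - j))⁆ =
        b (j + 1) • Y (j + 1) + a j • Y j := by
    intro j hj
    rw [Finset.mem_range] at hj
    obtain ⟨m, hm⟩ : ∃ m, j + m = 2 * n := ⟨2 * n - j, by omega⟩
    have e1 : 2 * n - j = m := by omega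
    have e2 : 2 * n + 1 - j = m + 1 := by omega
    have e3 : 2 * n + 1 - (j + 1) = m := by omega
    have f1 : (j.factorial : ℂ) ≠ 0 := by exact_mod_cast j.factorial_ne_zero
    have f2 : (m.factorial : ℂ) ≠ 0 := by exact_mod_cast m.factorial_ne_zero
    have g1 : (j : ℂ) + 1 ≠ 0 := by exact_mod_cast j.succ_ne_zero
    have g2 : (m : ℂ) + 1 ≠ 0 := by exact_mod_cast m.succ_ne_zero
    rw [lie_smul, lie_mul_q, e2, h.E_lie (by omega), h.E_lie (by omega)]
    simp only [hY, ha, hb, e2, e3, Nat.add_sub_cancel, coefF, e1, mul_smul_comm, smul_mul_assoc,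
      smul_add, smul_smul, Nat.factorial_succ]
    push_cast
    congr 2
    · simp only [pow_add, pow_one]; field_simp
    · field_simp
  have h2 : ∀ k ∈ Finset.range (2 * n + 2), b k • Y k + a k • Y k = coefH n k • Y k := by
    intro k hk
    rw [Finset.mem_range] at hk
    obtain ⟨m, hm⟩ : ∃ m, k + m = 2 * n + 1 := ⟨2 * n + 1 - k, by omega⟩
    have e1 : 2 * n + 1 - k = m := by omega
    have f1 : (k.factorial : ℂ) ≠ 0 := by exact_mod_cast k.factorial_ne_zero
    have f2 : (m.factorial : ℂ) ≠ 0 := by exact_mod_cast m.factorial_ne_zero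
    have h3 : ell n = ((k : ℂ) + m) / 2 := by
      have : (k : ℂ) + m = 2 * n + 1 := by exact_mod_cast hm
      rw [this, ell]; ring
    rw [← add_smul]
    congr 1
    simp only [ha, hb, e1, coefH, h3]
    field_simp
    ring
  have h5 : ∑ k ∈ Finset.range (2 * n + 2), coefH n k • Y k =
      ∑ k ∈ Finset.range (2 * n + 2), coefH n k • (q (2 * n + 1 - k) * q k) := by
    rw [← Finset.sum_range_reflect]
    refine Finset.sum_congr rfl fun k hk => ?_
    rw [Finset.mem_range] at hk
    have e1 : 2 * n + 2 - 1 - k = 2 * n + 1 - k := by omega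
    have e2 : 2 * n + 1 - (2 * n + 1 - k) = k := by omega
    simp only [hY, e1, e2]
    rw [coefH_symm (k := k) (by omega)]
  rw [h.H_eq, ← h5, ← Finset.sum_congr rfl h2, h.F_eq, lie_sum_q, hc, zero_mul, zero_add,
    Finset.sum_congr rfl h1, Finset.sum_add_distrib, Finset.sum_add_distrib,
    Finset.sum_range_succ (fun k => a k • Y k) (2 * n + 1),
    Finset.sum_range_succ' (fun k => b k • Y k) (2 * n + 1)]
  simp [ha, hb]

theorem zz_quad (h : HeisRel n q zz c) :
    Commute zz (oscE n q c) ∧ Commute zz (oscF n q c) ∧ Commute zz (oscH n q c) :=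
  ⟨h.c_quad _ _ (fun k => k - 1) _ _ h.central h.zz_c,
    h.c_quad _ _ (fun k => k) _ _ h.central h.zz_c,
    by rw [h.H_eq]; exact h.c_quad _ _ _ _ _ h.central h.zz_c⟩

/-- The oscillator formulas define a morphism from the conformal Galilei algebra. -/
def toLieHom (h : HeisRel n q zz c) : Alg n →ₗ⁅ℂ⁆ A :=
  lieHomOfGen
    ((stdBasis n).constr ℂ fun
      | .e => oscE n q c
      | .h => oscH n q c
      | .f => oscF n q c
      | .p k => q k
      | .z => zz)
    (by
      set F := (stdBasis n).constr ℂ (M' := A) _ with hF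
      have he : F (gen .e) = oscE n q c := by simp [hF, gen]
      have hh : F (gen .h) = oscH n q c := by simp [hF, gen]
      have hf : F (gen .f) = oscF n q c := by simp [hF, gen]
      have hz : F (gen .z) = zz := by simp [hF, gen]
      have hp : ∀ k, F (gen (.p k)) = q k := fun k => by simp [hF, gen]
      have hP : ∀ k, F (P n k) = q k := fun k => by
        rw [P]; split_ifs with hk
        · exact hp _
        · rw [map_zero, h.zero k (by omega)]
      obtain ⟨z1, z2, z3⟩ := h.zz_quad
      rw [commute_iff_lie_eq] at z1 z2 z3
      have z4 : ∀ i, ⁅zz, q i⁆ = 0 := fun i => commute_iff_lie_eq.mp (h.central i)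
      have main : ∀ i j : Idx n, F (table n i j) = ⁅F (gen i), F (gen j)⁆ ∨
          F (table n j i) = ⁅F (gen j), F (gen i)⁆ := by
        intro i j
        cases i <;> cases j <;>
        simp only [table, map_smul, map_neg, he, hh, hf, hz, hp, hP, map_zero, lie_self, z1, z2,
          z3, z4, true_or, or_true, h.E_lie_F, h.H_lie_E, h.H_lie_F, neg_smul, h.E_lie (Fin.is_lt _),
          h.F_lie (Fin.is_lt _), h.H_lie (Fin.is_lt _)]
        left
        rw [h.lie_qq]
        split_ifs <;> simp [hz]
      intro i j
      rcases main i j with h1 | h1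
      · exact h1
      · rw [table_swap, map_neg, h1, lie_skew])

end HeisRel

end Oscillator

/-! ### The localization of the enveloping algebra of the Heisenberg algebra -/

/-- The enveloping algebra of the Heisenberg algebra. -/
abbrev UHeis (n : ℕ) : Type := UniversalEnvelopingAlgebra ℂ (heis n)

/-- The element `p_k` of the enveloping algebra of the Heisenberg algebra. -/
def uP (n k : ℕ) : UHeis n := UniversalEnvelopingAlgebra.ι ℂ ⟨P n k, P_mem_heis n k⟩

/-- The element `z` of the enveloping algebra of the Heisenberg algebra. -/
def uZ (n : ℕ) : UHeis n := UniversalEnvelopingAlgebra.ι ℂ ⟨gen .z, gen_mem_heis_z n⟩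

attribute [local instance 100] LieRing.ofAssociativeRing in
/-- The enveloping algebra is generated by the Lie algebra. -/
theorem mem_of_ι_mem {L : Type} [LieRing L] [LieAlgebra ℂ L]
    (S : Subalgebra ℂ (UniversalEnvelopingAlgebra ℂ L))
    (hS : ∀ x : L, UniversalEnvelopingAlgebra.ι ℂ x ∈ S) (u : UniversalEnvelopingAlgebra ℂ L) :
    u ∈ S := by
  let g : L →ₗ⁅ℂ⁆ S :=
    { toFun := fun x => ⟨UniversalEnvelopingAlgebra.ι ℂ x, hS x⟩
      map_add' := fun x y => Subtype.ext (map_add _ x y)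
      map_smul' := fun r x => Subtype.ext (map_smul _ r x)
      map_lie' := by
        intro x y
        apply Subtype.ext
        change UniversalEnvelopingAlgebra.ι ℂ ⁅x, y⁆ = _
        rw [LieHom.map_lie]
        rfl }
  have h : S.val.comp (UniversalEnvelopingAlgebra.lift ℂ g) = AlgHom.id ℂ _ := by
    apply UniversalEnvelopingAlgebra.hom_ext
    ext x
    change ((UniversalEnvelopingAlgebra.lift ℂ g (UniversalEnvelopingAlgebra.ι ℂ x) : S) :
      UniversalEnvelopingAlgebra ℂ L) = UniversalEnvelopingAlgebra.ι ℂ x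
    rw [UniversalEnvelopingAlgebra.lift_ι_apply]
    rfl
  have := DFunLike.congr_fun h u
  change ((UniversalEnvelopingAlgebra.lift ℂ g u : S) : UniversalEnvelopingAlgebra ℂ L) = u at this
  rw [← this]
  exact (UniversalEnvelopingAlgebra.lift ℂ g u).2

attribute [local instance 100] LieRing.ofAssociativeRing in
theorem uZ_comm (n : ℕ) (u : UHeis n) : Commute (uZ n) u := by
  have key : ∀ x : heis n, Commute (uZ n) (UniversalEnvelopingAlgebra.ι ℂ x) := by
    intro x
    rw [commute_iff_lie_eq, uZ, ← LieHom.map_lie]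
    have : ⁅(⟨gen .z, gen_mem_heis_z n⟩ : heis n), x⁆ = 0 := Subtype.ext (bracket_z (x : Alg n))
    rw [this, map_zero]
  exact Subalgebra.mem_centralizer_iff ℂ |>.mp
    (mem_of_ι_mem (Subalgebra.centralizer ℂ {uZ n}) (fun x => by
      rw [Subalgebra.mem_centralizer_iff]
      rintro _ rfl
      exact key x) u) _ rfl

/-- The multiplicative set of the powers of `z`. -/
def zPowers (n : ℕ) : Submonoid (UHeis n) := Submonoid.powers (uZ n)

theorem zPowers_comm {n : ℕ} (s : zPowers n) (u : UHeis n) : (s : UHeis n) * u = u * s := by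
  obtain ⟨k, hk⟩ := s.2
  rw [← hk]
  exact ((uZ_comm n u).pow_left k).eq

/-- The powers of the central element `z` form an Ore set. -/
instance (n : ℕ) : OreLocalization.OreSet (zPowers n) where
  ore_right_cancel r₁ r₂ s h := ⟨s, by rw [zPowers_comm, zPowers_comm, h]⟩
  oreNum r _ := r
  oreDenom _ s := s
  ore_eq r s := zPowers_comm s r

/-- The localization of the enveloping algebra of the Heisenberg algebra at the powers of `z`. -/
abbrev UHeisLoc (n : ℕ) : Type := (UHeis n)[(zPowers n)⁻¹]

/-- The element `z` of the multiplicative set of its powers. -/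
def zElt (n : ℕ) : zPowers n := ⟨uZ n, Submonoid.mem_powers _⟩

/-- The inverse of `z` in the localization. -/
def zInv (n : ℕ) : UHeisLoc n := 1 /ₒ zElt n

/-- The canonical map to the localization. -/
abbrev toLoc (n : ℕ) : UHeis n →+* UHeisLoc n := OreLocalization.numeratorRingHom

attribute [local instance 100] LieRing.ofAssociativeRing in
theorem heisRel_loc (n : ℕ) :
    HeisRel n (fun k => toLoc n (uP n k)) (toLoc n (uZ n)) (zInv n) where
  comm i j := by
    rw [← map_mul, ← map_mul, ← map_sub, ← LieRing.of_associative_ring_bracket, uP, uP,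
      ← LieHom.map_lie]
    have h1 : ⁅(⟨P n i, P_mem_heis n i⟩ : heis n), (⟨P n j, P_mem_heis n j⟩ : heis n)⁆ =
        if i + j = 2 * n + 1 then omega n i • ⟨gen .z, gen_mem_heis_z n⟩ else 0 := by
      apply Subtype.ext
      change ⁅P n i, P n j⁆ = _
      rw [bracket_def, bracket_P_P]
      split_ifs <;> rfl
    rw [h1]
    split_ifs
    · rw [map_smul]
      exact (OreLocalization.smul_oreDiv_one (S := zPowers n) (omega n i) (uZ n)).symm
    · rw [map_zero, map_zero]
  zero i hi := by
    have : (⟨P n i, P_mem_heis n i⟩ : heis n) = 0 := Subtype.ext (P_of_ge hi)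
    simp only [uP, this, map_zero]
  central i := (uZ_comm n (uP n i)).map (toLoc n)
  mul_eq := OreLocalization.mul_inv 1 (zElt n)
  eq_mul := OreLocalization.mul_inv (zElt n) 1

attribute [local instance 100] LieRing.ofAssociativeRing in
/-- The algebra homomorphism `Φ` from the enveloping algebra of the conformal Galilei algebra to
the localized enveloping algebra of the Heisenberg algebra: it maps `p_k` to `p_k`, `z` to `z`, and
`e, f, h` to the quadratic expressions `E, F, H`. -/
def Phi (n : ℕ) : UniversalEnvelopingAlgebra ℂ (Alg n) →ₐ[ℂ] UHeisLoc n :=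
  UniversalEnvelopingAlgebra.lift ℂ (heisRel_loc n).toLieHom

/-- For a module `V` over the Heisenberg algebra, the localization `U(H)_{(z)} ⊗_{U(H)} V`
(realised as the module of fractions with denominators the powers of `z`), regarded as a module
over the conformal Galilei algebra through `Φ`. -/
def Oscillator (n : ℕ) (V : Type) [AddCommGroup V] [Module (UHeis n) V] : Type :=
  V[(zPowers n)⁻¹]

section Oscillator

variable (n : ℕ) (V : Type) [AddCommGroup V] [Module ℂ V] [Module (UHeis n) V]
  [IsScalarTower ℂ (UHeis n) V]

instance : AddCommGroup (Oscillator n V) := inferInstanceAs (AddCommGroup (V[(zPowers n)⁻¹]))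
instance : Module (UHeisLoc n) (Oscillator n V) :=
  inferInstanceAs (Module (UHeisLoc n) (V[(zPowers n)⁻¹]))
instance : Module ℂ (Oscillator n V) := inferInstanceAs (Module ℂ (V[(zPowers n)⁻¹]))
instance : IsScalarTower ℂ (UHeisLoc n) (Oscillator n V) :=
  inferInstanceAs (IsScalarTower ℂ (UHeisLoc n) (V[(zPowers n)⁻¹]))

attribute [local instance 100] LieRing.ofAssociativeRing in
instance : LieRingModule (Alg n) (Oscillator n V) where
  bracket x v := Phi n (UniversalEnvelopingAlgebra.ι ℂ x) • v
  add_lie x y v := by simp only [map_add, add_smul]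
  lie_add x v w := smul_add _ _ _
  leibniz_lie x y v := by
    simp only [LieHom.map_lie, LieRing.of_associative_ring_bracket, map_sub, map_mul, sub_smul,
      mul_smul, sub_add_cancel]

instance : LieModule ℂ (Alg n) (Oscillator n V) where
  smul_lie c x v := by
    change Phi n (UniversalEnvelopingAlgebra.ι ℂ (c • x)) • v =
      c • (Phi n (UniversalEnvelopingAlgebra.ι ℂ x) • v)
    rw [map_smul, map_smul, smul_assoc]
  lie_smul c x v := by
    change Phi n (UniversalEnvelopingAlgebra.ι ℂ x) • (c • v) =
      c • (Phi n (UniversalEnvelopingAlgebra.ι ℂ x) • v)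
    rw [smul_algebra_smul_comm]

end Oscillator

end Galilei

end

/-!
The Heisenberg part of the conformal Galilei algebra splits off from every module on which `z` acts
by a scalar `a ≠ 0`. On such a module `M` the oscillator formulas, evaluated at the operators `p_k`,
define a second action of the whole algebra, which agrees with the given one on `p_k` and `z`. The
difference of the two is the *residual* action (`residual`). It kills the Heisenberg algebra and
commutes with it, so it is an action of `sl₂` by endomorphisms of the Heisenberg module `M`.

The *Fock space* is the polynomial ring in `l + 1/2 = n + 1` variables, with `p_k` acting by
derivatives for `k < l` and by multiplications for `k > l`. Since it carries the oscillator action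
and `sl₂`-modules carry only the residual one, a tensor product `Fock ⊗ W` has the action of `W` as
its residual action. On a highest weight vector the oscillator part of `h` is `-(l + 1/2)² / 2`,
hence the shift of the weight.

* `M(a, b) ≅ Fock ⊗ M_{sl₂}(b + (l + 1/2)² / 2)` (`vermaEquiv`): one map comes from the universal
  property of `M(a, b)`. For its inverse, the universal property of the `sl₂`-Verma module and the
  residual action on `M(a, b)` give `w ↦ ψ w`, and `f ⊗ w` is sent to `f(p_{2l}, p_{2l-1}, …) ψ w`;
  this is equivariant because the vectors `ψ w` are killed by all `p_k` with `k < l`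
  (`polyHom_fock_lie`). Both compositions fix generators, so the Poincaré–Birkhoff–Witt theorem is
  not needed.
* The localized Verma module of the Heisenberg algebra is the Fock space (`fockEquiv`): localizing
  changes nothing because `z` already acts invertibly, and the same two universal constructions
  apply.
* Every submodule of `Fock ⊗ W` is `Fock ⊗ N` for a unique submodule `N` of `W`
  (`fockSubmoduleEquiv`): repeated derivatives isolate the coefficients of a tensor, and conversely
  the multiplications rebuild it from them. This isomorphism of lattices carries the sum of all
  proper submodules to the sum of all proper submodules (`OrderIso.map_sSup_ne_top`), so it also
  identifies the simple quotients (`simpleQuotientEquiv`) and transfers irreducibility.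
* For `sl₂` the vectors `f^k v` are a basis of the Verma module (`fBasis`), with pairwise
  different `h`-eigenvalues and `e f^{k+1} v = (k + 1)(λ - k) f^k v`. Hence there is a largest proper
  submodule, and the module is irreducible exactly when `λ` is not a natural number
  (`isIrreducible_vermaSl2_iff`).
-/

open scoped TensorProduct OreLocalization

noncomputable section

namespace Galilei

attribute [local instance 100] LieRing.ofAssociativeRing

/-! ### The universal property of induced modules -/

namespace Ind

variable {𝔤 : Type} [LieRing 𝔤] [LieAlgebra ℂ 𝔤] (𝔟 : LieSubalgebra ℂ 𝔤)
  (χ : LieAlgebra.LieCharacter ℂ 𝔟)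

/-- The projection from the enveloping algebra to the induced module. -/
def mk : UniversalEnvelopingAlgebra ℂ 𝔤 →ₗ[UniversalEnvelopingAlgebra ℂ 𝔤] Ind 𝔟 χ :=
  Submodule.mkQ _

theorem mk_surjective : Function.Surjective (mk 𝔟 χ) := Submodule.mkQ_surjective _

/-- The generator of the induced module, the class of `1`. -/
def vac : Ind 𝔟 χ := mk 𝔟 χ 1

theorem smul_vac (u : UniversalEnvelopingAlgebra ℂ 𝔤) : u • vac 𝔟 χ = mk 𝔟 χ u := by
  rw [vac, ← map_smul, smul_eq_mul, mul_one]

theorem lie_def (x : 𝔤) (m : Ind 𝔟 χ) : ⁅x, m⁆ = UniversalEnvelopingAlgebra.ι ℂ x • m := rfl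

theorem lie_vac (x : 𝔟) : ⁅(x : 𝔤), vac 𝔟 χ⁆ = χ x • vac 𝔟 χ := by
  rw [lie_def, ← algebraMap_smul (UniversalEnvelopingAlgebra ℂ 𝔤) (χ x), ← sub_eq_zero, ← sub_smul]
  change mk 𝔟 χ (_ * 1) = 0
  rw [mul_one]
  exact (Submodule.Quotient.mk_eq_zero _).mpr (Submodule.subset_span ⟨x, rfl⟩)

variable {𝔟 χ}

/-- The induced module is generated by the class of `1`. -/
theorem mem_of_vac_mem (S : Submodule ℂ (Ind 𝔟 χ)) (h1 : vac 𝔟 χ ∈ S)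
    (hS : ∀ x : 𝔤, ∀ m ∈ S, ⁅x, m⁆ ∈ S) (m : Ind 𝔟 χ) : m ∈ S := by
  let A : Subalgebra ℂ (UniversalEnvelopingAlgebra ℂ 𝔤) :=
    { carrier := {u | ∀ m ∈ S, u • m ∈ S}
      mul_mem' := fun {u v} hu hv m hm => by rw [mul_smul]; exact hu _ (hv _ hm)
      add_mem' := fun {u v} hu hv m hm => by rw [add_smul]; exact S.add_mem (hu _ hm) (hv _ hm)
      algebraMap_mem' := fun r m hm => by rw [algebraMap_smul]; exact S.smul_mem _ hm }
  obtain ⟨u, rfl⟩ := mk_surjective 𝔟 χ m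
  rw [← smul_vac]
  exact mem_of_ι_mem A hS u _ h1

variable {M : Type} [AddCommGroup M] [Module ℂ M] (ρ : 𝔤 →ₗ⁅ℂ⁆ Module.End ℂ M) (v : M)
  (hv : ∀ x : 𝔟, ρ x v = χ x • v)

/-- The universal property of the induced module: a vector `v` of a representation `ρ` on which the
subalgebra acts by the character is the image of the generator under a morphism. -/
def lift : Ind 𝔟 χ →ₗ[ℂ] M :=
  letI : Module (UniversalEnvelopingAlgebra ℂ 𝔤) M :=
    Module.compHom M (UniversalEnvelopingAlgebra.lift ℂ ρ).toRingHom
  haveI : IsScalarTower ℂ (UniversalEnvelopingAlgebra ℂ 𝔤) M :=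
    ⟨fun c u m => by
      change UniversalEnvelopingAlgebra.lift ℂ ρ (c • u) m =
        c • UniversalEnvelopingAlgebra.lift ℂ ρ u m
      rw [map_smul]; rfl⟩
  let F : Ind 𝔟 χ →ₗ[UniversalEnvelopingAlgebra ℂ 𝔤] M :=
    Submodule.liftQ _ (LinearMap.toSpanSingleton (UniversalEnvelopingAlgebra ℂ 𝔤) M v) (by
      rw [Submodule.span_le]
      rintro _ ⟨x, rfl⟩
      change UniversalEnvelopingAlgebra.lift ℂ ρ (UniversalEnvelopingAlgebra.ι ℂ (x : 𝔤) -
        algebraMap ℂ _ (χ x)) v = 0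
      rw [map_sub, UniversalEnvelopingAlgebra.lift_ι_apply, AlgHom.commutes, LinearMap.sub_apply,
        hv, Module.algebraMap_end_apply, sub_self])
  F.restrictScalars ℂ

theorem lift_mk (u : UniversalEnvelopingAlgebra ℂ 𝔤) :
    lift ρ v hv (mk 𝔟 χ u) = UniversalEnvelopingAlgebra.lift ℂ ρ u v := rfl

theorem lift_vac : lift ρ v hv (vac 𝔟 χ) = v := by
  rw [vac, lift_mk, map_one]; rfl

theorem lift_lie (x : 𝔤) (m : Ind 𝔟 χ) : lift ρ v hv ⁅x, m⁆ = ρ x (lift ρ v hv m) := by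
  obtain ⟨u, rfl⟩ := mk_surjective 𝔟 χ m
  have e : ⁅x, mk 𝔟 χ u⁆ = mk 𝔟 χ (UniversalEnvelopingAlgebra.ι ℂ x * u) := rfl
  rw [e, lift_mk, lift_mk, map_mul, UniversalEnvelopingAlgebra.lift_ι_apply]
  rfl

end Ind

/-! ### Functoriality of the oscillator formulas -/

namespace HeisRel

variable {n : ℕ} {A : Type} [Ring A] [Algebra ℂ A] {q : ℕ → A} {zz c : A}

theorem toLieHom_e (h : HeisRel n q zz c) : h.toLieHom (gen .e) = oscE n q c := by
  change (stdBasis n).constr ℂ _ (stdBasis n .e) = _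
  rw [Module.Basis.constr_basis]

theorem toLieHom_h (h : HeisRel n q zz c) : h.toLieHom (gen .h) = oscH n q c := by
  change (stdBasis n).constr ℂ _ (stdBasis n .h) = _
  rw [Module.Basis.constr_basis]

theorem toLieHom_f (h : HeisRel n q zz c) : h.toLieHom (gen .f) = oscF n q c := by
  change (stdBasis n).constr ℂ _ (stdBasis n .f) = _
  rw [Module.Basis.constr_basis]

theorem toLieHom_z (h : HeisRel n q zz c) : h.toLieHom (gen .z) = zz := by
  change (stdBasis n).constr ℂ _ (stdBasis n .z) = _
  rw [Module.Basis.constr_basis]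

theorem toLieHom_p (h : HeisRel n q zz c) (k : Fin (2 * n + 2)) :
    h.toLieHom (gen (.p k)) = q k := by
  change (stdBasis n).constr ℂ _ (stdBasis n (.p k)) = _
  rw [Module.Basis.constr_basis]

theorem toLieHom_P (h : HeisRel n q zz c) (k : ℕ) : h.toLieHom (P n k) = q k := by
  rw [P]
  split_ifs with hk
  · exact h.toLieHom_p ⟨k, hk⟩
  · rw [map_zero, h.zero k (by omega)]

/-- A linear map that intertwines two actions of the Heisenberg algebra intertwines the actions of
the conformal Galilei algebra given by the oscillator formulas. -/
theorem map_toLieHom_smul (h : HeisRel n q zz c) {B : Type} [Ring B] [Algebra ℂ B] {q' : ℕ → B}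
    {zz' c' : B} (h' : HeisRel n q' zz' c') {M M' : Type} [AddCommGroup M] [Module ℂ M]
    [Module A M] [IsScalarTower ℂ A M] [AddCommGroup M'] [Module ℂ M'] [Module B M']
    [IsScalarTower ℂ B M'] (T : M →ₗ[ℂ] M') (hq : ∀ k m, T (q k • m) = q' k • T m)
    (hz : ∀ m, T (zz • m) = zz' • T m) (hc : ∀ m, T (c • m) = c' • T m) (x : Alg n) (m : M) :
    T (h.toLieHom x • m) = h'.toLieHom x • T m := by
  induction x using gen_induction with
  | h0 => simp
  | hadd x y hx hy => simp only [map_add, add_smul, hx, hy]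
  | hsmul r x hx =>
    rw [map_smul h.toLieHom, map_smul h'.toLieHom, smul_assoc, smul_assoc, map_smul, hx]
  | hg i =>
    cases i with
    | e => simp only [toLieHom_e, oscE, mul_smul, Finset.sum_smul, smul_assoc, map_sum, map_smul,
        hc, hq]
    | f => simp only [toLieHom_f, oscF, mul_smul, Finset.sum_smul, smul_assoc, map_sum, map_smul,
        hc, hq]
    | h =>
      have h2 : ∀ {C : Type} [Ring C] [Algebra ℂ C] (y : C), 2 * y = (2 : ℂ) • y := by
        intro C _ _ y; rw [two_mul, two_smul]
      simp only [toLieHom_h, oscH, h2, mul_smul, Finset.sum_smul, smul_assoc, map_sum, map_smul,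
        sub_smul, map_sub, algebraMap_smul, hc, hq]
    | p k => rw [toLieHom_p, toLieHom_p, hq]
    | z => rw [toLieHom_z, toLieHom_z, hz]

/-! ### The action of creation operators -/

open scoped IsMulCommutative in
/-- The algebra morphism that evaluates a polynomial at the commuting elements
`q (2l), q (2l - 1), …, q (l + 1/2)`. -/
def polyHom (h : HeisRel n q zz c) : MvPolynomial (Fin (n + 1)) ℂ →ₐ[ℂ] A :=
  let s : Set A := Set.range fun i : Fin (n + 1) => q (2 * n + 1 - i)
  haveI : IsMulCommutative (Algebra.adjoin ℂ s) := Algebra.isMulCommutative_adjoin ℂ (by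
    rintro _ ⟨i, rfl⟩ _ ⟨j, rfl⟩
    have := h.comm (2 * n + 1 - i) (2 * n + 1 - j)
    rwa [if_neg (by omega), sub_eq_zero] at this)
  (Algebra.adjoin ℂ s).val.comp (MvPolynomial.aeval fun i : Fin (n + 1) =>
    (⟨q (2 * n + 1 - i), Algebra.subset_adjoin ⟨i, rfl⟩⟩ : Algebra.adjoin ℂ s))

theorem polyHom_X (h : HeisRel n q zz c) (i : Fin (n + 1)) :
    h.polyHom (MvPolynomial.X i) = q (2 * n + 1 - i) := by
  simp only [polyHom, AlgHom.comp_apply, MvPolynomial.aeval_X]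
  rfl

/-- A linear map that intertwines the creation operators intertwines the polynomials in them. -/
theorem map_polyHom_smul (h : HeisRel n q zz c) {B : Type} [Ring B] [Algebra ℂ B] {q' : ℕ → B}
    {zz' c' : B} (h' : HeisRel n q' zz' c') {M M' : Type} [AddCommGroup M] [Module ℂ M]
    [Module A M] [IsScalarTower ℂ A M] [AddCommGroup M'] [Module ℂ M'] [Module B M']
    [IsScalarTower ℂ B M'] (T : M →ₗ[ℂ] M') (hq : ∀ k m, T (q k • m) = q' k • T m)
    (f : MvPolynomial (Fin (n + 1)) ℂ) (m : M) : T (h.polyHom f • m) = h'.polyHom f • T m := by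
  induction f using MvPolynomial.induction_on generalizing m with
  | C r =>
    rw [MvPolynomial.C_eq_smul_one, map_smul h.polyHom, map_smul h'.polyHom, map_one, map_one,
      smul_assoc, smul_assoc, one_smul, one_smul, map_smul]
  | add f g hf hg => rw [map_add, map_add, add_smul, add_smul, map_add, hf, hg]
  | mul_X f i hf => rw [map_mul, map_mul, polyHom_X, polyHom_X, mul_smul, mul_smul, hf, hq]

/-- Whatever commutes with the `q k` commutes with the polynomials in them. -/
theorem commute_polyHom (h : HeisRel n q zz c) {y : A} (hy : ∀ k, Commute y (q k))
    (f : MvPolynomial (Fin (n + 1)) ℂ) : Commute y (h.polyHom f) := by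
  induction f using MvPolynomial.induction_on with
  | C r =>
    rw [MvPolynomial.C_eq_smul_one, map_smul, map_one]
    exact (Commute.one_right y).smul_right r
  | add f g hf hg => rw [map_add]; exact hf.add_right hg
  | mul_X f i hf => rw [map_mul, polyHom_X]; exact hf.mul_right (hy _)

/-- The annihilation operators act on polynomials in the creation operators by derivations. -/
theorem q_mul_polyHom (h : HeisRel n q zz c) (i : Fin (n + 1))
    (f : MvPolynomial (Fin (n + 1)) ℂ) :
    q i * h.polyHom f =
      h.polyHom f * q i + omega n i • (zz * h.polyHom (MvPolynomial.pderiv i f)) := by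
  induction f using MvPolynomial.induction_on with
  | C r =>
    rw [MvPolynomial.pderiv_C, map_zero, mul_zero, smul_zero, add_zero,
      MvPolynomial.C_eq_smul_one, map_smul, map_one, mul_smul_comm, smul_mul_assoc, one_mul,
      mul_one]
  | add f g hf hg => simp only [map_add, mul_add, add_mul, hf, hg, smul_add]; abel
  | mul_X f j hf =>
    have h1 := h.comm i (2 * n + 1 - j)
    rw [sub_eq_iff_eq_add] at h1
    have hz : zz * h.polyHom f = h.polyHom f * zz := (h.commute_polyHom h.central f).eq
    rw [map_mul, polyHom_X, ← mul_assoc, hf, add_mul, mul_assoc, h1, mul_add, mul_assoc,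
      MvPolynomial.pderiv_mul, map_add, map_mul, polyHom_X, MvPolynomial.pderiv_X]
    by_cases hij : j = i
    · subst hij
      rw [if_pos (by omega), Pi.single_eq_same, mul_one, mul_add zz, smul_add, hz,
        mul_smul_comm, smul_mul_assoc, mul_assoc zz]
      abel
    · rw [if_neg (by omega), Pi.single_eq_of_ne hij, mul_zero, mul_zero, map_zero, add_zero,
        zero_add, smul_mul_assoc, mul_assoc zz]

end HeisRel

/-! ### The Fock space -/

/-- The operators of the Heisenberg algebra on polynomials: for `k < l` the element `p_k` acts by a
multiple of the derivative with respect to the `k`-th variable, and `p_{2l - k}` acts by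
multiplication by this variable. -/
def fockOp (n : ℕ) (a : ℂ) (k : ℕ) : Module.End ℂ (MvPolynomial (Fin (n + 1)) ℂ) :=
  if h : k < n + 1 then (omega n k * a) • (MvPolynomial.pderiv ⟨k, h⟩).toLinearMap
  else if h' : k < 2 * n + 2 then LinearMap.mulLeft ℂ (MvPolynomial.X ⟨2 * n + 1 - k, by omega⟩)
  else 0

theorem fockOp_annihilation (n : ℕ) (a : ℂ) (i : Fin (n + 1)) (f : MvPolynomial (Fin (n + 1)) ℂ) :
    fockOp n a i f = (omega n i * a) • MvPolynomial.pderiv i f := by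
  rw [fockOp, dif_pos i.2]; rfl

theorem fockOp_creation (n : ℕ) (a : ℂ) (i : Fin (n + 1)) (f : MvPolynomial (Fin (n + 1)) ℂ) :
    fockOp n a (2 * n + 1 - i) f = MvPolynomial.X i * f := by
  have : (⟨2 * n + 1 - (2 * n + 1 - i), by omega⟩ : Fin (n + 1)) = i := by ext; simp; omega
  rw [fockOp, dif_neg (by omega), dif_pos (by omega), this]; rfl

theorem fockOp_eq_zero (n : ℕ) (a : ℂ) {k : ℕ} (hk : 2 * n + 2 ≤ k) : fockOp n a k = 0 := by
  rw [fockOp, dif_neg (by omega), dif_neg (by omega)]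

/-- Every index is the index of an annihilation operator, of a creation operator, or too large. -/
theorem index_cases {n : ℕ} {C : ℕ → Prop} (h1 : ∀ i : Fin (n + 1), C i)
    (h2 : ∀ i : Fin (n + 1), C (2 * n + 1 - i)) (h3 : ∀ k, 2 * n + 2 ≤ k → C k) (k : ℕ) : C k := by
  by_cases hk : k < n + 1
  · exact h1 ⟨k, hk⟩
  by_cases hk' : k < 2 * n + 2
  · have := h2 ⟨2 * n + 1 - k, by omega⟩
    simp only at this
    rwa [show 2 * n + 1 - (2 * n + 1 - k) = k by omega] at this
  · exact h3 k (by omega)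

theorem pderiv_comm {σ : Type} (i j : σ) (f : MvPolynomial σ ℂ) :
    MvPolynomial.pderiv i (MvPolynomial.pderiv j f) =
      MvPolynomial.pderiv j (MvPolynomial.pderiv i f) := by
  classical
  have h : ⁅MvPolynomial.pderiv (R := ℂ) i, MvPolynomial.pderiv (R := ℂ) j⁆ = 0 := by
    refine MvPolynomial.derivation_ext fun k => ?_
    rw [Derivation.commutator_apply, MvPolynomial.pderiv_X, MvPolynomial.pderiv_X]
    simp [Pi.single_apply, apply_ite]
  rw [← sub_eq_zero, ← Derivation.commutator_apply, h, Derivation.zero_apply]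

theorem fockOp_comm (n : ℕ) (a : ℂ) (i j : ℕ) (f : MvPolynomial (Fin (n + 1)) ℂ) :
    fockOp n a i (fockOp n a j f) - fockOp n a j (fockOp n a i f) =
      if i + j = 2 * n + 1 then (omega n i * a) • f else 0 := by
  have key : ∀ i j : Fin (n + 1),
      fockOp n a i (fockOp n a (2 * n + 1 - j) f) - fockOp n a (2 * n + 1 - j) (fockOp n a i f) =
      if (i : ℕ) + (2 * n + 1 - j) = 2 * n + 1 then (omega n i * a) • f else 0 := by
    intro i j
    simp only [fockOp_annihilation, fockOp_creation, MvPolynomial.pderiv_mul,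
      MvPolynomial.pderiv_X]
    by_cases hij : j = i
    · subst hij
      rw [if_pos (by omega), Pi.single_eq_same, one_mul, smul_add, mul_smul_comm,
        add_sub_cancel_right]
    · rw [if_neg (by omega), Pi.single_eq_of_ne hij, zero_mul, zero_add, mul_smul_comm, sub_self]
  induction i using index_cases (n := n) with
  | h1 i =>
    induction j using index_cases (n := n) with
    | h1 j =>
      rw [if_neg (by omega)]
      simp only [fockOp_annihilation, map_smul]
      rw [smul_smul, smul_smul, mul_comm, pderiv_comm, sub_self]
    | h2 j => exact key i j
    | h3 j hj => simp [fockOp_eq_zero n a hj, show (i : ℕ) + j ≠ 2 * n + 1 by omega]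
  | h2 i =>
    induction j using index_cases (n := n) with
    | h1 j =>
      rw [← neg_sub, key j i]
      split_ifs with h1 h2 h2
      · rw [omega_swap (k := 2 * n + 1 - i) (k' := j) (by omega), neg_mul, neg_smul, neg_neg]
      · omega
      · omega
      · exact neg_zero
    | h2 j =>
      rw [if_neg (by omega), fockOp_creation, fockOp_creation, fockOp_creation, fockOp_creation,
        mul_left_comm, sub_self]
    | h3 j hj => simp [fockOp_eq_zero n a hj, show 2 * n + 1 - i + j ≠ 2 * n + 1 by omega]
  | h3 i hi => simp [fockOp_eq_zero n a hi, show i + j ≠ 2 * n + 1 by omega]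

/-- The operators `fockOp` form a representation of the Heisenberg algebra in which `z` acts by
`a`. -/
theorem fockRel (n : ℕ) (a : ℂ) [NeZero a] :
    HeisRel n (fockOp n a) (algebraMap ℂ _ a) (algebraMap ℂ _ a⁻¹) where
  comm i j := by
    refine LinearMap.ext fun f => (fockOp_comm n a i j f).trans ?_
    split_ifs
    · exact mul_smul _ _ _
    · rfl
  zero _ := fockOp_eq_zero n a
  central k := Algebra.commutes a _
  mul_eq := by rw [← map_mul, inv_mul_cancel₀ (NeZero.ne a), map_one]
  eq_mul := by rw [← map_mul, mul_inv_cancel₀ (NeZero.ne a), map_one]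

/-- The Fock space: polynomials in `l + 1/2 = n + 1` variables, on which `z` acts by `a` and the
conformal Galilei algebra acts by the oscillator formulas. -/
def Fock (n : ℕ) (_a : ℂ) : Type := MvPolynomial (Fin (n + 1)) ℂ

section Fock

variable (n : ℕ) (a : ℂ)

instance : AddCommGroup (Fock n a) := inferInstanceAs (AddCommGroup (MvPolynomial (Fin (n + 1)) ℂ))
instance : Module ℂ (Fock n a) := inferInstanceAs (Module ℂ (MvPolynomial (Fin (n + 1)) ℂ))

/-- A polynomial, regarded as a vector of the Fock space. -/
def fockOf : MvPolynomial (Fin (n + 1)) ℂ ≃ₗ[ℂ] Fock n a := LinearEquiv.refl ℂ _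

variable [NeZero a]

instance : LieRingModule (Alg n) (Fock n a) :=
  LieRingModule.compLieHom (MvPolynomial (Fin (n + 1)) ℂ) (fockRel n a).toLieHom
instance : LieModule ℂ (Alg n) (Fock n a) :=
  LieModule.compLieHom (MvPolynomial (Fin (n + 1)) ℂ) (fockRel n a).toLieHom

variable {n a}

theorem fock_lie (x : Alg n) (f : MvPolynomial (Fin (n + 1)) ℂ) :
    ⁅x, fockOf n a f⁆ = fockOf n a ((fockRel n a).toLieHom x f) := rfl

theorem fock_lie_P (k : ℕ) (f : MvPolynomial (Fin (n + 1)) ℂ) :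
    ⁅P n k, fockOf n a f⁆ = fockOf n a (fockOp n a k f) := by
  rw [fock_lie, HeisRel.toLieHom_P]

theorem fock_lie_z (f : Fock n a) : ⁅(gen .z : Alg n), f⁆ = a • f := by
  obtain ⟨f, rfl⟩ := (fockOf n a).surjective f
  rw [fock_lie, HeisRel.toLieHom_z]; rfl

end Fock

namespace HeisRel

variable {n : ℕ} {a : ℂ} {A : Type} [Ring A] [Algebra ℂ A] {q : ℕ → A} {c : A}
  {M : Type} [AddCommGroup M] [Module A M]

/-- A vacuum vector `y` defines a morphism of modules over the Heisenberg algebra from the Fock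
space. -/
theorem polyHom_fockOp_smul (h : HeisRel n q (algebraMap ℂ A a) c) {y : M}
    (hy : ∀ i : Fin (n + 1), q i • y = 0) (k : ℕ) (f : MvPolynomial (Fin (n + 1)) ℂ) :
    h.polyHom (fockOp n a k f) • y = q k • h.polyHom f • y := by
  induction k using index_cases (n := n) with
  | h1 i =>
    rw [fockOp_annihilation, smul_smul, q_mul_polyHom, add_smul, mul_smul _ (q i), hy, smul_zero,
      zero_add, map_smul, mul_smul, ← Algebra.smul_def]
  | h2 i => rw [fockOp_creation, map_mul, polyHom_X, mul_smul]
  | h3 k hk => rw [fockOp_eq_zero n a hk, h.zero k hk, LinearMap.zero_apply, map_zero, zero_smul,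
      zero_smul]

end HeisRel

/-! ### The projection onto `sl₂` -/

section Projection

variable {n : ℕ}

theorem sl2Proj_e : sl2Proj n (gen .e) = ⟨gen .e, gen_mem_sl2_e n⟩ :=
  Module.Basis.constr_basis _ _ _ _

theorem sl2Proj_h : sl2Proj n (gen .h) = ⟨gen .h, gen_mem_sl2_h n⟩ :=
  Module.Basis.constr_basis _ _ _ _

theorem sl2Proj_f : sl2Proj n (gen .f) = ⟨gen .f, gen_mem_sl2_f n⟩ :=
  Module.Basis.constr_basis _ _ _ _

theorem sl2Proj_z : sl2Proj n (gen .z) = 0 :=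
  Module.Basis.constr_basis _ _ _ _

theorem sl2Proj_P (k : ℕ) : sl2Proj n (P n k) = 0 := by
  rw [P]
  split_ifs
  · exact Module.Basis.constr_basis _ _ _ _
  · exact map_zero _

theorem mem_spanSub {s : Set (Idx n)}
    {hs : ∀ i ∈ s, ∀ j ∈ s, table n i j ∈ Submodule.span ℂ ((gen : Idx n → Alg n) '' s)}
    {x : Alg n} : x ∈ spanSub s hs ↔ x ∈ Submodule.span ℂ ((gen : Idx n → Alg n) '' s) := Iff.rfl

theorem sl2_induction {C : Alg n → Prop} (h0 : C 0) (hadd : ∀ x y, C x → C y → C (x + y))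
    (hsmul : ∀ (c : ℂ) x, C x → C (c • x)) (he : C (gen .e)) (hh : C (gen .h)) (hf : C (gen .f))
    {x : Alg n} (hx : x ∈ sl2 n) : C x := by
  rw [sl2, mem_spanSub] at hx
  induction hx using Submodule.span_induction with
  | zero => exact h0
  | add a b _ _ ha hb => exact hadd a b ha hb
  | smul c a _ ha => exact hsmul c a ha
  | mem a ha =>
    obtain ⟨i, rfl | rfl | rfl, rfl⟩ := ha
    · exact he
    · exact hh
    · exact hf

theorem sl2Proj_coe (x : sl2 n) : sl2Proj n x = x := by
  apply Subtype.ext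
  refine sl2_induction (C := fun x => (sl2Proj n x : Alg n) = x) ?_ ?_ ?_ ?_ ?_ ?_ x.2
  · simp
  · intro x y hx hy
    simp [hx, hy]
  · intro c x hx
    simp [hx]
  · rw [sl2Proj_e]
  · rw [sl2Proj_h]
  · rw [sl2Proj_f]

end Projection

/-! ### Modules of non-zero central charge -/

section CentralCharge

variable {n : ℕ} {a : ℂ} [NeZero a] {M : Type} [AddCommGroup M] [Module ℂ M]
  [LieRingModule (Alg n) M] [LieModule ℂ (Alg n) M]

/-- The operators `p_k` of a module on which `z` acts by `a ≠ 0` satisfy the relations that the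
oscillator formulas need, with `1 / z` acting by `a⁻¹`. -/
theorem moduleRel (hz : ∀ m : M, ⁅(gen .z : Alg n), m⁆ = a • m) :
    HeisRel n (fun k => LieModule.toEnd ℂ (Alg n) M (P n k)) (algebraMap ℂ _ a)
      (algebraMap ℂ _ a⁻¹) where
  comm i j := by
    rw [← LieRing.of_associative_ring_bracket, ← LieHom.map_lie, bracket_def, bracket_P_P]
    split_ifs
    · rw [map_smul]
      congr 1
      ext1 m
      exact hz m
    · exact map_zero _
  zero k hk := by rw [P_of_ge hk, map_zero]
  central k := Algebra.commutes a _
  mul_eq := by rw [← map_mul, inv_mul_cancel₀ (NeZero.ne a), map_one]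
  eq_mul := by rw [← map_mul, mul_inv_cancel₀ (NeZero.ne a), map_one]

variable (hz : ∀ m : M, ⁅(gen .z : Alg n), m⁆ = a • m)

/-- The part of the action that the Heisenberg algebra determines through the oscillator
formulas. -/
def oscPart : Alg n →ₗ⁅ℂ⁆ Module.End ℂ M := (moduleRel hz).toLieHom

theorem oscPart_P (k : ℕ) : oscPart hz (P n k) = LieModule.toEnd ℂ (Alg n) M (P n k) :=
  (moduleRel hz).toLieHom_P k

theorem oscPart_z : oscPart hz (gen .z) = LieModule.toEnd ℂ (Alg n) M (gen .z) := by
  ext1 m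
  rw [oscPart, HeisRel.toLieHom_z]
  exact (hz m).symm

/-- The two actions that are subtracted agree on the Heisenberg algebra, which is an ideal; hence
their difference commutes with it. -/
theorem commute_residual_P (x : Alg n) (k : ℕ) :
    Commute (LieModule.toEnd ℂ (Alg n) M x - oscPart hz x)
      (LieModule.toEnd ℂ (Alg n) M (P n k)) := by
  rw [commute_iff_lie_eq, sub_lie, ← LieHom.map_lie, ← oscPart_P hz, ← LieHom.map_lie, sub_eq_zero]
  by_cases hk : k < 2 * n + 2
  · induction x using gen_induction with
    | h0 => simp
    | hadd x y hx hy => rw [add_lie, map_add, map_add, hx, hy]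
    | hsmul c x hx => rw [smul_lie, map_smul, map_smul, hx]
    | hg i =>
      rw [bracket_def]
      cases i with
      | e => rw [bracket_e_P hk, map_smul, map_smul, oscPart_P]
      | h => rw [bracket_h_P, map_smul, map_smul, oscPart_P]
      | f => rw [bracket_f_P hk, map_smul, map_smul, oscPart_P]
      | p j =>
        rw [← P_of_lt, bracket_P_P]
        split_ifs
        · rw [map_smul, map_smul, oscPart_z]
        · rw [map_zero, map_zero]
      | z => rw [bracket_z_P, map_zero, map_zero]
  · rw [P_of_ge (by omega), lie_zero, map_zero, map_zero]

theorem commute_residual_oscPart (x y : Alg n) :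
    Commute (LieModule.toEnd ℂ (Alg n) M x - oscPart hz x) (oscPart hz y) := by
  have hq := commute_residual_P hz x
  have hc := Algebra.commute_algebraMap_right (a⁻¹)
    (LieModule.toEnd ℂ (Alg n) M x - oscPart hz x)
  induction y using gen_induction with
  | h0 => simp
  | hadd y y' h h' => rw [map_add]; exact h.add_right h'
  | hsmul c y h => rw [map_smul]; exact h.smul_right c
  | hg i =>
    cases i with
    | e =>
      rw [oscPart, HeisRel.toLieHom_e]
      exact (moduleRel hz).c_quad _ _ (fun k => k - 1) _ _ hq hc
    | h =>
      rw [oscPart, HeisRel.toLieHom_h, HeisRel.H_eq (moduleRel hz)]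
      exact (moduleRel hz).c_quad _ _ _ _ _ hq hc
    | f =>
      rw [oscPart, HeisRel.toLieHom_f]
      exact (moduleRel hz).c_quad _ _ (fun k => k) _ _ hq hc
    | p k => rw [← P_of_lt, oscPart_P]; exact hq k
    | z =>
      rw [oscPart, HeisRel.toLieHom_z]
      exact Algebra.commute_algebraMap_right _ _

/-- The residual action: the difference of the action and of its oscillator part. It is again a
representation because it commutes with the oscillator part. -/
def residual : Alg n →ₗ⁅ℂ⁆ Module.End ℂ M :=
  { (LieModule.toEnd ℂ (Alg n) M : Alg n →ₗ[ℂ] Module.End ℂ M) -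
      (oscPart hz : Alg n →ₗ[ℂ] Module.End ℂ M) with
    map_lie' := by
      intro x y
      change LieModule.toEnd ℂ (Alg n) M ⁅x, y⁆ - oscPart hz ⁅x, y⁆ =
        ⁅LieModule.toEnd ℂ (Alg n) M x - oscPart hz x, LieModule.toEnd ℂ (Alg n) M y - oscPart hz y⁆
      have h1 := commute_iff_lie_eq.mp (commute_residual_oscPart hz x y)
      have h2 := commute_iff_lie_eq.mp (commute_residual_oscPart hz y x)
      rw [sub_lie, sub_eq_zero] at h1 h2
      rw [lie_sub, sub_lie, sub_lie, LieHom.map_lie, LieHom.map_lie, h1, sub_self, sub_zero,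
        ← lie_skew (oscPart hz x) (LieModule.toEnd ℂ (Alg n) M y), h2, lie_skew] }

theorem residual_apply (x : Alg n) (m : M) : residual hz x m = ⁅x, m⁆ - oscPart hz x m := rfl

theorem residual_P (k : ℕ) : residual hz (P n k) = 0 := by
  change LieModule.toEnd ℂ (Alg n) M (P n k) - oscPart hz (P n k) = 0
  rw [oscPart_P, sub_self]

theorem residual_z : residual hz (gen .z) = 0 := by
  change LieModule.toEnd ℂ (Alg n) M (gen .z) - oscPart hz (gen .z) = 0
  rw [oscPart_z, sub_self]

/-- The residual action factors through the projection onto `sl₂`. -/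
theorem residual_sl2Proj (x : Alg n) : residual hz (sl2Proj n x) = residual hz x := by
  induction x using gen_induction with
  | h0 => simp
  | hadd x y hx hy => simp [hx, hy]
  | hsmul c x hx => simp [hx]
  | hg i =>
    cases i with
    | e => rw [sl2Proj_e]
    | h => rw [sl2Proj_h]
    | f => rw [sl2Proj_f]
    | p k =>
      rw [← P_of_lt, residual_P, sl2Proj_P]
      exact map_zero _
    | z =>
      rw [residual_z, sl2Proj_z]
      exact map_zero _

theorem commute_residual_polyHom (x : Alg n) (f : MvPolynomial (Fin (n + 1)) ℂ) :
    Commute (residual hz x) ((moduleRel hz).polyHom f) :=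
  (moduleRel hz).commute_polyHom (commute_residual_P hz x) f

/-- The linear map from the Fock space defined by a vacuum vector intertwines the oscillator
actions. -/
theorem polyHom_fock_lie {y : M} (hy : ∀ i : Fin (n + 1), ⁅P n i, y⁆ = 0) (x : Alg n)
    (f : MvPolynomial (Fin (n + 1)) ℂ) :
    (moduleRel hz).polyHom ((fockRel n a).toLieHom x f) y =
      oscPart hz x ((moduleRel hz).polyHom f y) := by
  refine (fockRel n a).map_toLieHom_smul (moduleRel hz)
    (((LinearMap.applyₗ y).comp (moduleRel hz).polyHom.toLinearMap)) ?_ ?_ ?_ x f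
  · intro k f
    exact (moduleRel hz).polyHom_fockOp_smul (y := y) hy k f
  · intro f
    change (moduleRel hz).polyHom (a • f) y = a • (moduleRel hz).polyHom f y
    rw [map_smul, LinearMap.smul_apply]
  · intro f
    change (moduleRel hz).polyHom (a⁻¹ • f) y = a⁻¹ • (moduleRel hz).polyHom f y
    rw [map_smul, LinearMap.smul_apply]

end CentralCharge

/-! ### Tensor products with the Fock space -/

section Inflation

variable {n : ℕ} {V : Type} [AddCommGroup V] [Module ℂ V] [LieRingModule (sl2 n) V]
  [LieModule ℂ (sl2 n) V]

variable (n V) in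
/-- A vector of an `sl₂`-module, regarded as a vector of its inflation. -/
def inflOf : V ≃ₗ[ℂ] Inflation n V := LinearEquiv.refl ℂ _

omit [LieModule ℂ (sl2 n) V] in
theorem inflation_lie (x : Alg n) (w : V) :
    ⁅x, inflOf n V w⁆ = inflOf n V ⁅sl2Proj n x, w⁆ := rfl

omit [LieModule ℂ (sl2 n) V] in
theorem inflation_lie_P (k : ℕ) (w : Inflation n V) : ⁅P n k, w⁆ = 0 := by
  obtain ⟨w, rfl⟩ := (inflOf n V).surjective w
  rw [inflation_lie, sl2Proj_P, zero_lie, map_zero]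

omit [LieModule ℂ (sl2 n) V] in
theorem inflation_lie_z (w : Inflation n V) : ⁅(gen .z : Alg n), w⁆ = 0 := by
  obtain ⟨w, rfl⟩ := (inflOf n V).surjective w
  rw [inflation_lie, sl2Proj_z, zero_lie, map_zero]

end Inflation

/-- The tensor product of the Fock space and an inflated `sl₂`-module. -/
abbrev FockTensor (n : ℕ) (a : ℂ) (V : Type) [AddCommGroup V] [Module ℂ V] : Type :=
  Fock n a ⊗[ℂ] Inflation n V

section FockTensor

variable {n : ℕ} {a : ℂ} {V : Type} [AddCommGroup V] [Module ℂ V]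

@[elab_as_elim]
theorem fockTensor_induction {C : FockTensor n a V → Prop} (t : FockTensor n a V) (h0 : C 0)
    (hadd : ∀ s t, C s → C t → C (s + t))
    (htmul : ∀ f w, C (fockOf n a f ⊗ₜ[ℂ] inflOf n V w)) : C t := by
  induction t using TensorProduct.induction_on with
  | zero => exact h0
  | add s t hs ht => exact hadd s t hs ht
  | tmul f w => exact htmul f w

variable [NeZero a] [LieRingModule (sl2 n) V] [LieModule ℂ (sl2 n) V]

theorem fockTensor_lie_P (k : ℕ) (f : MvPolynomial (Fin (n + 1)) ℂ) (w : Inflation n V) :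
    ⁅P n k, fockOf n a f ⊗ₜ[ℂ] w⁆ = fockOf n a (fockOp n a k f) ⊗ₜ[ℂ] w := by
  rw [TensorProduct.LieModule.lie_tmul_right, inflation_lie_P, TensorProduct.tmul_zero, add_zero,
    fock_lie_P]

theorem fockTensor_lie_z (t : FockTensor n a V) : ⁅(gen .z : Alg n), t⁆ = a • t := by
  induction t using TensorProduct.induction_on with
  | zero => simp
  | add s t hs ht => rw [lie_add, hs, ht, smul_add]
  | tmul f w =>
    rw [TensorProduct.LieModule.lie_tmul_right, inflation_lie_z, TensorProduct.tmul_zero, add_zero,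
      fock_lie_z, TensorProduct.smul_tmul']

/-- On a tensor product with the Fock space, the oscillator part of the action is the action on the
first factor. -/
theorem oscPart_fockTensor (x : Alg n) (f : MvPolynomial (Fin (n + 1)) ℂ) (w : Inflation n V) :
    oscPart (fockTensor_lie_z (a := a) (V := V)) x (fockOf n a f ⊗ₜ[ℂ] w) =
      ⁅x, fockOf n a f⁆ ⊗ₜ[ℂ] w := by
  refine ((fockRel n a).map_toLieHom_smul (moduleRel (fockTensor_lie_z (a := a) (V := V)))
    (((TensorProduct.mk ℂ (Fock n a) (Inflation n V)).flip w).comp (fockOf n a).toLinearMap)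
    ?_ ?_ ?_ x f).symm
  · intro k f
    exact (fockTensor_lie_P k f w).symm
  · intro f
    exact TensorProduct.smul_tmul' a (fockOf n a f) w
  · intro f
    exact TensorProduct.smul_tmul' a⁻¹ (fockOf n a f) w

/-- On a tensor product with the Fock space, the residual action is the action on the second
factor. -/
theorem residual_fockTensor (x : Alg n) (f : MvPolynomial (Fin (n + 1)) ℂ) (w : Inflation n V) :
    residual (fockTensor_lie_z (a := a) (V := V)) x (fockOf n a f ⊗ₜ[ℂ] w) =
      fockOf n a f ⊗ₜ[ℂ] ⁅x, w⁆ := by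
  rw [residual_apply, oscPart_fockTensor, TensorProduct.LieModule.lie_tmul_right,
    add_sub_cancel_left]

theorem polyHom_fockTensor (f g : MvPolynomial (Fin (n + 1)) ℂ) (w : Inflation n V) :
    (moduleRel (fockTensor_lie_z (a := a) (V := V))).polyHom f (fockOf n a g ⊗ₜ[ℂ] w) =
      fockOf n a (f * g) ⊗ₜ[ℂ] w := by
  induction f using MvPolynomial.induction_on generalizing g with
  | C r =>
    rw [MvPolynomial.C_eq_smul_one, map_smul, map_one, smul_mul_assoc, one_mul, map_smul,
      ← TensorProduct.smul_tmul']
    rfl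
  | add f f' h h' =>
    rw [map_add, LinearMap.add_apply, h, h', add_mul, map_add, TensorProduct.add_tmul]
  | mul_X f i h =>
    rw [map_mul, HeisRel.polyHom_X, Module.End.mul_apply, LieModule.toEnd_apply_apply,
      fockTensor_lie_P, fockOp_creation, h, mul_assoc]

end FockTensor

/-! ### The Verma module of the conformal Galilei algebra -/

section Verma

variable {n : ℕ} {a b : ℂ}

theorem borel_induction {C : Alg n → Prop} (h0 : C 0) (hadd : ∀ x y, C x → C y → C (x + y))
    (hsmul : ∀ (c : ℂ) x, C x → C (c • x)) (hh : C (gen .h)) (hz : C (gen .z)) (he : C (gen .e))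
    (hp : ∀ i : Fin (n + 1), C (P n i)) {x : Alg n} (hx : x ∈ borel n) : C x := by
  change x ∈ Submodule.span ℂ ((gen : Idx n → Alg n) '' nonnegIdx n) at hx
  induction hx using Submodule.span_induction with
  | zero => exact h0
  | add x y _ _ hx hy => exact hadd x y hx hy
  | smul c x _ hx => exact hsmul c x hx
  | mem x hx =>
    obtain ⟨i, (rfl | rfl | rfl) | ⟨k, hk, rfl⟩, rfl⟩ := hx
    · exact hh
    · exact hz
    · exact he
    · rw [← P_of_lt]
      exact hp ⟨k, by omega⟩

theorem weightFun_h : weightFun n a b (gen .h) = b := Module.Basis.constr_basis _ _ _ _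

theorem weightFun_z : weightFun n a b (gen .z) = a := Module.Basis.constr_basis _ _ _ _

theorem weightFun_e : weightFun n a b (gen .e) = 0 := Module.Basis.constr_basis _ _ _ _

theorem weightFun_P (k : ℕ) : weightFun n a b (P n k) = 0 := by
  rw [P]
  split_ifs
  · exact Module.Basis.constr_basis _ _ _ _
  · exact map_zero _

/-- The non-negative part acts through the character on a vector as soon as its generators do. -/
theorem weight_of_gen {M : Type} [AddCommGroup M] [Module ℂ M] (ρ : Alg n →ₗ⁅ℂ⁆ Module.End ℂ M)
    {v : M} (hh : ρ (gen .h) v = b • v) (hz : ρ (gen .z) v = a • v) (he : ρ (gen .e) v = 0)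
    (hp : ∀ i : Fin (n + 1), ρ (P n i) v = 0) {x : Alg n} (hx : x ∈ borel n) :
    ρ x v = weightFun n a b x • v := by
  refine borel_induction (C := fun x => ρ x v = weightFun n a b x • v) ?_ ?_ ?_ ?_ ?_ ?_ ?_ hx
  · simp
  · intro x y hx hy
    rw [map_add, map_add, LinearMap.add_apply, hx, hy, add_smul]
  · intro c x hx
    rw [map_smul, map_smul, LinearMap.smul_apply, hx, smul_eq_mul, mul_smul]
  · rw [hh, weightFun_h]
  · rw [hz, weightFun_z]
  · rw [he, weightFun_e, zero_smul]
  · intro i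
    rw [hp, weightFun_P, zero_smul]

theorem gen_h_mem_borel : gen .h ∈ borel n := gen_mem_span (by simp [nonnegIdx])
theorem gen_e_mem_borel : gen .e ∈ borel n := gen_mem_span (by simp [nonnegIdx])
theorem gen_z_mem_borel : gen .z ∈ borel n := gen_mem_span (by simp [nonnegIdx])
theorem P_mem_borel (i : Fin (n + 1)) : P n i ∈ borel n :=
  P_mem_span _ fun j hj => Or.inr ⟨j, by omega, rfl⟩

/-- The highest weight vector of the Verma module. -/
abbrev vermaVac (n : ℕ) (a b : ℂ) : Verma n a b := Ind.vac _ _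

/-- The highest weight vector of the Verma module of `sl₂`. -/
abbrev sl2Vac (n : ℕ) (b : ℂ) : VermaSl2 n b := Ind.vac _ _

theorem verma_lie_vac {x : Alg n} (hx : x ∈ borel n) :
    ⁅x, vermaVac n a b⁆ = weightFun n a b x • vermaVac n a b :=
  Ind.lie_vac (borel n) (weightChar n a b) ⟨x, hx⟩

theorem verma_lie_z (m : Verma n a b) : ⁅(gen .z : Alg n), m⁆ = a • m := by
  refine Ind.mem_of_vac_mem (LinearMap.eqLocus (LieModule.toEnd ℂ (Alg n) (Verma n a b) (gen .z))
    (algebraMap ℂ (Module.End ℂ (Verma n a b)) a)) ?_ ?_ m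
  · change ⁅(gen .z : Alg n), vermaVac n a b⁆ = a • vermaVac n a b
    rw [verma_lie_vac gen_z_mem_borel, weightFun_z]
  · intro x m hm
    change ⁅(gen .z : Alg n), m⁆ = a • m at hm
    change ⁅(gen .z : Alg n), ⁅x, m⁆⁆ = a • ⁅x, m⁆
    have h0 : ⁅(gen .z : Alg n), x⁆ = 0 := bracket_z x
    rw [leibniz_lie, h0, zero_lie, zero_add, hm, lie_smul]

/-- The oscillator part of the action on a vacuum vector: it has weight `-(l + 1/2)² / 2`. -/
theorem osc_vacuum {A : Type} [Ring A] [Algebra ℂ A] {q : ℕ → A} {zz c : A} (h : HeisRel n q zz c)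
    {M : Type} [AddCommGroup M] [Module ℂ M] [Module A M] [IsScalarTower ℂ A M] {v : M}
    (hv : ∀ i : Fin (n + 1), q i • v = 0) :
    oscE n q c • v = 0 ∧ oscH n q c • v = -((ell n + 1 / 2) ^ 2 / 2) • v := by
  have hv' : ∀ k, k < n + 1 → q k • v = 0 := fun k hk => hv ⟨k, hk⟩
  constructor
  · rw [oscE, mul_smul, Finset.sum_smul, Finset.sum_eq_zero, smul_zero]
    intro k hk
    rw [Finset.mem_Icc] at hk
    rw [smul_assoc]
    by_cases h1 : k < n + 1
    · -- one of the two commuting factors is an annihilation operator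
      have := h.comm (k - 1) (2 * n + 1 - k)
      rw [if_neg (by omega), sub_eq_zero] at this
      rw [this, mul_smul, hv' (k - 1) (by omega), smul_zero, smul_zero]
    · rw [mul_smul, hv' (2 * n + 1 - k) (by omega), smul_zero, smul_zero]
  · rw [oscH, sub_smul, mul_smul, Finset.sum_smul, Finset.sum_eq_zero, smul_zero, zero_sub,
      algebraMap_smul, neg_smul]
    intro k hk
    rw [Finset.mem_range] at hk
    rw [smul_assoc, mul_smul, hv' k hk, smul_zero, smul_zero]

theorem ind_lie_vac {𝔞 : LieSubalgebra ℂ (Alg n)} (x : 𝔞) (hx : (x : Alg n) ∈ borel n) :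
    ⁅x, Ind.vac (borelIn 𝔞) (weightCharIn 𝔞 a b)⁆ = weightFun n a b x • Ind.vac _ _ :=
  Ind.lie_vac (borelIn 𝔞) (weightCharIn 𝔞 a b) ⟨x, hx⟩

variable [NeZero a]

variable (n a b) in
/-- The `sl₂`-weight of the highest weight vector after the oscillator part has been removed. -/
abbrev shifted : ℂ := b + 1 / 2 * (ell n + 1 / 2) ^ 2

variable (n a b) in
/-- The morphism from the Verma module of the conformal Galilei algebra to the tensor product. -/
def vermaToTensor : Verma n a b →ₗ[ℂ] FockTensor n a (VermaSl2 n (shifted n b)) :=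
  Ind.lift (LieModule.toEnd ℂ (Alg n) (FockTensor n a (VermaSl2 n (shifted n b))))
    (fockOf n a 1 ⊗ₜ[ℂ] inflOf n _ (sl2Vac n (shifted n b))) (by
      have hp : ∀ i : Fin (n + 1), fockOp n a i 1 = 0 := fun i => by
        rw [fockOp_annihilation, MvPolynomial.pderiv_one, smul_zero]
      obtain ⟨h1, h2⟩ := osc_vacuum (fockRel n a) (v := 1) hp
      rw [Module.End.smul_def] at h1 h2
      have he : ⁅(gen .e : Alg n), inflOf n _ (sl2Vac n (shifted n b))⁆ = 0 := by
        rw [inflation_lie, sl2Proj_e, ind_lie_vac _ gen_e_mem_borel, weightFun_e, zero_smul,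
          map_zero]
      have hh : ⁅(gen .h : Alg n), inflOf n _ (sl2Vac n (shifted n b))⁆ =
          shifted n b • inflOf n _ (sl2Vac n (shifted n b)) := by
        rw [inflation_lie, sl2Proj_h, ind_lie_vac _ gen_h_mem_borel, weightFun_h, map_smul]
      rintro ⟨x, hx⟩
      refine weight_of_gen _ ?_ (fockTensor_lie_z _) ?_ ?_ hx
      · rw [LieModule.toEnd_apply_apply, TensorProduct.LieModule.lie_tmul_right, hh, fock_lie,
          HeisRel.toLieHom_h, h2, map_smul, ← TensorProduct.smul_tmul', TensorProduct.tmul_smul,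
          ← add_smul]
        congr 1
        ring
      · rw [LieModule.toEnd_apply_apply, TensorProduct.LieModule.lie_tmul_right, he, fock_lie,
          HeisRel.toLieHom_e, TensorProduct.tmul_zero, add_zero, h1, map_zero,
          TensorProduct.zero_tmul]
      · intro i
        rw [LieModule.toEnd_apply_apply, fockTensor_lie_P, hp, map_zero, TensorProduct.zero_tmul])

theorem vermaToTensor_vac : vermaToTensor n a b (vermaVac n a b) =
    fockOf n a 1 ⊗ₜ[ℂ] inflOf n _ (sl2Vac n (shifted n b)) := Ind.lift_vac _ _ _

theorem vermaToTensor_lie (x : Alg n) (m : Verma n a b) :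
    vermaToTensor n a b ⁅x, m⁆ = ⁅x, vermaToTensor n a b m⁆ := Ind.lift_lie _ _ _ _ _

omit [NeZero a] in
theorem verma_vac_P (i : Fin (n + 1)) : ⁅P n i, vermaVac n a b⁆ = 0 := by
  rw [verma_lie_vac (P_mem_borel i), weightFun_P, zero_smul]

variable (n a b) in
/-- The Verma module of `sl₂` maps to the Verma module of the conformal Galilei algebra with its
residual action. -/
def sl2ToVerma : VermaSl2 n (shifted n b) →ₗ[ℂ] Verma n a b :=
  Ind.lift ((residual (verma_lie_z (n := n) (a := a) (b := b))).comp (sl2 n).incl)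
    (vermaVac n a b) (by
    have hz := verma_lie_z (n := n) (a := a) (b := b)
    obtain ⟨h1, h2⟩ := osc_vacuum (moduleRel hz) (v := vermaVac n a b) (verma_vac_P (b := b))
    rw [Module.End.smul_def] at h1 h2
    rintro ⟨⟨x, _⟩, hx⟩
    refine weight_of_gen (residual hz) ?_ ?_ ?_ ?_ hx
    · rw [residual_apply, verma_lie_vac gen_h_mem_borel, weightFun_h, oscPart, HeisRel.toLieHom_h,
        h2, ← sub_smul]
      congr 1
      ring
    · rw [residual_z, zero_smul]; rfl
    · rw [residual_apply, verma_lie_vac gen_e_mem_borel, weightFun_e, oscPart, HeisRel.toLieHom_e,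
        h1, zero_smul, sub_zero]
    · intro i
      rw [residual_P]; rfl)

theorem sl2ToVerma_vac : sl2ToVerma n a b (sl2Vac n _) = vermaVac n a b := Ind.lift_vac _ _ _

theorem sl2ToVerma_lie (x : sl2 n) (w : VermaSl2 n (shifted n b)) :
    sl2ToVerma n a b ⁅x, w⁆ =
      residual (verma_lie_z (a := a) (b := b)) (x : Alg n) (sl2ToVerma n a b w) :=
  Ind.lift_lie _ _ _ _ _

theorem sl2ToVerma_vacuum (w : VermaSl2 n (shifted n b)) (i : Fin (n + 1)) :
    ⁅P n i, sl2ToVerma n a b w⁆ = 0 := by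
  refine Ind.mem_of_vac_mem (LinearMap.ker
    ((LieModule.toEnd ℂ (Alg n) (Verma n a b) (P n i)).comp (sl2ToVerma n a b))) ?_ ?_ w
  · change ⁅P n i, sl2ToVerma n a b (sl2Vac n _)⁆ = 0
    rw [sl2ToVerma_vac, verma_vac_P]
  · intro x w hw
    change ⁅P n i, sl2ToVerma n a b _⁆ = 0 at hw ⊢
    have := (commute_residual_P (verma_lie_z (n := n) (a := a) (b := b)) x i).eq
    rw [sl2ToVerma_lie]
    refine (DFunLike.congr_fun this _).symm.trans ?_
    rw [Module.End.mul_apply, LieModule.toEnd_apply_apply, hw, map_zero]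

variable (n a b) in
/-- The inverse map, `f ⊗ w ↦ f(p_{2l}, p_{2l-1}, …) w`. -/
def tensorToVerma : FockTensor n a (VermaSl2 n (shifted n b)) →ₗ[ℂ] Verma n a b :=
  TensorProduct.lift (LinearMap.compl₁₂ (LinearMap.id (R := ℂ) (M := Module.End ℂ (Verma n a b)))
    ((moduleRel (verma_lie_z (a := a))).polyHom.toLinearMap.comp (fockOf n a).symm.toLinearMap)
    ((sl2ToVerma n a b).comp (inflOf n _).symm.toLinearMap))

theorem tensorToVerma_tmul (f : MvPolynomial (Fin (n + 1)) ℂ) (w : VermaSl2 n (shifted n b)) :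
    tensorToVerma n a b (fockOf n a f ⊗ₜ[ℂ] inflOf n _ w) =
      (moduleRel (verma_lie_z (a := a))).polyHom f (sl2ToVerma n a b w) := rfl

theorem tensorToVerma_lie (x : Alg n) (t : FockTensor n a (VermaSl2 n (shifted n b))) :
    tensorToVerma n a b ⁅x, t⁆ = ⁅x, tensorToVerma n a b t⁆ := by
  induction t using fockTensor_induction with
  | h0 => simp
  | hadd s t hs ht => rw [lie_add, map_add, map_add, lie_add, hs, ht]
  | htmul f w =>
    have hz := verma_lie_z (n := n) (a := a) (b := b)
    have h2 := DFunLike.congr_fun (commute_residual_polyHom hz x f).eq (sl2ToVerma n a b w)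
    rw [Module.End.mul_apply, Module.End.mul_apply, residual_apply] at h2
    rw [TensorProduct.LieModule.lie_tmul_right, map_add, fock_lie, inflation_lie,
      tensorToVerma_tmul, tensorToVerma_tmul, tensorToVerma_tmul, sl2ToVerma_lie,
      polyHom_fock_lie hz (sl2ToVerma_vacuum w), residual_sl2Proj, ← h2, add_sub_cancel]

theorem tensorToVerma_vermaToTensor (m : Verma n a b) :
    tensorToVerma n a b (vermaToTensor n a b m) = m := by
  refine Ind.mem_of_vac_mem (LinearMap.eqLocus
    ((tensorToVerma n a b).comp (vermaToTensor n a b)) LinearMap.id) ?_ ?_ m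
  · change tensorToVerma n a b (vermaToTensor n a b (vermaVac n a b)) = vermaVac n a b
    rw [vermaToTensor_vac, tensorToVerma_tmul, map_one, sl2ToVerma_vac]
    rfl
  · intro x m hm
    change tensorToVerma n a b (vermaToTensor n a b _) = _ at hm ⊢
    rw [vermaToTensor_lie, tensorToVerma_lie, hm]
    rfl

theorem vermaToTensor_residual (x : Alg n) (m : Verma n a b) :
    vermaToTensor n a b (residual (verma_lie_z (a := a)) x m) =
      residual fockTensor_lie_z x (vermaToTensor n a b m) := by
  rw [residual_apply, residual_apply, map_sub, vermaToTensor_lie]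
  congr 1
  refine (moduleRel (verma_lie_z (a := a) (b := b))).map_toLieHom_smul
    (moduleRel (fockTensor_lie_z (a := a) (V := VermaSl2 n (shifted n b)))) (vermaToTensor n a b)
    ?_ ?_ ?_ x m
  · exact fun k m => vermaToTensor_lie (P n k) m
  · exact fun m => map_smul (vermaToTensor n a b) a m
  · exact fun m => map_smul (vermaToTensor n a b) a⁻¹ m

theorem vermaToTensor_polyHom (f : MvPolynomial (Fin (n + 1)) ℂ) (m : Verma n a b) :
    vermaToTensor n a b ((moduleRel (verma_lie_z (a := a))).polyHom f m) =
      (moduleRel (fockTensor_lie_z (a := a))).polyHom f (vermaToTensor n a b m) := by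
  refine (moduleRel (verma_lie_z (a := a) (b := b))).map_polyHom_smul
    (moduleRel (fockTensor_lie_z (a := a) (V := VermaSl2 n (shifted n b)))) (vermaToTensor n a b)
    ?_ f m
  exact fun k m => vermaToTensor_lie (P n k) m

theorem vermaToTensor_sl2ToVerma (w : VermaSl2 n (shifted n b)) :
    vermaToTensor n a b (sl2ToVerma n a b w) = fockOf n a 1 ⊗ₜ[ℂ] inflOf n _ w := by
  refine Ind.mem_of_vac_mem (LinearMap.eqLocus
    ((vermaToTensor n a b).comp (sl2ToVerma n a b))
      ((TensorProduct.mk ℂ (Fock n a) (Inflation n (VermaSl2 n (shifted n b))) (fockOf n a 1)).comp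
        (inflOf n _).toLinearMap)) ?_ ?_ w
  · change vermaToTensor n a b (sl2ToVerma n a b (sl2Vac n _)) = _
    rw [sl2ToVerma_vac, vermaToTensor_vac]
    rfl
  · intro x w hw
    change vermaToTensor n a b (sl2ToVerma n a b _) = fockOf n a 1 ⊗ₜ[ℂ] inflOf n _ _ at hw ⊢
    rw [sl2ToVerma_lie, vermaToTensor_residual, hw, residual_fockTensor, inflation_lie, sl2Proj_coe]

theorem vermaToTensor_tensorToVerma (t : FockTensor n a (VermaSl2 n (shifted n b))) :
    vermaToTensor n a b (tensorToVerma n a b t) = t := by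
  induction t using fockTensor_induction with
  | h0 => simp
  | hadd s t hs ht => rw [map_add, map_add, hs, ht]
  | htmul f w =>
    rw [tensorToVerma_tmul, vermaToTensor_polyHom, vermaToTensor_sl2ToVerma, polyHom_fockTensor,
      mul_one]

variable (n a b) in
/-- The Verma module of the conformal Galilei algebra is the tensor product of the Fock space and
the Verma module of `sl₂` of the shifted weight. -/
def vermaEquiv :
    Verma n a b ≃ₗ⁅ℂ, Alg n⁆ FockTensor n a (VermaSl2 n (shifted n b)) :=
  { vermaToTensor n a b with
    map_lie' := vermaToTensor_lie _ _
    invFun := tensorToVerma n a b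
    left_inv := tensorToVerma_vermaToTensor
    right_inv := vermaToTensor_tensorToVerma }

end Verma

/-! ### The Verma module of the Heisenberg algebra -/

section Heisenberg

variable {n : ℕ} {a : ℂ}

theorem heis_induction {C : Alg n → Prop} (h0 : C 0) (hadd : ∀ x y, C x → C y → C (x + y))
    (hsmul : ∀ (c : ℂ) x, C x → C (c • x)) (hz : C (gen .z)) (hp : ∀ k, C (P n k))
    {x : Alg n} (hx : x ∈ heis n) : C x := by
  rw [heis, mem_spanSub] at hx
  induction hx using Submodule.span_induction with
  | zero => exact h0
  | add x y _ _ hx hy => exact hadd x y hx hy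
  | smul c x _ hx => exact hsmul c x hx
  | mem x hx =>
    obtain ⟨i, rfl | ⟨k, rfl⟩, rfl⟩ := hx
    · exact hz
    · rw [← P_of_lt]
      exact hp _

/-- The highest weight of `h` plays no role on the Heisenberg algebra, which does not contain
`h`. -/
theorem weightFun_heis (b b' : ℂ) {x : Alg n} (hx : x ∈ heis n) :
    weightFun n a b x = weightFun n a b' x := by
  refine heis_induction (C := fun x => weightFun n a b x = weightFun n a b' x) ?_ ?_ ?_ ?_ ?_ hx
  · simp
  · intro x y hx hy
    rw [map_add, map_add, hx, hy]
  · intro c x hx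
    rw [map_smul, map_smul, hx]
  · rw [weightFun_z, weightFun_z]
  · intro k
    rw [weightFun_P, weightFun_P]

/-- The highest weight vector of the Verma module of the Heisenberg algebra. -/
abbrev heisVac (n : ℕ) (a : ℂ) : VermaHeis n a := Ind.vac _ _

theorem uZ_smul (v : VermaHeis n a) : uZ n • v = a • v := by
  refine Ind.mem_of_vac_mem (LinearMap.eqLocus
    (LieModule.toEnd ℂ (heis n) (VermaHeis n a) ⟨gen .z, gen_mem_heis_z n⟩)
    (algebraMap ℂ (Module.End ℂ (VermaHeis n a)) a)) ?_ ?_ v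
  · change ⁅(⟨gen .z, gen_mem_heis_z n⟩ : heis n), heisVac n a⁆ = a • heisVac n a
    rw [ind_lie_vac _ gen_z_mem_borel, weightFun_z]
  · intro x m hm
    change uZ n • m = a • m at hm
    change uZ n • ⁅x, m⁆ = a • ⁅x, m⁆
    rw [Ind.lie_def, ← mul_smul, (uZ_comm n _).eq, mul_smul, hm, smul_algebra_smul_comm]

theorem uP_smul_heisVac (i : Fin (n + 1)) : uP n i • heisVac n a = 0 := by
  change ⁅(⟨P n i, P_mem_heis n i⟩ : heis n), heisVac n a⁆ = 0
  rw [ind_lie_vac _ (P_mem_borel i), weightFun_P, zero_smul]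

theorem zPowers_smul [NeZero a] (s : zPowers n) :
    ∃ r : ℂ, r ≠ 0 ∧ ∀ v : VermaHeis n a, s • v = r • v := by
  obtain ⟨_, k, rfl⟩ := s
  refine ⟨a ^ k, pow_ne_zero k (NeZero.ne a), fun v => ?_⟩
  change uZ n ^ k • v = a ^ k • v
  induction k with
  | zero => rw [pow_zero, pow_zero, one_smul, one_smul]
  | succ k ih => rw [pow_succ', mul_smul, ih, uZ_smul, smul_smul, pow_succ']

/-- The canonical map to the localization. -/
def toOscillator (n : ℕ) (a : ℂ) : VermaHeis n a →ₗ[ℂ] Oscillator n (VermaHeis n a) where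
  toFun v := (v /ₒ (1 : zPowers n) : (VermaHeis n a)[(zPowers n)⁻¹])
  map_add' _ _ := OreLocalization.add_oreDiv.symm
  map_smul' c v := (OreLocalization.smul_oreDiv_one c v).symm

theorem toLoc_smul_toOscillator (u : UHeis n) (v : VermaHeis n a) :
    toLoc n u • toOscillator n a v = toOscillator n a (u • v) := by
  refine (OreLocalization.oreDiv_smul_char u v 1 1 u 1
    (by rw [OneMemClass.coe_one, one_mul, mul_one])).trans ?_
  rw [mul_one]
  rfl

variable [NeZero a]

/-- The element `z` acts on the Verma module invertibly, so that the localization changes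
nothing. -/
theorem toOscillator_bijective : Function.Bijective (toOscillator n a) := by
  constructor
  · intro v w hvw
    obtain ⟨u, u', h1, h2⟩ := OreLocalization.oreDiv_eq_iff.mp hvw
    obtain ⟨r, hr, hu⟩ := zPowers_smul (a := a) u
    have h3 : (u : UHeis n) = u' := by simpa using h2
    have h4 : u • w = u • v := by rw [h1, ← h3]; rfl
    rw [hu, hu] at h4
    exact (smul_right_injective _ hr h4).symm
  · intro o
    induction o using OreLocalization.ind with
    | _ v s =>
      obtain ⟨r, hr, hs⟩ := zPowers_smul (a := a) s
      refine ⟨r⁻¹ • v, ?_⟩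
      refine (OreLocalization.expand' (r⁻¹ • v) 1 s).trans ?_
      rw [mul_one, hs, smul_smul, mul_inv_cancel₀ hr, one_smul]

theorem oscillator_z_smul (o : Oscillator n (VermaHeis n a)) : toLoc n (uZ n) • o = a • o := by
  obtain ⟨v, rfl⟩ := toOscillator_bijective.2 o
  rw [toLoc_smul_toOscillator, uZ_smul, map_smul]

omit [NeZero a] in
theorem oscillator_lie (x : Alg n) (o : Oscillator n (VermaHeis n a)) :
    ⁅x, o⁆ = (heisRel_loc n).toLieHom x • o := by
  change UniversalEnvelopingAlgebra.lift ℂ (heisRel_loc n).toLieHom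
    (UniversalEnvelopingAlgebra.ι ℂ x) • o = _
  rw [UniversalEnvelopingAlgebra.lift_ι_apply]

omit [NeZero a] in
theorem oscillator_lie_P (k : ℕ) (o : Oscillator n (VermaHeis n a)) :
    ⁅P n k, o⁆ = toLoc n (uP n k) • o := by
  rw [oscillator_lie, HeisRel.toLieHom_P]

theorem oscillator_lie_z (o : Oscillator n (VermaHeis n a)) : ⁅(gen .z : Alg n), o⁆ = a • o := by
  rw [oscillator_lie, HeisRel.toLieHom_z, oscillator_z_smul]

theorem zInv_smul (o : Oscillator n (VermaHeis n a)) : zInv n • o = a⁻¹ • o := by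
  have h : zInv n • toLoc n (uZ n) • o = o := by
    rw [← mul_smul, (heisRel_loc n).mul_eq, one_smul]
  rw [oscillator_z_smul, smul_algebra_smul_comm] at h
  rw [eq_inv_smul_iff₀ (NeZero.ne a), h]

/-- The oscillator module has no residual action. -/
theorem oscPart_oscillator (x : Alg n) (o : Oscillator n (VermaHeis n a)) :
    oscPart (oscillator_lie_z (a := a)) x o = ⁅x, o⁆ := by
  rw [oscillator_lie]
  refine ((heisRel_loc n).map_toLieHom_smul (moduleRel (oscillator_lie_z (n := n) (a := a)))
    LinearMap.id ?_ ?_ ?_ x o).symm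
  · exact fun k o => (oscillator_lie_P k o).symm
  · exact oscillator_z_smul
  · exact zInv_smul

/-- The morphism from the Fock space to the oscillator module. -/
def fockToOscillator (n : ℕ) (a : ℂ) [NeZero a] :
    Fock n a →ₗ[ℂ] Oscillator n (VermaHeis n a) :=
  (LinearMap.applyₗ (toOscillator n a (heisVac n a))).comp
    ((moduleRel (oscillator_lie_z (n := n) (a := a))).polyHom.toLinearMap.comp
      (fockOf n a).symm.toLinearMap)

theorem fockToOscillator_apply (f : MvPolynomial (Fin (n + 1)) ℂ) :
    fockToOscillator n a (fockOf n a f) =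
      (moduleRel (oscillator_lie_z (n := n) (a := a))).polyHom f
        (toOscillator n a (heisVac n a)) := rfl

theorem fockToOscillator_lie (x : Alg n) (f : Fock n a) :
    fockToOscillator n a ⁅x, f⁆ = ⁅x, fockToOscillator n a f⁆ := by
  obtain ⟨f, rfl⟩ := (fockOf n a).surjective f
  rw [fock_lie, fockToOscillator_apply, fockToOscillator_apply,
    polyHom_fock_lie (oscillator_lie_z (n := n) (a := a)), oscPart_oscillator]
  intro i
  rw [oscillator_lie_P, toLoc_smul_toOscillator, uP_smul_heisVac, map_zero]

/-- The morphism from the Verma module of the Heisenberg algebra to the Fock space. -/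
def heisToFock (n : ℕ) (a : ℂ) [NeZero a] :
    VermaHeis n a →ₗ[ℂ] MvPolynomial (Fin (n + 1)) ℂ :=
  Ind.lift ((fockRel n a).toLieHom.comp (heis n).incl) 1 (by
    have hp : ∀ i : Fin (n + 1), fockOp n a i 1 = 0 := fun i => by
      rw [fockOp_annihilation, MvPolynomial.pderiv_one, smul_zero]
    obtain ⟨h1, h2⟩ := osc_vacuum (fockRel n a) (v := 1) hp
    rintro ⟨⟨x, hx⟩, hx'⟩
    change (fockRel n a).toLieHom x 1 = weightFun n a 0 x • 1
    -- the choice of weight for which `1` is a vacuum vector of the whole algebra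
    rw [weightFun_heis 0 (-((ell n + 1 / 2) ^ 2 / 2)) hx]
    refine weight_of_gen (fockRel n a).toLieHom ?_ ?_ ?_ ?_ hx'
    · rw [HeisRel.toLieHom_h]; exact h2
    · rw [HeisRel.toLieHom_z]; rfl
    · rw [HeisRel.toLieHom_e]; exact h1
    · intro i
      rw [HeisRel.toLieHom_P, hp])

theorem heisToFock_vac : heisToFock n a (heisVac n a) = 1 := Ind.lift_vac _ _ _

theorem heisToFock_lie (x : heis n) (v : VermaHeis n a) :
    heisToFock n a ⁅x, v⁆ = (fockRel n a).toLieHom x (heisToFock n a v) := Ind.lift_lie _ _ _ _ _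

theorem fockToOscillator_heisToFock (v : VermaHeis n a) :
    fockToOscillator n a (fockOf n a (heisToFock n a v)) = toOscillator n a v := by
  refine Ind.mem_of_vac_mem (LinearMap.eqLocus
    (((fockToOscillator n a).comp (fockOf n a).toLinearMap).comp (heisToFock n a))
      (toOscillator n a)) ?_ ?_ v
  · change fockToOscillator n a (fockOf n a (heisToFock n a (heisVac n a))) = toOscillator n a _
    rw [heisToFock_vac, fockToOscillator_apply, map_one]
    rfl
  · intro x v hv
    change fockToOscillator n a (fockOf n a (heisToFock n a _)) = toOscillator n a _ at hv ⊢
    rw [heisToFock_lie, ← fock_lie, fockToOscillator_lie, hv]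
    obtain ⟨u, hu, h⟩ : ∃ u : heis n, (u : Alg n) = x ∧
        ⁅(x : Alg n), toOscillator n a v⁆ = toOscillator n a ⁅u, v⁆ := by
      refine heis_induction (C := fun x => ∃ u : heis n, (u : Alg n) = x ∧
        ⁅x, toOscillator n a v⁆ = toOscillator n a ⁅u, v⁆) ?_ ?_ ?_ ?_ ?_ x.2
      · exact ⟨0, rfl, by rw [zero_lie, zero_lie, map_zero]⟩
      · rintro _ _ ⟨u, rfl, hu⟩ ⟨u', rfl, hu'⟩
        exact ⟨u + u', rfl, by rw [add_lie, add_lie, map_add, hu, hu']⟩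
      · rintro c _ ⟨u, rfl, hu⟩
        exact ⟨c • u, rfl, by rw [smul_lie, smul_lie, map_smul, hu]⟩
      · refine ⟨⟨gen .z, gen_mem_heis_z n⟩, rfl, ?_⟩
        rw [oscillator_lie, HeisRel.toLieHom_z, toLoc_smul_toOscillator]
        rfl
      · intro k
        refine ⟨⟨P n k, P_mem_heis n k⟩, rfl, ?_⟩
        rw [oscillator_lie_P, toLoc_smul_toOscillator]
        rfl
    rw [h, Subtype.ext hu]

theorem polyHom_fock (f g : MvPolynomial (Fin (n + 1)) ℂ) :
    (fockRel n a).polyHom f g = f * g := by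
  induction f using MvPolynomial.induction_on generalizing g with
  | C r =>
    rw [MvPolynomial.C_eq_smul_one, map_smul, map_one, smul_mul_assoc, one_mul]
    rfl
  | add f f' h h' => rw [map_add, LinearMap.add_apply, h, h', add_mul]
  | mul_X f i h =>
    rw [map_mul, HeisRel.polyHom_X, Module.End.mul_apply, fockOp_creation, h, mul_assoc]

theorem fockToOscillator_bijective : Function.Bijective (fockToOscillator n a) := by
  constructor
  -- `heisToFock`, transported to the localization, is a left inverse
  · let j := LinearEquiv.ofBijective (toOscillator n a) toOscillator_bijective
    let T : Oscillator n (VermaHeis n a) →ₗ[ℂ] MvPolynomial (Fin (n + 1)) ℂ :=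
      (heisToFock n a).comp j.symm.toLinearMap
    have hj : ∀ v, T (toOscillator n a v) = heisToFock n a v := fun v =>
      congrArg (heisToFock n a) (j.symm_apply_apply v)
    have hT : ∀ k o, T ⁅P n k, o⁆ = fockOp n a k (T o) := by
      intro k o
      obtain ⟨v, rfl⟩ := toOscillator_bijective.2 o
      rw [oscillator_lie_P, toLoc_smul_toOscillator, hj, hj, ← (fockRel n a).toLieHom_P]
      exact heisToFock_lie ⟨P n k, P_mem_heis n k⟩ v
    have h : ∀ f, T (fockToOscillator n a (fockOf n a f)) = f := by
      intro f
      rw [fockToOscillator_apply]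
      refine ((moduleRel (oscillator_lie_z (n := n) (a := a))).map_polyHom_smul (fockRel n a) T
        hT f _).trans ?_
      rw [hj, heisToFock_vac, Module.End.smul_def, polyHom_fock, mul_one]
    intro f g hfg
    obtain ⟨f, rfl⟩ := (fockOf n a).surjective f
    obtain ⟨g, rfl⟩ := (fockOf n a).surjective g
    rw [← h f, ← h g, hfg]
  · intro o
    obtain ⟨v, rfl⟩ := toOscillator_bijective.2 o
    exact ⟨_, fockToOscillator_heisToFock v⟩

/-- The oscillator module of the Verma module of the Heisenberg algebra is the Fock space. -/
def fockEquiv (n : ℕ) (a : ℂ) [NeZero a] :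
    Fock n a ≃ₗ[ℂ] Oscillator n (VermaHeis n a) :=
  LinearEquiv.ofBijective (fockToOscillator n a) fockToOscillator_bijective

/-- The Fock space may be replaced by the oscillator module in tensor products. -/
def fockTensorEquiv (n : ℕ) (a : ℂ) [NeZero a] (V : Type) [AddCommGroup V] [Module ℂ V]
    [LieRingModule (sl2 n) V] [LieModule ℂ (sl2 n) V] :
    FockTensor n a V ≃ₗ⁅ℂ, Alg n⁆ Oscillator n (VermaHeis n a) ⊗[ℂ] Inflation n V :=
  { TensorProduct.congr (fockEquiv n a) (LinearEquiv.refl ℂ (Inflation n V)) with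
    map_lie' := by
      intro x t
      change TensorProduct.congr (fockEquiv n a) (LinearEquiv.refl ℂ (Inflation n V)) ⁅x, t⁆ =
        ⁅x, TensorProduct.congr (fockEquiv n a) (LinearEquiv.refl ℂ (Inflation n V)) t⁆
      induction t using TensorProduct.induction_on with
      | zero => rw [lie_zero, map_zero, lie_zero]
      | add s t hs ht => rw [lie_add, map_add, map_add, lie_add, hs, ht]
      | tmul f w =>
        rw [TensorProduct.LieModule.lie_tmul_right, map_add, TensorProduct.congr_tmul,
          TensorProduct.congr_tmul, TensorProduct.congr_tmul,
          TensorProduct.LieModule.lie_tmul_right]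
        congr 2
        exact fockToOscillator_lie x f }

end Heisenberg

/-! ### Submodules of tensor products with the Fock space -/

section Coordinates

variable {n : ℕ} {a : ℂ} {V : Type} [AddCommGroup V] [Module ℂ V]

variable (n a V) in
/-- The coordinates of a tensor with respect to the monomials of the Fock space. -/
def coord : FockTensor n a V ≃ₗ[ℂ] (Fin (n + 1) →₀ ℕ) →₀ V :=
  (TensorProduct.congr ((fockOf n a).symm.trans (MvPolynomial.basisMonomials _ ℂ).repr)
    (inflOf n V).symm).trans (TensorProduct.finsuppScalarLeft ℂ V _)

theorem coord_tmul (f : MvPolynomial (Fin (n + 1)) ℂ) (w : V) (α : Fin (n + 1) →₀ ℕ) :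
    coord n a V (fockOf n a f ⊗ₜ[ℂ] inflOf n V w) α = MvPolynomial.coeff α f • w :=
  TensorProduct.finsuppScalarLeft_apply_tmul_apply _ _ _

theorem coord_monomial (α : Fin (n + 1) →₀ ℕ) (w : V) :
    coord n a V (fockOf n a (MvPolynomial.monomial α 1) ⊗ₜ[ℂ] inflOf n V w) =
      Finsupp.single α w := by
  classical
  ext β
  rw [coord_tmul, MvPolynomial.coeff_monomial, Finsupp.single_apply]
  split_ifs
  · rw [one_smul]
  · rw [zero_smul]

theorem coord_symm_single (α : Fin (n + 1) →₀ ℕ) (w : V) :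
    (coord n a V).symm (Finsupp.single α w) =
      fockOf n a (MvPolynomial.monomial α 1) ⊗ₜ[ℂ] inflOf n V w := by
  rw [LinearEquiv.symm_apply_eq, coord_monomial]

variable [NeZero a] [LieRingModule (sl2 n) V] [LieModule ℂ (sl2 n) V]

/-- The annihilation operators shift the coordinates. -/
theorem coord_lie_P (i : Fin (n + 1)) (t : FockTensor n a V) (α : Fin (n + 1) →₀ ℕ) :
    coord n a V ⁅P n i, t⁆ α =
      (omega n i * a * (α i + 1)) • coord n a V t (α + Finsupp.single i 1) := by
  induction t using fockTensor_induction with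
  | h0 => simp
  | hadd s t hs ht => simp only [lie_add, map_add, Finsupp.add_apply, hs, ht, smul_add]
  | htmul f w =>
    rw [fockTensor_lie_P, coord_tmul, coord_tmul, fockOp_annihilation, MvPolynomial.coeff_smul,
      MvPolynomial.coeff_pderiv, smul_smul, smul_eq_mul]
    congr 1
    ring

theorem omega_ne_zero (n k : ℕ) : omega n k ≠ 0 :=
  mul_ne_zero (mul_ne_zero (pow_ne_zero _ (by norm_num)) (Nat.cast_ne_zero.mpr k.factorial_ne_zero))
    (Nat.cast_ne_zero.mpr (Nat.factorial_ne_zero _))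

/-- A submodule that contains `1 ⊗ w` contains all `f ⊗ w`. -/
theorem tmul_mem_of_vacuum {X : LieSubmodule ℂ (Alg n) (FockTensor n a V)} {w : V}
    (hw : fockOf n a 1 ⊗ₜ[ℂ] inflOf n V w ∈ X) (f : MvPolynomial (Fin (n + 1)) ℂ) :
    fockOf n a f ⊗ₜ[ℂ] inflOf n V w ∈ X := by
  induction f using MvPolynomial.induction_on with
  | C r =>
    rw [MvPolynomial.C_eq_smul_one, map_smul, ← TensorProduct.smul_tmul']
    exact X.smul_mem r hw
  | add f g hf hg => rw [map_add, TensorProduct.add_tmul]; exact X.add_mem hf hg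
  | mul_X f i hf =>
    have := X.lie_mem (x := P n (2 * n + 1 - i)) hf
    rwa [fockTensor_lie_P, fockOp_creation, mul_comm] at this

/-- The vectors `w` with `1 ⊗ w` in a given submodule of the tensor product. -/
def vacuumPart (X : LieSubmodule ℂ (Alg n) (FockTensor n a V)) : LieSubmodule ℂ (sl2 n) V :=
  { (X : Submodule ℂ (FockTensor n a V)).comap
      ((TensorProduct.mk ℂ (Fock n a) (Inflation n V) (fockOf n a 1)).comp
        (inflOf n V).toLinearMap) with
    lie_mem := by
      intro x w hw
      change fockOf n a 1 ⊗ₜ[ℂ] inflOf n V w ∈ X at hw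
      change fockOf n a 1 ⊗ₜ[ℂ] inflOf n V ⁅x, w⁆ ∈ X
      have h := X.lie_mem (x := (x : Alg n)) hw
      rw [TensorProduct.LieModule.lie_tmul_right, inflation_lie, sl2Proj_coe, fock_lie] at h
      exact (X.add_mem_iff_right (tmul_mem_of_vacuum hw _)).mp h }

theorem mem_vacuumPart {X : LieSubmodule ℂ (Alg n) (FockTensor n a V)} {w : V} :
    w ∈ vacuumPart X ↔ fockOf n a 1 ⊗ₜ[ℂ] inflOf n V w ∈ X := Iff.rfl

theorem mem_of_coord_mem {X : LieSubmodule ℂ (Alg n) (FockTensor n a V)} {t : FockTensor n a V}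
    (ht : ∀ α, coord n a V t α ∈ vacuumPart X) : t ∈ X := by
  rw [← (coord n a V).symm_apply_apply t, ← Finsupp.sum_single (coord n a V t), Finsupp.sum,
    map_sum]
  refine X.sum_mem fun α _ => ?_
  rw [coord_symm_single]
  exact tmul_mem_of_vacuum (ht α) _

/-- The coordinates of the elements of a submodule are vacuum vectors of this submodule: the
annihilation operators move each coordinate of positive degree to a lower degree, and after
subtraction of the terms of positive degree only the constant coordinate is left. -/
theorem coord_mem_of_degree_lt {X : LieSubmodule ℂ (Alg n) (FockTensor n a V)} (d : ℕ) :
    ∀ t ∈ X, (∀ α, coord n a V t α ≠ 0 → α.degree < d) → ∀ α, coord n a V t α ∈ vacuumPart X := by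
  induction d with
  | zero =>
    intro t _ hd α
    by_cases h : coord n a V t α = 0
    · rw [h]; exact zero_mem _
    · exact absurd (hd α h) (Nat.not_lt_zero _)
  | succ d ih =>
    intro t ht hd
    have hpos : ∀ α, α ≠ 0 → coord n a V t α ∈ vacuumPart X := by
      intro α hα
      obtain ⟨i, hi⟩ := Finsupp.ne_iff.mp hα
      obtain ⟨β, rfl⟩ : ∃ β, α = β + Finsupp.single i 1 := by
        refine ⟨α - Finsupp.single i 1, (tsub_add_cancel_of_le ?_).symm⟩
        rw [Finsupp.single_le_iff]
        exact Nat.one_le_iff_ne_zero.mpr hi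
      have hne : omega n i * a * (β i + 1 : ℂ) ≠ 0 :=
        mul_ne_zero (mul_ne_zero (omega_ne_zero n i) (NeZero.ne a)) (Nat.cast_add_one_ne_zero _)
      have h1 := ih ⁅P n i, t⁆ (X.lie_mem ht) (fun γ hγ => by
        rw [coord_lie_P] at hγ
        have := hd _ (right_ne_zero_of_smul hγ)
        rw [map_add, Finsupp.degree_single] at this
        omega) β
      rw [coord_lie_P] at h1
      exact ((vacuumPart X).toSubmodule.smul_mem_iff hne).mp h1
    intro α
    by_cases hα : α = 0
    · subst hα
      have h1 : t - fockOf n a 1 ⊗ₜ[ℂ] inflOf n V (coord n a V t 0) ∈ X := by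
        refine mem_of_coord_mem fun α => ?_
        have e : coord n a V (fockOf n a 1 ⊗ₜ[ℂ] inflOf n V (coord n a V t 0)) =
            Finsupp.single 0 (coord n a V t 0) := coord_monomial 0 _
        rw [map_sub, e, Finsupp.sub_apply]
        by_cases hα : α = 0
        · subst hα
          rw [Finsupp.single_eq_same, sub_self]
          exact zero_mem _
        · rw [Finsupp.single_eq_of_ne hα, sub_zero]
          exact hpos α hα
      exact (X.sub_mem_iff_right ht).mp h1
    · exact hpos α hα

theorem mem_iff_coord_mem {X : LieSubmodule ℂ (Alg n) (FockTensor n a V)} {t : FockTensor n a V} :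
    t ∈ X ↔ ∀ α, coord n a V t α ∈ vacuumPart X := by
  refine ⟨fun ht => coord_mem_of_degree_lt
    ((coord n a V t).support.sup Finsupp.degree + 1) t ht fun α hα => ?_, mem_of_coord_mem⟩
  exact Nat.lt_succ_of_le (Finset.le_sup (f := Finsupp.degree) (Finsupp.mem_support_iff.mpr hα))

variable {V' : Type} [AddCommGroup V'] [Module ℂ V'] [LieRingModule (sl2 n) V']
  [LieModule ℂ (sl2 n) V']

/-- A morphism of `sl₂`-modules, regarded as a morphism of their inflations. -/
def inflMap (g : V →ₗ⁅ℂ, sl2 n⁆ V') : Inflation n V →ₗ⁅ℂ, Alg n⁆ Inflation n V' :=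
  { (inflOf n V').toLinearMap.comp ((g : V →ₗ[ℂ] V').comp (inflOf n V).symm.toLinearMap) with
    map_lie' := by
      intro x w
      exact g.map_lie (sl2Proj n x) _ }

variable (a) in
/-- The functor `V ↦ Fock ⊗ V` on morphisms. -/
def fockMap (g : V →ₗ⁅ℂ, sl2 n⁆ V') : FockTensor n a V →ₗ⁅ℂ, Alg n⁆ FockTensor n a V' :=
  TensorProduct.LieModule.map LieModuleHom.id (inflMap g)

theorem fockMap_tmul (g : V →ₗ⁅ℂ, sl2 n⁆ V') (f : Fock n a) (w : V) :
    fockMap a g (f ⊗ₜ[ℂ] inflOf n V w) = f ⊗ₜ[ℂ] inflOf n V' (g w) := rfl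

theorem coord_fockMap (g : V →ₗ⁅ℂ, sl2 n⁆ V') (t : FockTensor n a V) (α : Fin (n + 1) →₀ ℕ) :
    coord n a V' (fockMap a g t) α = g (coord n a V t α) := by
  induction t using fockTensor_induction with
  | h0 => simp
  | hadd s t hs ht => simp only [map_add, Finsupp.add_apply, hs, ht]
  | htmul f w => rw [fockMap_tmul, coord_tmul, coord_tmul, map_smul]

theorem fockMap_surjective {g : V →ₗ⁅ℂ, sl2 n⁆ V'} (hg : Function.Surjective g) :
    Function.Surjective (fockMap a g) := by
  intro t
  induction t using fockTensor_induction with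
  | h0 => exact ⟨0, map_zero _⟩
  | hadd s t hs ht =>
    obtain ⟨s, rfl⟩ := hs
    obtain ⟨t, rfl⟩ := ht
    exact ⟨s + t, map_add _ _ _⟩
  | htmul f w =>
    obtain ⟨w, rfl⟩ := hg w
    exact ⟨_, fockMap_tmul g _ w⟩

variable (a) in
/-- The submodule `Fock ⊗ N`. -/
def fockSubmodule (N : LieSubmodule ℂ (sl2 n) V) : LieSubmodule ℂ (Alg n) (FockTensor n a V) :=
  (fockMap a (LieSubmodule.Quotient.mk' N)).ker

theorem mem_fockSubmodule {N : LieSubmodule ℂ (sl2 n) V} {t : FockTensor n a V} :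
    t ∈ fockSubmodule a N ↔ ∀ α, coord n a V t α ∈ N := by
  rw [fockSubmodule, LieModuleHom.mem_ker, ← (coord n a (V ⧸ N)).map_eq_zero_iff,
    Finsupp.ext_iff]
  refine forall_congr' fun α => ?_
  rw [coord_fockMap, Finsupp.zero_apply, LieSubmodule.Quotient.mk_eq_zero]

variable (n a V) in
/-- The submodules of `Fock ⊗ V` are the `Fock ⊗ N` for the submodules `N` of `V`. -/
def fockSubmoduleEquiv :
    LieSubmodule ℂ (sl2 n) V ≃o LieSubmodule ℂ (Alg n) (FockTensor n a V) where
  toFun := fockSubmodule a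
  invFun := vacuumPart
  left_inv N := by
    ext w
    rw [mem_vacuumPart, mem_fockSubmodule]
    have h : ∀ α, coord n a V (fockOf n a 1 ⊗ₜ[ℂ] inflOf n V w) α = Finsupp.single 0 w α :=
      fun α => DFunLike.congr_fun (coord_monomial 0 w) α
    refine ⟨fun hw => ?_, fun hw α => ?_⟩
    · have := hw 0
      rwa [h, Finsupp.single_eq_same] at this
    · rw [h]
      by_cases hα : α = 0
      · subst hα
        rwa [Finsupp.single_eq_same]
      · rw [Finsupp.single_eq_of_ne hα]
        exact zero_mem _
  right_inv X := by
    ext t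
    rw [mem_fockSubmodule, mem_iff_coord_mem]
  map_rel_iff' {N N'} := by
    refine ⟨fun h w hw => ?_, fun h t ht => ?_⟩
    · have h1 : fockOf n a 1 ⊗ₜ[ℂ] inflOf n V w ∈ fockSubmodule a N :=
        mem_fockSubmodule.mpr fun α => by
          rw [coord_tmul]; exact N.smul_mem _ hw
      have h2 := mem_fockSubmodule.mp (h h1) 0
      rwa [coord_tmul, MvPolynomial.coeff_zero_one, one_smul] at h2
    · exact mem_fockSubmodule.mpr fun α => h (mem_fockSubmodule.mp ht α)

end Coordinates

/-! ### The simple quotient -/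

section SimpleQuotient

theorem OrderIso.map_sSup_ne_top {α β : Type} [CompleteLattice α] [CompleteLattice β]
    (e : α ≃o β) : e (sSup {x | x ≠ ⊤}) = sSup {y | y ≠ ⊤} := by
  rw [e.map_sSup_eq_sSup_symm_preimage]
  congr 1
  ext y
  simp

variable {L M : Type} [LieRing L] [LieAlgebra ℂ L] [AddCommGroup M] [Module ℂ M]
  [LieRingModule L M] [LieModule ℂ L M]

/-- The quotient by the sum of all proper submodules is irreducible when this sum is proper. -/
theorem isIrreducible_simpleQuotient (h : sSup {N : LieSubmodule ℂ L M | N ≠ ⊤} ≠ ⊤) :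
    LieModule.IsIrreducible ℂ L (SimpleQuotient L M) := by
  set J := sSup {N : LieSubmodule ℂ L M | N ≠ ⊤} with hJ
  have : Nontrivial (M ⧸ J) := by
    refine Submodule.Quotient.nontrivial_iff.mpr fun h' => h ?_
    exact (LieSubmodule.toSubmodule_eq_top J).mp h'
  refine LieModule.IsIrreducible.mk fun N hN => ?_
  by_contra hN'
  have h1 : N.comap (LieSubmodule.Quotient.mk' J) ≠ ⊤ := by
    intro h1
    apply hN'
    rw [eq_top_iff]
    intro m _
    obtain ⟨m, rfl⟩ := LieSubmodule.Quotient.surjective_mk' J m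
    have : m ∈ N.comap (LieSubmodule.Quotient.mk' J) := h1 ▸ LieSubmodule.mem_top m
    exact this
  apply hN
  rw [eq_bot_iff]
  intro m hm
  obtain ⟨m, rfl⟩ := LieSubmodule.Quotient.surjective_mk' J m
  have h2 : m ∈ J := (le_sSup (a := N.comap (LieSubmodule.Quotient.mk' J)) h1 : _ ≤ J) hm
  rw [LieSubmodule.mem_bot]
  exact (LieSubmodule.Quotient.mk_eq_zero J).mpr h2

/-- A surjective morphism whose kernel is the sum of all proper submodules is the projection to the
simple quotient. -/
def simpleQuotientEquiv {M' : Type} [AddCommGroup M'] [Module ℂ M'] [LieRingModule L M']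
    [LieModule ℂ L M'] (g : M →ₗ⁅ℂ, L⁆ M') (hg : Function.Surjective g)
    (hk : g.ker = sSup {N : LieSubmodule ℂ L M | N ≠ ⊤}) : SimpleQuotient L M ≃ₗ⁅ℂ, L⁆ M' :=
  { (Submodule.quotEquivOfEq _ _ (by rw [← hk]; rfl)).trans
      ((g : M →ₗ[ℂ] M').quotKerEquivOfSurjective hg) with
    map_lie' := by
      intro x m
      obtain ⟨m, rfl⟩ := LieSubmodule.Quotient.surjective_mk' _ m
      exact g.map_lie x m }

end SimpleQuotient

/-! ### The Verma module of `sl₂` -/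

section Sl2

variable {n : ℕ}

/-- The operator `e` on the Verma module of `sl₂` with basis `f^k v`. -/
def modelE (b : ℂ) : Module.End ℂ (ℕ →₀ ℂ) :=
  Finsupp.linearCombination ℂ fun k : ℕ => ((k : ℂ) * (b - k + 1)) • Finsupp.single (k - 1) 1

/-- The operator `h` on the Verma module of `sl₂` with basis `f^k v`. -/
def modelH (b : ℂ) : Module.End ℂ (ℕ →₀ ℂ) :=
  Finsupp.linearCombination ℂ fun k : ℕ => (b - 2 * k) • Finsupp.single k 1

/-- The operator `f` on the Verma module of `sl₂` with basis `f^k v`. -/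
def modelF : Module.End ℂ (ℕ →₀ ℂ) :=
  Finsupp.linearCombination ℂ fun k : ℕ => Finsupp.single (k + 1) 1

theorem modelE_single (b : ℂ) (k : ℕ) : modelE b (Finsupp.single k 1) =
    ((k : ℂ) * (b - k + 1)) • Finsupp.single (k - 1) 1 := by
  rw [modelE, Finsupp.linearCombination_single, one_smul]

theorem modelH_single (b : ℂ) (k : ℕ) : modelH b (Finsupp.single k 1) =
    (b - 2 * k) • Finsupp.single k 1 := by
  rw [modelH, Finsupp.linearCombination_single, one_smul]

theorem modelF_single (k : ℕ) : modelF (Finsupp.single k 1) = Finsupp.single (k + 1) 1 := by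
  rw [modelF, Finsupp.linearCombination_single, one_smul]

theorem model_ext {f g : Module.End ℂ (ℕ →₀ ℂ)}
    (h : ∀ k, f (Finsupp.single k 1) = g (Finsupp.single k 1)) : f = g :=
  Finsupp.lhom_ext' fun k => LinearMap.ext_ring (h k)

theorem model_h_e (b : ℂ) : modelH b * modelE b - modelE b * modelH b = (2 : ℂ) • modelE b := by
  refine model_ext fun k => ?_
  rw [LinearMap.sub_apply, Module.End.mul_apply,
    Module.End.mul_apply, LinearMap.smul_apply, modelE_single, modelH_single, map_smul, map_smul,
    modelE_single, modelH_single]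
  rcases k with _ | k
  · simp
  · rw [Nat.add_sub_cancel]
    push_cast
    module

theorem model_h_f (b : ℂ) : modelH b * modelF - modelF * modelH b = -((2 : ℂ) • modelF) := by
  refine model_ext fun k => ?_
  rw [LinearMap.sub_apply, Module.End.mul_apply,
    Module.End.mul_apply, LinearMap.neg_apply, LinearMap.smul_apply, modelF_single, modelH_single,
    modelH_single, map_smul, modelF_single]
  push_cast
  module

theorem model_e_f (b : ℂ) : modelE b * modelF - modelF * modelE b = modelH b := by
  refine model_ext fun k => ?_
  rw [LinearMap.sub_apply, Module.End.mul_apply,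
    Module.End.mul_apply, modelF_single, modelE_single, modelE_single, map_smul, modelF_single,
    modelH_single]
  rcases k with _ | k
  · simp
  · simp only [Nat.add_sub_cancel]
    push_cast
    module

/-- The explicit highest weight module of `sl₂`, inflated to the conformal Galilei algebra. -/
def modelRep (n : ℕ) (b : ℂ) : Alg n →ₗ⁅ℂ⁆ Module.End ℂ (ℕ →₀ ℂ) :=
  lieHomOfGen
    ((stdBasis n).constr ℂ fun
      | .e => modelE b
      | .h => modelH b
      | .f => modelF
      | _ => 0)
    (by
      set F := (stdBasis n).constr ℂ (M' := Module.End ℂ (ℕ →₀ ℂ)) _ with hF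
      have he : F (gen .e) = modelE b := Module.Basis.constr_basis _ _ _ _
      have hh : F (gen .h) = modelH b := Module.Basis.constr_basis _ _ _ _
      have hf : F (gen .f) = modelF := Module.Basis.constr_basis _ _ _ _
      have hz : F (gen .z) = 0 := Module.Basis.constr_basis _ _ _ _
      have hp : ∀ k, F (gen (.p k)) = 0 := fun k => Module.Basis.constr_basis _ _ _ _
      have hP : ∀ k, F (P n k) = 0 := fun k => by
        rw [P]
        split_ifs
        · exact hp _
        · exact map_zero _
      have h1 : modelE b * modelH b - modelH b * modelE b = -((2 : ℂ) • modelE b) := by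
        rw [← model_h_e]; exact (neg_sub (modelH b * modelE b) (modelE b * modelH b)).symm
      have h2 : modelF * modelH b - modelH b * modelF = (2 : ℂ) • modelF := by
        refine LinearMap.ext fun v => ?_
        have := LinearMap.congr_fun (model_h_f b) v
        rw [LinearMap.sub_apply, LinearMap.neg_apply] at this
        rw [LinearMap.sub_apply, ← neg_sub, this, neg_neg]
      have h3 : modelF * modelE b - modelE b * modelF = -modelH b := by
        rw [← model_e_f b]; exact (neg_sub (modelE b * modelF) (modelF * modelE b)).symm
      intro i j
      rw [LieRing.of_associative_ring_bracket]
      cases i <;> cases j <;>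
        simp only [table, map_smul, map_neg, he, hh, hf, hz, hp, hP, mul_zero, zero_mul, sub_self,
          smul_zero, map_zero, model_h_e, model_h_f, model_e_f, h1, h2, h3]
      all_goals first
        | exact LinearMap.ext fun _ => neg_zero
        | (split_ifs <;> simp only [map_smul, hz, smul_zero, map_zero]))

theorem modelRep_e (b : ℂ) : modelRep n b (gen .e) = modelE b := Module.Basis.constr_basis _ _ _ _

theorem modelRep_h (b : ℂ) : modelRep n b (gen .h) = modelH b := Module.Basis.constr_basis _ _ _ _

theorem modelRep_f (b : ℂ) : modelRep n b (gen .f) = modelF := Module.Basis.constr_basis _ _ _ _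

theorem modelRep_z (b : ℂ) : modelRep n b (gen .z) = 0 := Module.Basis.constr_basis _ _ _ _

theorem modelRep_P (b : ℂ) (k : ℕ) : modelRep n b (P n k) = 0 := by
  rw [P]
  split_ifs
  · exact Module.Basis.constr_basis _ _ _ _
  · exact map_zero _

/-- The element `e` of `sl₂`. -/
abbrev sl2E (n : ℕ) : sl2 n := ⟨gen .e, gen_mem_sl2_e n⟩

/-- The element `h` of `sl₂`. -/
abbrev sl2H (n : ℕ) : sl2 n := ⟨gen .h, gen_mem_sl2_h n⟩

/-- The element `f` of `sl₂`. -/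
abbrev sl2F (n : ℕ) : sl2 n := ⟨gen .f, gen_mem_sl2_f n⟩

theorem sl2_generators {C : sl2 n → Prop} (h0 : C 0) (hadd : ∀ x y, C x → C y → C (x + y))
    (hsmul : ∀ (c : ℂ) x, C x → C (c • x)) (he : C (sl2E n)) (hh : C (sl2H n)) (hf : C (sl2F n))
    (x : sl2 n) : C x := by
  rw [← sl2Proj_coe x]
  refine sl2_induction (C := fun x => C (sl2Proj n x)) ?_ ?_ ?_ ?_ ?_ ?_ x.2
  · rwa [map_zero]
  · intro x y hx hy
    rw [map_add]
    exact hadd _ _ hx hy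
  · intro c x hx
    rw [map_smul]
    exact hsmul _ _ hx
  · rwa [sl2Proj_e]
  · rwa [sl2Proj_h]
  · rwa [sl2Proj_f]

theorem sl2Triple (n : ℕ) : IsSl2Triple (sl2H n) (sl2E n) (sl2F n) where
  h_ne_zero h := (stdBasis n).ne_zero .h (congrArg Subtype.val h)
  lie_e_f := Subtype.ext (lie_gen _ _)
  lie_h_e_nsmul := Subtype.ext ((lie_gen _ _).trans (ofNat_smul_eq_nsmul ℂ 2 _))
  lie_h_f_nsmul := Subtype.ext ((lie_gen _ _).trans (congrArg Neg.neg (ofNat_smul_eq_nsmul ℂ 2 _)))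

variable {b : ℂ}

variable (n b) in
/-- The morphism from the Verma module of `sl₂` to its explicit model. -/
def sl2ToModel : VermaSl2 n b →ₗ[ℂ] ℕ →₀ ℂ :=
  Ind.lift ((modelRep n b).comp (sl2 n).incl) (Finsupp.single 0 1) (by
    rintro ⟨⟨x, hx⟩, hx'⟩
    refine weight_of_gen (modelRep n b) ?_ ?_ ?_ ?_ hx'
    · rw [modelRep_h, modelH_single, Nat.cast_zero, mul_zero, sub_zero]
    · rw [modelRep_z, zero_smul]; rfl
    · rw [modelRep_e, modelE_single, Nat.cast_zero, zero_mul, zero_smul]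
    · intro i
      rw [modelRep_P]; rfl)

theorem sl2ToModel_vac : sl2ToModel n b (sl2Vac n b) = Finsupp.single 0 1 := Ind.lift_vac _ _ _

theorem sl2ToModel_lie (x : sl2 n) (v : VermaSl2 n b) :
    sl2ToModel n b ⁅x, v⁆ = modelRep n b x (sl2ToModel n b v) := Ind.lift_lie _ _ _ _ _

variable (n b) in
/-- The vectors `f^k v` of the Verma module of `sl₂`. -/
def fPow (k : ℕ) : VermaSl2 n b :=
  (LieModule.toEnd ℂ (sl2 n) (VermaSl2 n b) (sl2F n) ^ k) (sl2Vac n b)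

theorem lie_f_fPow (k : ℕ) : ⁅sl2F n, fPow n b k⁆ = fPow n b (k + 1) := by
  rw [fPow, fPow, pow_succ', Module.End.mul_apply, LieModule.toEnd_apply_apply]

theorem sl2ToModel_fPow (k : ℕ) : sl2ToModel n b (fPow n b k) = Finsupp.single k 1 := by
  induction k with
  | zero => exact sl2ToModel_vac
  | succ k ih => rw [← lie_f_fPow, sl2ToModel_lie, modelRep_f, ih, modelF_single]

theorem primitive_sl2Vac : (sl2Triple n).HasPrimitiveVectorWith (sl2Vac n b) b where
  ne_zero h := by
    have := sl2ToModel_vac (n := n) (b := b)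
    rw [h, map_zero] at this
    exact (Finsupp.single_ne_zero.mpr one_ne_zero) this.symm
  lie_h := by rw [ind_lie_vac _ gen_h_mem_borel, weightFun_h]
  lie_e := by rw [ind_lie_vac _ gen_e_mem_borel, weightFun_e, zero_smul]

theorem lie_h_fPow (k : ℕ) : ⁅sl2H n, fPow n b k⁆ = (b - 2 * k) • fPow n b k :=
  primitive_sl2Vac.lie_h_pow_toEnd_f k

theorem lie_e_fPow_succ (k : ℕ) :
    ⁅sl2E n, fPow n b (k + 1)⁆ = (((k : ℂ) + 1) * (b - k)) • fPow n b k :=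
  primitive_sl2Vac.lie_e_pow_succ_toEnd_f k

theorem lie_e_fPow_zero : ⁅sl2E n, fPow n b 0⁆ = 0 := primitive_sl2Vac.lie_e

/-- The span of the `f^k v` with `k ∈ s` is a submodule if `s` is closed under successors, and under
predecessors except at `k + 1 ∈ s` with `b = k`, where `e f^{k+1} v = 0`. -/
theorem lie_mem_span_fPow {s : Set ℕ} (hs : ∀ k ∈ s, k + 1 ∈ s)
    (hs' : ∀ k, k + 1 ∈ s → k ∈ s ∨ b = k) (x : sl2 n) {v : VermaSl2 n b}
    (hv : v ∈ Submodule.span ℂ (fPow n b '' s)) : ⁅x, v⁆ ∈ Submodule.span ℂ (fPow n b '' s) := by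
  induction hv using Submodule.span_induction with
  | zero => rw [lie_zero]; exact zero_mem _
  | add v w _ _ hv hw => rw [lie_add]; exact add_mem hv hw
  | smul c v _ hv => rw [lie_smul]; exact Submodule.smul_mem _ _ hv
  | mem v hv =>
    obtain ⟨k, hk, rfl⟩ := hv
    refine sl2_generators (C := fun x => ⁅x, fPow n b k⁆ ∈ Submodule.span ℂ (fPow n b '' s))
      ?_ ?_ ?_ ?_ ?_ ?_ x
    · rw [zero_lie]; exact zero_mem _
    · intro x y hx hy
      rw [add_lie]; exact add_mem hx hy
    · intro c x hx
      rw [smul_lie]; exact Submodule.smul_mem _ _ hx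
    · rcases k with _ | k
      · rw [lie_e_fPow_zero]; exact zero_mem _
      · rw [lie_e_fPow_succ]
        rcases hs' k hk with h | h
        · exact Submodule.smul_mem _ _ (Submodule.subset_span ⟨k, h, rfl⟩)
        · rw [h, sub_self, mul_zero, zero_smul]; exact zero_mem _
    · rw [lie_h_fPow]
      exact Submodule.smul_mem _ _ (Submodule.subset_span ⟨k, hk, rfl⟩)
    · rw [lie_f_fPow]
      exact Submodule.subset_span ⟨k + 1, hs k hk, rfl⟩

variable (n b) in
/-- The vectors `f^k v` are a basis of the Verma module of `sl₂`. -/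
def fBasis : Module.Basis ℕ ℂ (VermaSl2 n b) :=
  Module.Basis.mk (v := fPow n b)
    (by
      refine LinearIndependent.of_comp (sl2ToModel n b) ?_
      have h : sl2ToModel n b ∘ fPow n b =
          (Finsupp.basisSingleOne : Module.Basis ℕ ℂ (ℕ →₀ ℂ)) := by
        funext k
        rw [Finsupp.coe_basisSingleOne]
        exact sl2ToModel_fPow k
      rw [h]
      exact Module.Basis.linearIndependent _)
    (fun v _ => by
      rw [← Set.image_univ]
      refine Ind.mem_of_vac_mem _ ?_ ?_ v
      · exact Submodule.subset_span ⟨0, trivial, rfl⟩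
      · exact fun x v hv => lie_mem_span_fPow (s := Set.univ) (fun _ _ => trivial)
          (fun _ _ => Or.inl trivial) x hv)

theorem fBasis_apply (k : ℕ) : fBasis n b k = fPow n b k := Module.Basis.mk_apply _ _ _

theorem coord_lie_h (v : VermaSl2 n b) (k : ℕ) :
    (fBasis n b).repr ⁅sl2H n, v⁆ k = (b - 2 * k) * (fBasis n b).repr v k := by
  have h : ((fBasis n b).coord k).comp (LieModule.toEnd ℂ (sl2 n) (VermaSl2 n b) (sl2H n)) =
      (b - 2 * k) • (fBasis n b).coord k := by
    refine (fBasis n b).ext fun j => ?_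
    rw [LinearMap.comp_apply, LieModule.toEnd_apply_apply, fBasis_apply, lie_h_fPow, map_smul,
      ← fBasis_apply, LinearMap.smul_apply, Module.Basis.coord_apply, Module.Basis.repr_self,
      Finsupp.single_apply]
    split_ifs with hjk
    · rw [hjk]
    · rw [smul_zero, smul_zero]
  exact DFunLike.congr_fun h v

/-- A submodule contains the weight components of its elements. -/
theorem component_mem (N : LieSubmodule ℂ (sl2 n) (VermaSl2 n b)) (s : Finset ℕ) :
    ∀ v ∈ N, (fBasis n b).repr v ∈ Finsupp.supported ℂ ℂ (s : Set ℕ) →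
      ∀ k, (fBasis n b).repr v k • fPow n b k ∈ N := by
  classical
  induction s using Finset.induction_on with
  | empty =>
    intro v _ hv k
    rw [Finset.coe_empty, Finsupp.supported_empty, Submodule.mem_bot] at hv
    rw [hv, Finsupp.zero_apply, zero_smul]
    exact N.zero_mem
  | insert j s hj ih =>
    intro v hv hs
    have hs' : ∀ k, k ∉ insert j s → (fBasis n b).repr v k = 0 := fun k hk =>
      Finsupp.notMem_support_iff.mp fun h => hk (by
        have := (Finsupp.mem_supported ℂ _).mp hs h
        exact_mod_cast this)
    -- `h - (b - 2j)` kills the component of `f^j v` and rescales the others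
    have h1 : ∀ k, (fBasis n b).repr (⁅sl2H n, v⁆ - (b - 2 * j) • v) k =
        (2 * (j - k)) * (fBasis n b).repr v k := by
      intro k
      rw [map_sub, map_smul, Finsupp.sub_apply, Finsupp.smul_apply, coord_lie_h, smul_eq_mul]
      ring
    have h2 : ∀ k, k ≠ j → (fBasis n b).repr v k • fPow n b k ∈ N := by
      intro k hk
      have h3 := ih _ (N.sub_mem (N.lie_mem (x := sl2H n) hv) (N.smul_mem (b - 2 * j) hv)) (by
        rw [Finsupp.mem_supported]
        intro i hi
        rw [Finset.mem_coe, Finsupp.mem_support_iff, h1] at hi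
        by_contra his
        have : i ≠ j := by
          rintro rfl
          rw [sub_self, mul_zero, zero_mul] at hi
          exact hi rfl
        rw [hs' i (by rw [Finset.mem_insert]; tauto), mul_zero] at hi
        exact hi rfl) k
      rw [h1, mul_smul] at h3
      have hne : (2 * ((j : ℂ) - k)) ≠ 0 :=
        mul_ne_zero two_ne_zero (sub_ne_zero.mpr (Nat.cast_injective.ne hk.symm))
      exact (N.toSubmodule.smul_mem_iff hne).mp h3
    intro k
    by_cases hk : k = j
    · subst hk
      have h3 : v = (fBasis n b).repr v k • fPow n b k +
          ∑ i ∈ s, (fBasis n b).repr v i • fPow n b i := by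
        refine Eq.trans ?_
          (Finset.sum_insert (f := fun i => (fBasis n b).repr v i • fPow n b i) hj)
        conv_lhs => rw [← (fBasis n b).linearCombination_repr v]
        rw [Finsupp.linearCombination_apply, Finsupp.sum_of_support_subset (s := insert k s)]
        · simp only [fBasis_apply]
        · intro i hi
          exact_mod_cast (Finsupp.mem_supported ℂ _).mp hs hi
        · intro i _
          rw [zero_smul]
      have h4 : ∑ i ∈ s, (fBasis n b).repr v i • fPow n b i ∈ N :=
        N.sum_mem fun i hi => h2 i fun h => hj (h ▸ hi)
      exact (N.add_mem_iff_left h4).mp (h3 ▸ hv)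
    · exact h2 k hk

theorem fPow_mem (N : LieSubmodule ℂ (sl2 n) (VermaSl2 n b)) {v : VermaSl2 n b} (hv : v ∈ N)
    {k : ℕ} (hk : (fBasis n b).repr v k ≠ 0) : fPow n b k ∈ N :=
  (N.toSubmodule.smul_mem_iff hk).mp (component_mem N ((fBasis n b).repr v).support v hv
    ((Finsupp.mem_supported ℂ _).mpr subset_rfl) k)

theorem eq_top_of_vac_mem {N : LieSubmodule ℂ (sl2 n) (VermaSl2 n b)} (h : fPow n b 0 ∈ N) :
    N = ⊤ := by
  rw [eq_top_iff]
  exact fun v _ => Ind.mem_of_vac_mem N.toSubmodule h (fun x v hv => N.lie_mem hv) v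

theorem repr_zero_of_ne_top {N : LieSubmodule ℂ (sl2 n) (VermaSl2 n b)} (hN : N ≠ ⊤)
    {v : VermaSl2 n b} (hv : v ∈ N) : (fBasis n b).repr v 0 = 0 := by
  by_contra h
  exact hN (eq_top_of_vac_mem (fPow_mem N hv h))

/-- The Verma module of `sl₂` has a largest proper submodule. -/
theorem sl2_sSup_ne_top :
    sSup {N : LieSubmodule ℂ (sl2 n) (VermaSl2 n b) | N ≠ ⊤} ≠ ⊤ := by
  intro h
  have h1 : (sSup {N : LieSubmodule ℂ (sl2 n) (VermaSl2 n b) | N ≠ ⊤}).toSubmodule ≤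
      LinearMap.ker ((fBasis n b).coord 0) := by
    rw [LieSubmodule.sSup_toSubmodule]
    refine sSup_le ?_
    rintro _ ⟨N, hN, rfl⟩ v hv
    exact repr_zero_of_ne_top hN hv
  have h2 : fBasis n b 0 ∈ LinearMap.ker ((fBasis n b).coord 0) := h1 (by rw [h]; trivial)
  rw [LinearMap.mem_ker, Module.Basis.coord_apply, Module.Basis.repr_self,
    Finsupp.single_eq_same] at h2
  exact one_ne_zero h2

/-- The Verma module of `sl₂` is irreducible if and only if its highest weight is not a natural
number. -/
theorem isIrreducible_vermaSl2_iff :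
    LieModule.IsIrreducible ℂ (sl2 n) (VermaSl2 n b) ↔ ¬ ∃ k : ℕ, b = k := by
  constructor
  · rintro h ⟨m, rfl⟩
    -- the vectors `f^k v` with `k > m` span a proper non-zero submodule
    let N : LieSubmodule ℂ (sl2 n) (VermaSl2 n m) :=
      { Submodule.span ℂ (fPow n m '' Set.Ioi m) with
        lie_mem := fun {x v} hv => lie_mem_span_fPow (s := Set.Ioi m)
          (fun k hk => Nat.lt_succ_of_lt hk)
          (fun k hk => (Nat.lt_succ_iff_lt_or_eq.mp hk).imp id fun h => by rw [h]) x hv }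
    have hN : fPow n m (m + 1) ∈ N := Submodule.subset_span ⟨m + 1, Nat.lt_succ_self m, rfl⟩
    rcases IsSimpleOrder.eq_bot_or_eq_top N with h0 | h0
    · rw [h0, LieSubmodule.mem_bot, ← fBasis_apply] at hN
      exact (fBasis n m).ne_zero _ hN
    · have h1 : N.toSubmodule ≤ LinearMap.ker ((fBasis n m).coord 0) := by
        refine Submodule.span_le.mpr ?_
        rintro _ ⟨k, hk, rfl⟩
        rw [SetLike.mem_coe, LinearMap.mem_ker, ← fBasis_apply, Module.Basis.coord_apply,
          Module.Basis.repr_self, Finsupp.single_eq_of_ne (Nat.ne_of_lt (Nat.zero_lt_of_lt hk))]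
      have h2 : fBasis n m 0 ∈ LinearMap.ker ((fBasis n (m : ℂ)).coord 0) :=
        h1 (by rw [h0]; trivial)
      rw [LinearMap.mem_ker, Module.Basis.coord_apply, Module.Basis.repr_self,
        Finsupp.single_eq_same] at h2
      exact one_ne_zero h2
  · intro hb
    have : Nontrivial (VermaSl2 n b) := ⟨⟨fBasis n b 0, 0, (fBasis n b).ne_zero 0⟩⟩
    refine LieModule.IsIrreducible.mk fun N hN => ?_
    obtain ⟨v, hv, hv0⟩ : ∃ v ∈ N, v ≠ 0 := by
      by_contra! h
      exact hN ((LieSubmodule.eq_bot_iff N).mpr h)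
    obtain ⟨k, hk⟩ := Finsupp.ne_iff.mp ((fBasis n b).repr.map_ne_zero_iff.mpr hv0)
    have hk' := fPow_mem N hv hk
    clear hk
    induction k with
    | zero => exact eq_top_of_vac_mem hk'
    | succ k ih =>
      refine ih ?_
      have h1 := N.lie_mem (x := sl2E n) hk'
      rw [lie_e_fPow_succ] at h1
      exact (N.toSubmodule.smul_mem_iff (mul_ne_zero (Nat.cast_add_one_ne_zero k)
        (sub_ne_zero.mpr fun h => hb ⟨k, h⟩))).mp h1

end Sl2

end Galilei

end

theorem theorem2 (n : ℕ) (a b : ℂ) (ha : a ≠ 0) :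
    Nonempty (Galilei.Verma n a b ≃ₗ⁅ℂ, Galilei.Alg n⁆
      Galilei.Oscillator n (Galilei.VermaHeis n a) ⊗[ℂ]
        Galilei.Inflation n
          (Galilei.VermaSl2 n (b + 1 / 2 * (Galilei.ell n + 1 / 2) ^ 2))) ∧
    LieModule.IsIrreducible ℂ (Galilei.Alg n)
      (Galilei.SimpleQuotient (Galilei.Alg n) (Galilei.Verma n a b)) ∧
    Nonempty (Galilei.SimpleQuotient (Galilei.Alg n) (Galilei.Verma n a b) ≃ₗ⁅ℂ, Galilei.Alg n⁆
      Galilei.Oscillator n (Galilei.VermaHeis n a) ⊗[ℂ]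
        Galilei.Inflation n
          (Galilei.SimpleQuotient (Galilei.sl2 n)
            (Galilei.VermaSl2 n (b + 1 / 2 * (Galilei.ell n + 1 / 2) ^ 2)))) ∧
    (LieModule.IsIrreducible ℂ (Galilei.Alg n) (Galilei.Verma n a b) ↔
      ¬ ∃ k : ℕ, b + (Galilei.ell n + 1 / 2) ^ 2 / 2 = k) := by
  have : NeZero a := ⟨ha⟩
  let φ := Galilei.vermaEquiv n a b
  let W := Galilei.VermaSl2 n (Galilei.shifted n b)
  -- the submodules of the Verma module correspond to those of the Verma module of `sl₂`
  let σ : LieSubmodule ℂ (Galilei.sl2 n) W ≃o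
      LieSubmodule ℂ (Galilei.Alg n) (Galilei.Verma n a b) :=
    (Galilei.fockSubmoduleEquiv n a W).trans (LieSubmodule.orderIsoMapComap φ).symm
  have hJ := Galilei.OrderIso.map_sSup_ne_top σ
  refine ⟨⟨φ.trans (Galilei.fockTensorEquiv n a W)⟩, ?_, ⟨?_⟩, ?_⟩
  · refine Galilei.isIrreducible_simpleQuotient ?_
    rw [← hJ, Ne, map_eq_top_iff]
    exact Galilei.sl2_sSup_ne_top
  · refine LieModuleEquiv.trans (Galilei.simpleQuotientEquiv
      ((Galilei.fockMap a (LieSubmodule.Quotient.mk' _)).comp φ.toLieModuleHom) ?_ ?_)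
      (Galilei.fockTensorEquiv n a (Galilei.SimpleQuotient (Galilei.sl2 n) W))
    · exact (Galilei.fockMap_surjective (LieSubmodule.Quotient.surjective_mk' _)).comp φ.surjective
    · rw [← hJ]
      rfl
  · have e : b + (Galilei.ell n + 1 / 2) ^ 2 / 2 = Galilei.shifted n b := by
      rw [Galilei.shifted]; ring
    rw [e, ← Galilei.isIrreducible_vermaSl2_iff (n := n)]
    exact σ.symm.isSimpleOrder_iff
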